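/- Let $m>0$, $\lambda>0$ and $\chi$ be real numbers with $\chi^2>\lambda^2$ (for hydrogen-like atoms $\chi=\pm(j+\tfrac12)$), put $\gamma=\sqrt{\chi^2-\lambda^2}$, and consider the radial Dirac equations on $r>0$ with $|\varepsilon|<m$: $$f'+\frac{1+\chi}{r}f-\Big(\varepsilon+m+\frac{\lambda}{r}\Big)g=0,\qquad g'+\frac{1-\chi}{r}g+\Big(\varepsilon-m+\frac{\lambda}{r}\Big)f=0 .$$ A bound state of energy $\varepsilon$ is a (complex-valued, differentiable) solution with $rf,\,rg\in L^2(0,\infty)$; if $\gamma<\tfrac12$ it is moreover required that $r^\gamma f,\,r^\gamma g\in L^1(0,1)$. Let $q=2r\sqrt{m^2-\varepsilon^2}$, and for $\operatorname{Im}z<0$ let $$\mathcal L^\gamma(f)(z)=\int_0^\infty e^{-izq}q^\gamma f(q)\,dq,\qquad \eta=-\gamma-\frac{\lambda\varepsilon}{\sqrt{m^2-\varepsilon^2}},\qquad \tilde\eta=-\gamma+\frac{\lambda\varepsilon}{\sqrt{m^2-\varepsilon^2}} .$$ Call $n\in\{0,1,2,\dots\}$ admissible if $n\ge1$ or $\chi<0$,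 and for such $n$ let $\varepsilon_n=m\big(1+\lambda^2/(\gamma+n)^2\big)^{-1/2}$, $k_n=\sqrt{(m+\varepsilon_n)/(m-\varepsilon_n)}$ and $c_n^{\pm}=-\gamma+\chi\pm\lambda k_n$. 1. Let $(f,g)$ be a bound state of energy $\varepsilon$. Then $f,g=O(r^{\gamma-1})$ as $r\to0^+$. Regarding $f,g$ as functions of $q$, the integrals defining $F=\mathcal L^\gamma(f)$ and $G=\mathcal L^\gamma(g)$ converge absolutely, $F$ and $G$ are analytic in $\operatorname{Im}z<0$ and tend to $0$ as $z\to-i\infty$ along the imaginary axis, and on $\operatorname{Im}z<0$ $$(-z\partial_z+\chi-\gamma)F-\Big(\tfrac i2\sqrt{\tfrac{m+\varepsilon}{m-\varepsilon}}\,\partial_z+\lambda\Big)G=0,\qquad (-z\partial_z-\chi-\gamma)G-\Big(\tfrac i2\sqrt{\tfrac{m-\varepsilon}{m+\varepsilon}}\,\partial_z-\lambda\Big)F=0. \quad(*)$$ 2. Let $|\varepsilon|<m$ and let $(F,G)$ be a solution of $(*)$ that is analytic in $\operatorname{Im}z<0$, not identically zero there, and tends to $0$ as $z\to-i\infty$ along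 the imaginary axis. Then there is an admissible $n$ with $\tilde\eta=n$ and $\eta=-n-2\gamma$, and $(F,G)$ is a constant multiple of the $\Phi_n$ of part 4. 3. For $|\varepsilon|<m$ and every integer $n\ge0$, $\tilde\eta=n$ if and only if $\varepsilon=m\big(1+\lambda^2/(\gamma+n)^2\big)^{-1/2}$. A nonzero bound state of energy $\varepsilon$ exists if and only if $\varepsilon=\varepsilon_n$ for some admissible $n$. 4. For every admissible $n$ one has $|\varepsilon_n|<m$. With $x=\tfrac12+iz$ and principal powers, put $$\Phi_n(z)=c_n^-\binom{1}{-1/k_n}x^{-2\gamma}{}_2F_1\big(-n,2\gamma;2\gamma+1;\tfrac1x\big)+c_n^+\binom{1}{1/k_n}x^{-2\gamma}{}_2F_1\big(-n+1,2\gamma;2\gamma+1;\tfrac1x\big),$$ $$\binom{f_n}{g_n}(q)=\frac{q^{\gamma-1}e^{-q/2}}{\Gamma(2\gamma)}\left[c_n^-\binom{1}{-1/k_n}{}_1F_1(-n;2\gamma+1;q)+c_n^+\binom{1}{1/k_n}{}_1F_1(-n+1;2\gamma+1;q)\right]$$ (for $n=0$ the terms with $c_0^+=0$ are absent). Then $\Phi_n$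 is a nonzero solution of $(*)$ for $\varepsilon=\varepsilon_n$, analytic in $\operatorname{Im}z<0$ and tending to $0$ as $z\to-i\infty$ along the imaginary axis; $(f_n,g_n)$ with $q=2r\sqrt{m^2-\varepsilon_n^2}$ is a nonzero bound state of energy $\varepsilon_n$, and every bound state of energy $\varepsilon_n$ is a constant multiple of it; $\mathcal L^\gamma(f_n,g_n)=\Phi_n$ on $\operatorname{Im}z<0$; and $\Phi_n$ is inverted by the constant dual wavelet $\chi^\gamma=1/(2\pi\Gamma(\gamma))$: for every real $q\neq0$, $$\lim_{N\to\infty}\int_{-N}^{N}db\int_0^\infty\frac{da}{a^2}\,a^{\gamma-1/2}\,\Phi_n(b-ia)\,\frac{a^{3/2}e^{ibq}}{2\pi\Gamma(\gamma)}=\theta(q)\binom{f_n}{g_n}(q),$$ where $\theta(q)=1$ for $q>0$ and $\theta(q)=0$ for $q<0$, and for each $N$ the double integral converges absolutely. -/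

import Mathlib

namespace DiracCoulomb

noncomputable section

/-- `γ = √(χ² - λ²)`. -/
def gam (lam χ : ℝ) : ℝ := √(χ ^ 2 - lam ^ 2)

/-- `√(m² - ε²)`; the dimensionless radial variable is `q = 2 r √(m² - ε²)`. -/
def kap (m ε : ℝ) : ℝ := √(m ^ 2 - ε ^ 2)

/-- `η = -γ - λ ε / √(m² - ε²)`. -/
def eta (m lam χ ε : ℝ) : ℝ := -gam lam χ - lam * ε / kap m ε

/-- `η̃ = -γ + λ ε / √(m² - ε²)`. -/
def etaTilde (m lam χ ε : ℝ) : ℝ := -gam lam χ + lam * ε / kap m ε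

/-- `ε_n = m (1 + λ² / (γ + n)²) ^ (-1/2)`. -/
def energy (m lam χ : ℝ) (n : ℕ) : ℝ :=
  m * (1 + lam ^ 2 / (gam lam χ + n) ^ 2) ^ (-(1 / 2) : ℝ)

/-- The radial quantum numbers that occur: every `n ≥ 0` if `χ < 0`, every `n ≥ 1` if `χ > 0`. -/
def Admissible (χ : ℝ) (n : ℕ) : Prop := n = 0 → χ < 0

/-- The radial Dirac equations on `r > 0` for the Coulomb potential `-λ / r`,
`f' + (1+χ)/r f - (ε + m + λ/r) g = 0` and `g' + (1-χ)/r g + (ε - m + λ/r) f = 0`. -/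
def RadialDirac (m lam χ ε : ℝ) (f g : ℝ → ℂ) : Prop :=
  ∀ r : ℝ, 0 < r →
    DifferentiableAt ℝ f r ∧ DifferentiableAt ℝ g r ∧
    deriv f r + (((1 + χ) / r : ℝ) : ℂ) * f r - ((ε + m + lam / r : ℝ) : ℂ) * g r = 0 ∧
    deriv g r + (((1 - χ) / r : ℝ) : ℂ) * g r + ((ε - m + lam / r : ℝ) : ℂ) * f r = 0

/-- `f ∈ L¹_loc([0,∞), r^γ dr)` near the origin. -/
def LocIntegrableAtZero (γ : ℝ) (f : ℝ → ℂ) : Prop :=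
  MeasureTheory.IntegrableOn (fun r : ℝ => ((r ^ γ : ℝ) : ℂ) * f r) (Set.Ioc 0 1)

/-- Bound states at energy `ε`: solutions of the radial equations with `r f` and `r g` square
integrable on `(0,∞)`. If `γ < 1/2`, both behaviours `r ^ (-1 ± γ)` at the origin are square
integrable, and the solution is required in addition to lie in the domain
`L¹_loc([0,∞), r^γ dr)` of the transform. -/
structure IsBoundState (m lam χ ε : ℝ) (f g : ℝ → ℂ) : Prop where
  dirac : RadialDirac m lam χ ε f g
  sq_f : MeasureTheory.MemLp (fun r : ℝ => (r : ℂ) * f r) 2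
    (MeasureTheory.volume.restrict (Set.Ioi 0))
  sq_g : MeasureTheory.MemLp (fun r : ℝ => (r : ℂ) * g r) 2
    (MeasureTheory.volume.restrict (Set.Ioi 0))
  zero_f : gam lam χ < 1 / 2 → LocIntegrableAtZero (gam lam χ) f
  zero_g : gam lam χ < 1 / 2 → LocIntegrableAtZero (gam lam χ) g

/-- `f` as a function of `q = 2 r √(m² - ε²)`. -/
def inQ (m ε : ℝ) (f : ℝ → ℂ) (q : ℝ) : ℂ := f (q / (2 * kap m ε))

/-- A function of `q = 2 r √(m² - ε²)` as a function of `r`. -/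
def inR (m ε : ℝ) (f : ℝ → ℂ) (r : ℝ) : ℂ := f (2 * kap m ε * r)

/-- The open lower half-plane. -/
def lowerHalfPlane : Set ℂ := {z : ℂ | z.im < 0}

/-- The integrand `e^{-izq} q^γ f(q)`. -/
def transformIntegrand (γ : ℝ) (f : ℝ → ℂ) (z : ℂ) (q : ℝ) : ℂ :=
  Complex.exp (-(Complex.I * z * (q : ℂ))) * ((q ^ γ : ℝ) : ℂ) * f q

/-- `𝓛^γ(f)(z) = ∫₀^∞ e^{-izq} q^γ f(q) dq`. -/
def transform (γ : ℝ) (f : ℝ → ℂ) (z : ℂ) : ℂ :=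
  ∫ q in Set.Ioi (0 : ℝ), transformIntegrand γ f z q

/-- The radial equations after the transform, on the open lower half-plane. -/
def TransformedDirac (m lam χ ε : ℝ) (F G : ℂ → ℂ) : Prop :=
  ∀ z ∈ lowerHalfPlane,
    (-(z * deriv F z) + ((χ - gam lam χ : ℝ) : ℂ) * F z)
      - (Complex.I / 2 * ((√((m + ε) / (m - ε)) : ℝ) : ℂ) * deriv G z + (lam : ℂ) * G z) = 0 ∧
    (-(z * deriv G z) + ((-χ - gam lam χ : ℝ) : ℂ) * G z)
      - (Complex.I / 2 * ((√((m - ε) / (m + ε)) : ℝ) : ℂ) * deriv F z - (lam : ℂ) * F z) = 0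

/-- Analytic solutions of the transformed equations in the open lower half-plane that vanish as
`z → -i∞` along the imaginary axis. -/
structure IsAnalyticSolution (m lam χ ε : ℝ) (F G : ℂ → ℂ) : Prop where
  analytic_F : AnalyticOnNhd ℂ F lowerHalfPlane
  analytic_G : AnalyticOnNhd ℂ G lowerHalfPlane
  system : TransformedDirac m lam χ ε F G
  lim_F : Filter.Tendsto (fun a : ℝ => F (-(Complex.I * (a : ℂ)))) Filter.atTop (nhds 0)
  lim_G : Filter.Tendsto (fun a : ℝ => G (-(Complex.I * (a : ℂ)))) Filter.atTop (nhds 0)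

/-- The confluent (degenerate) hypergeometric function `₁F₁(a, b; x)`. -/
def oneFOne (a b x : ℂ) : ℂ :=
  ∑' k : ℕ, (ascPochhammer ℂ k).eval a / ((ascPochhammer ℂ k).eval b * (k.factorial : ℂ)) * x ^ k

/-- `-γ + χ - λ √((m + ε_n) / (m - ε_n))`. -/
def cMinus (m lam χ : ℝ) (n : ℕ) : ℝ :=
  -gam lam χ + χ - lam * √((m + energy m lam χ n) / (m - energy m lam χ n))

/-- `-γ + χ + λ √((m + ε_n) / (m - ε_n))`. -/
def cPlus (m lam χ : ℝ) (n : ℕ) : ℝ :=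
  -gam lam χ + χ + lam * √((m + energy m lam χ n) / (m - energy m lam χ n))

/-- `√((m - ε_n) / (m + ε_n))`. -/
def lowerRatio (m lam χ : ℝ) (n : ℕ) : ℝ :=
  √((m - energy m lam χ n) / (m + energy m lam χ n))

/-- `(1/2 + iz)^{-2γ} ₂F₁(a, 2γ; 2γ + 1; 1 / (1/2 + iz))`. -/
def gaussFactor (γ : ℝ) (a z : ℂ) : ℂ :=
  (1 / 2 + Complex.I * z) ^ (-(2 * (γ : ℂ))) *
    ordinaryHypergeometric a (2 * (γ : ℂ)) (2 * (γ : ℂ) + 1) (1 / (1 / 2 + Complex.I * z))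

/-- Upper component of the transformed eigenfunction `Φ_n`. -/
def PhiF (m lam χ : ℝ) (n : ℕ) (z : ℂ) : ℂ :=
  (cMinus m lam χ n : ℂ) * gaussFactor (gam lam χ) (-(n : ℂ)) z
    + (cPlus m lam χ n : ℂ) * gaussFactor (gam lam χ) (-(n : ℂ) + 1) z

/-- Lower component of the transformed eigenfunction `Φ_n`. -/
def PhiG (m lam χ : ℝ) (n : ℕ) (z : ℂ) : ℂ :=
  (lowerRatio m lam χ n : ℂ) *
    (-((cMinus m lam χ n : ℂ) * gaussFactor (gam lam χ) (-(n : ℂ)) z)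
      + (cPlus m lam χ n : ℂ) * gaussFactor (gam lam χ) (-(n : ℂ) + 1) z)

/-- `q^{γ-1} e^{-q/2} ₁F₁(a, 2γ + 1; q) / Γ(2γ)`. -/
def kummerFactor (γ : ℝ) (a : ℂ) (q : ℝ) : ℂ :=
  ((1 / Real.Gamma (2 * γ) * q ^ (γ - 1) * Real.exp (-(q / 2)) : ℝ) : ℂ) *
    oneFOne a (2 * (γ : ℂ) + 1) (q : ℂ)

/-- Upper component of the radial eigenfunction, as a function of `q`. -/
def eigenF (m lam χ : ℝ) (n : ℕ) (q : ℝ) : ℂ :=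
  (cMinus m lam χ n : ℂ) * kummerFactor (gam lam χ) (-(n : ℂ)) q
    + (cPlus m lam χ n : ℂ) * kummerFactor (gam lam χ) (-(n : ℂ) + 1) q

/-- Lower component of the radial eigenfunction, as a function of `q`. -/
def eigenG (m lam χ : ℝ) (n : ℕ) (q : ℝ) : ℂ :=
  (lowerRatio m lam χ n : ℂ) *
    (-((cMinus m lam χ n : ℂ) * kummerFactor (gam lam χ) (-(n : ℂ)) q)
      + (cPlus m lam χ n : ℂ) * kummerFactor (gam lam χ) (-(n : ℂ) + 1) q)

/-- The (constant) dual wavelet `χ^γ(q) = 1 / (2π Γ(γ))`. -/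
def dualWavelet (γ : ℝ) (_q : ℝ) : ℝ := 1 / (2 * Real.pi * Real.Gamma γ)

/-- The dual wavelet moved by the `ax + b` group, `a^{3/2} e^{ibq} χ^γ(aq)`. -/
def dualWaveletAt (γ b a q : ℝ) : ℂ :=
  ((a ^ (3 / 2 : ℝ) : ℝ) : ℂ) * Complex.exp (Complex.I * (b : ℂ) * (q : ℂ)) *
    (dualWavelet γ (a * q) : ℂ)

/-- The integrand of the inverse transform with respect to `da db`: the wavelet coefficient
`a^{γ-1/2} F(b - ia)` times the dual wavelet, with the invariant weight `1 / a²`. -/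
def inverseIntegrand (γ : ℝ) (F : ℂ → ℂ) (q b a : ℝ) : ℂ :=
  ((a ^ (γ - 1 / 2) : ℝ) : ℂ) * F ((b : ℂ) - Complex.I * (a : ℂ)) *
    dualWaveletAt γ b a q / ((a ^ 2 : ℝ) : ℂ)

/-- The inverse transform of `F` at `q` converges to `v`: the integral over `|b| ≤ N`, `a > 0`
converges absolutely for every `N`, and tends to `v` as `N → ∞`. -/
def InvertsTo (γ : ℝ) (F : ℂ → ℂ) (q : ℝ) (v : ℂ) : Prop :=
  (∀ N : ℝ, MeasureTheory.IntegrableOn (fun p : ℝ × ℝ => inverseIntegrand γ F q p.1 p.2)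
    (Set.Icc (-N) N ×ˢ Set.Ioi (0 : ℝ))) ∧
  Filter.Tendsto
    (fun N : ℝ => ∫ b in (-N)..N, ∫ a in Set.Ioi (0 : ℝ), inverseIntegrand γ F q b a)
    Filter.atTop (nhds v)

end

end DiracCoulomb

/-! Multiplied by `q`, the radial system has coefficients linear in `q`. Under `𝓛^γ`, multiplication
by `q` becomes `i∂_z`, and integration by parts turns `q f'` into `-(γ+1)F - zF'`, so the transform
is again a first-order system, now with finite singular points `z = ±i/2`. Put `x = 1/2 + iz`, so
that the lower half-plane becomes `Re x > 1/2`, and write `k = √((m+ε)/(m-ε))`, `ν = η̃`, `τ =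
λm/√(m²-ε²)`. The combinations `p = F - kG`, `r = F + kG` diagonalize the derivative terms: `x p' =
-(ν+2γ) p - (τ-χ) r`, `(x-1) r' = ν r + (χ+τ) p`, with `τ² - χ² = ν(ν+2γ)`. Eliminating `r` shows
that `h = x^{ν+2γ} · x p'` satisfies the Euler equation `(x-1) h' = ν h`. The singular point `x = 1`
lies inside the domain, so analyticity forces either `h = 0` or `ν = n ∈ ℕ` and `h = C (x-1)^n`. If
`h = 0`, decay at infinity kills `p` and then `r`. Hence a nonzero solution has `ν = n`, and two
solutions with proportional `h` are proportional: this is both quantization and uniqueness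
(`ReducedSolution.deriv_alternative`, `ReducedSolution.eq_zero_of_deriv_eq_zero`). The case `n = 0`,
`χ > 0` is excluded by evaluating the system at `x = 1`.

To apply this to bound states one must know that they are regular at the origin (`QBound.isBigO`).
At every energy an explicit Kummer solution of size `O(q^{γ-1})` exists. A nonzero Wronskian with it
would force size at least `q^{-γ-1}`, contradicting square integrability when `γ ≥ 1/2` and the
extra `L¹` condition when `γ < 1/2`.

Conversely, for admissible `n` the Kummer series that occur are polynomials. Termwise, `q^{s-1-γ}
e^{-q/2}` transforms to `Γ(s) x^{-s}`, which turns `₁F₁` into `₂F₁` and gives `Φ_n`. Injectivity of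
the transform carries nonvanishing and uniqueness between the two sides. For the inversion, the
`a`-integral produces `Γ(γ) t^{-γ}`, which cancels the weight `t^γ` and the normalization of the
wavelet; what remains is pointwise Fourier inversion of the eigenfunction extended by zero. -/

namespace DiracCoulomb

open MeasureTheory Set Filter Topology Asymptotics

/-! ### The weighted Laplace transform: convergence, analyticity, integration by parts, injectivity
-/

section

/-- `e^{-aq} q^γ f(q)` is integrable on `(0,∞)` for every `a > 0`. -/
def LaplaceClass (γ : ℝ) (f : ℝ → ℂ) : Prop :=
  ∀ a : ℝ, 0 < a →
    IntegrableOn (fun q : ℝ => ((Real.exp (-(a * q)) : ℝ) : ℂ) * (((q ^ γ : ℝ) : ℂ) * f q)) (Ioi 0)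

namespace LaplaceClass

variable {γ : ℝ} {f g : ℝ → ℂ}

/-- Write `w = (w e^{aq}) e^{-aq}`: the first factor is bounded and the second is covered by the
class at rate `a`. The integrability of transform integrands and of moments is reduced to this. -/
theorem integrableOn_mul (hf : LaplaceClass γ f) {w : ℝ → ℂ} (hw : Continuous w) {a C : ℝ}
    (ha : 0 < a) (hb : ∀ q, 0 < q → ‖w q‖ ≤ C * Real.exp (-(a * q))) :
    IntegrableOn (fun q : ℝ => w q * (((q ^ γ : ℝ) : ℂ) * f q)) (Ioi 0) := by
  have h1 : IntegrableOn (fun q : ℝ => (w q * ((Real.exp (a * q) : ℝ) : ℂ)) *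
      (((Real.exp (-(a * q)) : ℝ) : ℂ) * (((q ^ γ : ℝ) : ℂ) * f q))) (Ioi 0) := by
    refine Integrable.bdd_mul (c := C) (hf a ha) ?_ ?_
    · have : Continuous fun q : ℝ => w q * ((Real.exp (a * q) : ℝ) : ℂ) := by fun_prop
      exact this.aestronglyMeasurable
    · refine (ae_restrict_iff' measurableSet_Ioi).2 (ae_of_all _ fun q hq => ?_)
      have h := mul_le_mul_of_nonneg_right (hb q hq) (Real.exp_pos (a * q)).le
      rw [mul_assoc, ← Real.exp_add, neg_add_cancel, Real.exp_zero, mul_one] at h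
      rwa [norm_mul, Complex.norm_real, Real.norm_of_nonneg (Real.exp_pos _).le]
  refine h1.congr_fun (fun q _ => ?_) measurableSet_Ioi
  have : ((Real.exp (a * q) : ℝ) : ℂ) * ((Real.exp (-(a * q)) : ℝ) : ℂ) = 1 := by
    rw [← Complex.ofReal_mul, ← Real.exp_add]; simp
  linear_combination (w q * (((q ^ γ : ℝ) : ℂ) * f q)) * this

theorem norm_exp_neg_I_mul (z : ℂ) (q : ℝ) :
    ‖Complex.exp (-(Complex.I * z * (q : ℂ)))‖ = Real.exp (z.im * q) := by
  rw [Complex.norm_exp]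
  congr 1
  simp

theorem integrableOn_transformIntegrand (hf : LaplaceClass γ f) {z : ℂ} (hz : z.im < 0) :
    IntegrableOn (transformIntegrand γ f z) (Ioi 0) := by
  have := hf.integrableOn_mul (w := fun q : ℝ => Complex.exp (-(Complex.I * z * (q : ℂ))))
    (by fun_prop) (a := -z.im) (C := 1) (by linarith) (fun q _ => by
      rw [norm_exp_neg_I_mul]; simp)
  refine this.congr_fun (fun q _ => ?_) measurableSet_Ioi
  simp only [transformIntegrand]; ring

theorem congr (hf : LaplaceClass γ f) (h : ∀ q, 0 < q → f q = g q) : LaplaceClass γ g :=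
  fun a ha => (hf a ha).congr_fun (fun q hq => by simp only [h q hq]) measurableSet_Ioi

theorem add (hf : LaplaceClass γ f) (hg : LaplaceClass γ g) :
    LaplaceClass γ (fun q => f q + g q) := fun a ha =>
  IntegrableOn.congr_fun ((hf a ha).add (hg a ha))
    (fun q _ => by simp only [Pi.add_apply]; ring) measurableSet_Ioi

theorem const_mul (c : ℂ) (hf : LaplaceClass γ f) : LaplaceClass γ (fun q => c * f q) :=
  fun a ha => IntegrableOn.congr_fun (Integrable.const_mul (hf a ha) c)
    (fun q _ => by ring) measurableSet_Ioi

/-- Half of the decay rate pays for the factor: `q ≤ (2/a) e^{aq/2}`. This closure is what allows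
the transform to be differentiated within the class. -/
theorem id_mul (hf : LaplaceClass γ f) : LaplaceClass γ (fun q => (q : ℂ) * f q) := by
  intro a ha
  have := hf.integrableOn_mul (w := fun q : ℝ => ((Real.exp (-(a * q)) : ℝ) : ℂ) * q)
    (by fun_prop) (a := a / 2) (C := 2 / a) (by linarith) (fun q hq => by
      rw [norm_mul, Complex.norm_real, Complex.norm_real, Real.norm_of_nonneg (Real.exp_pos _).le,
        Real.norm_of_nonneg hq.le]
      have h1 : a / 2 * q ≤ Real.exp (a / 2 * q) :=
        (by linarith : a / 2 * q ≤ a / 2 * q + 1).trans (Real.add_one_le_exp _)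
      have h2 : q ≤ 2 / a * Real.exp (a / 2 * q) := by
        rw [div_mul_eq_mul_div, le_div_iff₀ ha]; linarith
      calc Real.exp (-(a * q)) * q ≤ Real.exp (-(a * q)) * (2 / a * Real.exp (a / 2 * q)) := by
            gcongr
        _ = 2 / a * (Real.exp (-(a * q)) * Real.exp (a / 2 * q)) := by ring
        _ = 2 / a * Real.exp (-(a / 2 * q)) := by rw [← Real.exp_add]; ring_nf)
  refine this.congr_fun (fun q _ => by ring) measurableSet_Ioi

end LaplaceClass

open LaplaceClass

variable {γ : ℝ} {f g : ℝ → ℂ}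

theorem transform_congr (h : ∀ q, 0 < q → f q = g q) (z : ℂ) :
    transform γ f z = transform γ g z :=
  setIntegral_congr_fun measurableSet_Ioi fun q hq => by simp only [transformIntegrand, h q hq]

theorem transform_add (hf : LaplaceClass γ f) (hg : LaplaceClass γ g) {z : ℂ} (hz : z.im < 0) :
    transform γ (fun q => f q + g q) z = transform γ f z + transform γ g z := by
  simp only [transform]
  rw [← integral_add (hf.integrableOn_transformIntegrand hz) (hg.integrableOn_transformIntegrand hz)]
  simp only [transformIntegrand]
  congr 1; ext q; ring

theorem transform_const_mul (c : ℂ) (f : ℝ → ℂ) (z : ℂ) :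
    transform γ (fun q => c * f q) z = c * transform γ f z := by
  simp only [transform]
  rw [← integral_const_mul]
  simp only [transformIntegrand]
  congr 1; ext q; ring

theorem isOpen_lowerHalfPlane : IsOpen lowerHalfPlane :=
  isOpen_lt Complex.continuous_im continuous_const

theorem hasDerivAt_transform (hf : LaplaceClass γ f) {z : ℂ} (hz : z.im < 0) :
    HasDerivAt (transform γ f) (-Complex.I * transform γ (fun q => (q : ℂ) * f q) z) z := by
  -- On this neighbourhood `|e^{-iwq}| = e^{q Im w}` is at most its value at `w = i Im z / 2`, so
  -- the integrand there is a dominating function.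
  have hs : {w : ℂ | w.im < z.im / 2} ∈ 𝓝 z :=
    (isOpen_lt Complex.continuous_im continuous_const).mem_nhds (by simp; linarith)
  have hb := (hf.id_mul.const_mul (-Complex.I)).integrableOn_transformIntegrand
    (z := ((z.im / 2 : ℝ) : ℂ) * Complex.I) (by simp; linarith)
  have := (hasDerivAt_integral_of_dominated_loc_of_deriv_le (μ := volume.restrict (Ioi 0))
    (F := fun w q => transformIntegrand γ f w q)
    (F' := fun w q => transformIntegrand γ (fun q => -Complex.I * ((q : ℂ) * f q)) w q)
    (x₀ := z) (bound := fun q => ‖transformIntegrand γ (fun q => -Complex.I * ((q : ℂ) * f q))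
      (((z.im / 2 : ℝ) : ℂ) * Complex.I) q‖) hs ?_ (hf.integrableOn_transformIntegrand hz)
    ((hf.id_mul.const_mul (-Complex.I)).integrableOn_transformIntegrand hz).aestronglyMeasurable
    ?_ hb.norm ?_).2
  · rw [← transform_const_mul]; exact this
  · filter_upwards [isOpen_lowerHalfPlane.mem_nhds hz] with w hw
    exact (hf.integrableOn_transformIntegrand hw).aestronglyMeasurable
  · refine (ae_restrict_iff' measurableSet_Ioi).2 (ae_of_all _ fun q hq w hw => ?_)
    simp only [transformIntegrand, norm_mul, norm_exp_neg_I_mul]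
    gcongr
    · exact le_of_lt hq
    · have hw : w.im < z.im / 2 := hw
      simp; linarith
  · refine ae_of_all _ fun q w _ => ?_
    have h1 : HasDerivAt (fun w : ℂ => -(Complex.I * w * (q : ℂ))) (-(Complex.I * 1 * (q : ℂ))) w :=
      (((hasDerivAt_id w).const_mul Complex.I).mul_const (q : ℂ)).neg
    have h2 := (h1.cexp.mul_const ((q ^ γ : ℝ) : ℂ)).mul_const (f q)
    refine h2.congr_deriv ?_
    simp only [transformIntegrand]; ring

theorem analyticOnNhd_transform (hf : LaplaceClass γ f) :
    AnalyticOnNhd ℂ (transform γ f) lowerHalfPlane :=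
  DifferentiableOn.analyticOnNhd
    (fun _ hz => (hasDerivAt_transform hf hz).differentiableAt.differentiableWithinAt)
    isOpen_lowerHalfPlane

/-- Dominated convergence: `e^{-aq} → 0` for each `q > 0`, and for `a ≥ 1` the integrand at `z = -i`
dominates. -/
theorem tendsto_transform_zero (hf : LaplaceClass γ f) :
    Tendsto (fun a : ℝ => transform γ f (-(Complex.I * (a : ℂ)))) atTop (𝓝 0) := by
  have h0 : (0 : ℂ) = ∫ _ in Ioi (0 : ℝ), (0 : ℂ) := by simp
  rw [h0]
  refine tendsto_integral_filter_of_dominated_convergence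
    (fun q => ‖transformIntegrand γ f (-Complex.I) q‖) ?_ ?_
    (hf.integrableOn_transformIntegrand (by simp)).norm ?_
  · filter_upwards [eventually_gt_atTop 0] with a ha
    exact (hf.integrableOn_transformIntegrand (by simpa using ha)).aestronglyMeasurable
  · filter_upwards [eventually_ge_atTop 1] with a ha
    refine (ae_restrict_iff' measurableSet_Ioi).2 (ae_of_all _ fun q hq => ?_)
    simp only [transformIntegrand, norm_mul, norm_exp_neg_I_mul]
    gcongr
    · exact le_of_lt hq
    · simpa using ha
  · refine (ae_restrict_iff' measurableSet_Ioi).2 (ae_of_all _ fun q hq => ?_)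
    rw [tendsto_zero_iff_norm_tendsto_zero]
    have h1 : Tendsto (fun a : ℝ => Real.exp (-(a * q))) atTop (𝓝 0) :=
      Real.tendsto_exp_neg_atTop_nhds_zero.comp (tendsto_id.atTop_mul_const hq)
    have h2 := (h1.mul_const ‖((q ^ γ : ℝ) : ℂ)‖).mul_const ‖f q‖
    simp only [zero_mul] at h2
    refine h2.congr fun a => ?_
    simp only [transformIntegrand, norm_mul, norm_exp_neg_I_mul]
    simp

/-- Integration by parts for the transform of `q f'(q)`. -/
theorem transform_id_mul_deriv {f' : ℝ → ℂ} (hf : LaplaceClass γ f) (hγ : 0 < γ)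
    (hf' : LaplaceClass γ (fun q => (q : ℂ) * f' q)) (hd : ∀ q, 0 < q → HasDerivAt f (f' q) q)
    (h0 : Tendsto (fun q : ℝ => ((q ^ (γ + 1) : ℝ) : ℂ) * f q) (𝓝[>] 0) (𝓝 0)) {z : ℂ}
    (hz : z.im < 0) :
    transform γ (fun q => (q : ℂ) * f' q) z =
      -(γ + 1) * transform γ f z - z * deriv (transform γ f) z := by
  rw [(hasDerivAt_transform hf hz).deriv]
  -- `H = e^{-izq} q^{γ+1} f` is the boundary term. It vanishes at the origin by `h0`, and at
  -- infinity because both `H` and `H'` are integrable, so no pointwise decay of `f` is needed.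
  set H : ℝ → ℂ := fun q => Complex.exp (-(Complex.I * z * (q : ℂ))) * (((q ^ (γ + 1) : ℝ) : ℂ) * f q)
    with hH
  set H' : ℝ → ℂ := fun q => transformIntegrand γ (fun q => (q : ℂ) * f' q) z q
    + ((γ + 1) * transformIntegrand γ f z q
    - Complex.I * z * transformIntegrand γ (fun q => (q : ℂ) * f q) z q) with hH'
  have hpow : ∀ q : ℝ, 0 < q → ((q ^ (γ + 1) : ℝ) : ℂ) = ((q ^ γ : ℝ) : ℂ) * q := fun q hq => by
    rw [Real.rpow_add_one hq.ne']; push_cast; ring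
  have hderiv : ∀ q ∈ Ioi (0 : ℝ), HasDerivAt H (H' q) q := by
    intro q hq
    have hq : 0 < q := hq
    have h1 : HasDerivAt (fun q : ℝ => Complex.exp (-(Complex.I * z * (q : ℂ))))
        (Complex.exp (-(Complex.I * z * (q : ℂ))) * -(Complex.I * z * 1)) q :=
      ((Complex.ofRealCLM.hasDerivAt (x := q)).const_mul (Complex.I * z)).neg.cexp
    have h2 : HasDerivAt (fun q : ℝ => ((q ^ (γ + 1) : ℝ) : ℂ))
        (((γ + 1) * q ^ γ : ℝ) : ℂ) q := by
      have := (Real.hasDerivAt_rpow_const (x := q) (p := γ + 1) (Or.inl hq.ne'))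
      simpa using this.ofReal_comp
    refine (h1.mul (h2.mul (hd q hq))).congr_deriv ?_
    simp only [hH', transformIntegrand, Pi.mul_apply, hpow q hq]
    push_cast
    ring
  have i1 := hf'.integrableOn_transformIntegrand hz
  have i2 := (hf.integrableOn_transformIntegrand hz)
  have i3 := (hf.id_mul.integrableOn_transformIntegrand hz)
  have hint' : IntegrableOn H' (Ioi 0) :=
    i1.add ((i2.const_mul (γ + 1 : ℂ)).sub (i3.const_mul (Complex.I * z)))
  have hint : IntegrableOn H (Ioi 0) :=
    i3.congr_fun (fun q hq => by simp only [transformIntegrand, hH, hpow q hq]; ring)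
      measurableSet_Ioi
  have hlim := tendsto_zero_of_hasDerivAt_of_integrableOn_Ioi hderiv hint' hint
  have hH0 : H 0 = 0 := by simp [hH, Real.zero_rpow (by linarith : γ + 1 ≠ 0)]
  have hcont : ContinuousWithinAt H (Ici 0) 0 := by
    rw [← continuousWithinAt_Ioi_iff_Ici, ContinuousWithinAt, hH0]
    have h1 : Tendsto (fun q : ℝ => Complex.exp (-(Complex.I * z * (q : ℂ)))) (𝓝[>] 0)
        (𝓝 (Complex.exp (-(Complex.I * z * ((0 : ℝ) : ℂ))))) :=
      ((by fun_prop : Continuous fun q : ℝ => Complex.exp (-(Complex.I * z * (q : ℂ)))).tendsto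
        0).mono_left nhdsWithin_le_nhds
    simpa using h1.mul h0
  have key := integral_Ioi_of_hasDerivAt_of_tendsto hcont hderiv hint' hlim
  rw [hH0, sub_zero] at key
  have e : ∫ q in Ioi (0 : ℝ), H' q = transform γ (fun q => (q : ℂ) * f' q) z
      + ((γ + 1) * transform γ f z - Complex.I * z * transform γ (fun q => (q : ℂ) * f q) z) := by
    simp only [hH', transform]
    refine (integral_add i1 ((i2.const_mul (γ + 1 : ℂ)).sub (i3.const_mul (Complex.I * z)))).trans ?_
    congr 1
    refine (integral_sub (i2.const_mul (γ + 1 : ℂ)) (i3.const_mul (Complex.I * z))).trans ?_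
    rw [integral_const_mul, integral_const_mul]
  rw [e] at key
  linear_combination key

/-- The transform is injective on continuous functions. -/
theorem eq_zero_of_transform_eq_zero (hf : LaplaceClass γ f) (hc : ContinuousOn f (Ioi 0))
    (h : ∀ z ∈ lowerHalfPlane, transform γ f z = 0) {q : ℝ} (hq : 0 < q) : f q = 0 := by
  -- The transform on the horizontal line `Im z = -1` is the Fourier transform of this function, at
  -- `z = 2πw - i`. Fourier inversion then gives `φ = 0` at points of continuity.
  set φ : ℝ → ℂ := (Ioi (0 : ℝ)).indicator (transformIntegrand γ f (-Complex.I)) with hφ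
  have hint : Integrable φ :=
    (integrable_indicator_iff measurableSet_Ioi).2 (hf.integrableOn_transformIntegrand (by simp))
  have hF : FourierTransform.fourier φ = 0 := by
    ext w
    rw [Real.fourier_real_eq_integral_exp_smul, Pi.zero_apply]
    rw [← h ((2 * Real.pi * w : ℝ) - Complex.I) (by simp [lowerHalfPlane]), transform,
      ← integral_indicator measurableSet_Ioi]
    congr 1; ext v
    by_cases hv : v ∈ Ioi (0 : ℝ)
    · simp only [hφ, indicator_of_mem hv, transformIntegrand, smul_eq_mul]
      rw [← mul_assoc, ← mul_assoc, ← Complex.exp_add]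
      congr 3
      push_cast; ring_nf
    · simp [hφ, indicator_of_notMem hv]
  have hca : ContinuousAt φ q := by
    have : ContinuousOn (transformIntegrand γ f (-Complex.I)) (Ioi 0) := by
      refine ContinuousOn.mul (ContinuousOn.mul (by fun_prop) ?_) hc
      exact Complex.continuous_ofReal.comp_continuousOn
        (continuousOn_id.rpow_const fun x hx => Or.inl (ne_of_gt hx))
    refine (this.continuousAt (Ioi_mem_nhds hq)).congr ?_
    filter_upwards [Ioi_mem_nhds hq] with x hx
    rw [hφ, indicator_of_mem hx]
  have h1 := hint.fourierInv_fourier_eq (by rw [hF]; exact integrable_zero _ _ _) hca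
  rw [hF] at h1
  have h2 : φ q = 0 := by rw [← h1]; simp [Real.fourierInv_eq]
  rw [hφ, indicator_of_mem (mem_Ioi.2 hq), transformIntegrand] at h2
  have h3 : ((q ^ γ : ℝ) : ℂ) ≠ 0 := by exact_mod_cast (Real.rpow_pos_of_pos hq γ).ne'
  simpa [h3, Complex.exp_ne_zero] using h2

end

/-! ### Pointwise Fourier inversion with symmetric cut-off -/

section

open FourierTransform

/-- Up to a constant, the Fourier transform of `t s(t)` is the derivative of `𝓕 s`, so the integral
equals a difference of boundary values, which tend to `0` by Riemann–Lebesgue. -/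
theorem tendsto_intervalIntegral_fourier_id_mul {s : ℝ → ℂ} (hs : Integrable s)
    (hts : Integrable fun t : ℝ => (t : ℂ) * s t) :
    Tendsto (fun N : ℝ => ∫ w in (-N)..N, 𝓕 (fun t : ℝ => (t : ℂ) * s t) w) atTop (𝓝 0) := by
  have hd : ∀ w : ℝ, HasDerivAt (𝓕 s)
      ((-2 * Real.pi * Complex.I) * 𝓕 (fun t : ℝ => (t : ℂ) * s t) w) w := by
    intro w
    refine (Real.hasDerivAt_fourier hs (by simpa using hts) w).congr_deriv ?_
    rw [Real.fourier_real_eq_integral_exp_smul, Real.fourier_real_eq_integral_exp_smul,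
      ← integral_const_mul]
    congr 1; ext v; simp only [smul_eq_mul]; ring
  have hc : Continuous (𝓕 (fun t : ℝ => (t : ℂ) * s t)) :=
    VectorFourier.fourierIntegral_continuous Real.continuous_fourierChar
      (by exact continuous_inner) hts
  have hpi : (-2 * Real.pi * Complex.I : ℂ) ≠ 0 := by simp [Real.pi_ne_zero]
  have e : ∀ N : ℝ, ∫ w in (-N)..N, 𝓕 (fun t : ℝ => (t : ℂ) * s t) w
      = (-2 * Real.pi * Complex.I)⁻¹ * (𝓕 s N - 𝓕 s (-N)) := by
    intro N
    rw [← intervalIntegral.integral_eq_sub_of_hasDerivAt (fun w _ => hd w)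
      ((continuous_const.mul hc).intervalIntegrable _ _), intervalIntegral.integral_const_mul,
      inv_mul_cancel_left₀ hpi]
  simp_rw [e]
  have h0 := Real.zero_at_infty_fourier s
  have h1 := h0.comp (Filter.Tendsto.mono_right tendsto_id atTop_le_cocompact)
  have h2 := h0.comp (tendsto_neg_atTop_atBot.mono_right atBot_le_cocompact)
  simpa using (h1.sub h2).const_mul ((-2 * Real.pi * Complex.I : ℂ)⁻¹)

/-- Differentiability and `φ(0) = 0` make `φ(t)/t` bounded near `0`; away from `0` division by `t`
is harmless. Hence `φ = t s` with `s` integrable. -/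
theorem tendsto_intervalIntegral_fourier_of_eq_zero {φ : ℝ → ℂ} (hφ : Integrable φ)
    (hd : DifferentiableAt ℝ φ 0) (h0 : φ 0 = 0) :
    Tendsto (fun N : ℝ => ∫ w in (-N)..N, 𝓕 φ w) atTop (𝓝 0) := by
  set s : ℝ → ℂ := fun t => ((t : ℂ))⁻¹ * φ t with hs
  have hts : (fun t : ℝ => (t : ℂ) * s t) = φ := by
    ext t
    by_cases ht : t = 0
    · simp [ht, h0]
    · have : (t : ℂ) ≠ 0 := by exact_mod_cast ht
      simp [hs, this]
  have hm : AEStronglyMeasurable s volume :=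
    (Complex.measurable_ofReal.inv.aestronglyMeasurable).mul hφ.aestronglyMeasurable
  obtain ⟨C, hC⟩ := hd.isBigO_sub.bound
  obtain ⟨δ, hδ, hball⟩ := Metric.eventually_nhds_iff.1 hC
  have hsi : Integrable s := by
    have hb : Integrable fun t : ℝ => (Ioo (-δ) δ).indicator (fun _ => |C|) t + δ⁻¹ * ‖φ t‖ := by
      refine Integrable.add ?_ (hφ.norm.const_mul _)
      rw [integrable_indicator_iff measurableSet_Ioo]
      simp
    refine hb.mono' hm (ae_of_all _ fun t => ?_)
    simp only [hs, norm_mul, norm_inv, Complex.norm_real, Real.norm_eq_abs]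
    by_cases ht : t ∈ Ioo (-δ) δ
    · rw [indicator_of_mem ht]
      have h1 : ‖φ t‖ ≤ C * |t| := by
        simpa [h0] using hball (y := t) (by simpa [abs_lt] using ht)
      have h2 : |t|⁻¹ * ‖φ t‖ ≤ |C| := by
        by_cases ht0 : t = 0
        · simp [ht0]
        · have : 0 < |t| := abs_pos.2 ht0
          rw [inv_mul_le_iff₀ this]
          nlinarith [le_abs_self C]
      have : 0 ≤ δ⁻¹ * ‖φ t‖ := by positivity
      linarith
    · rw [indicator_of_notMem ht, zero_add]
      have : δ ≤ |t| := by
        by_contra h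
        exact ht (abs_lt.1 (not_le.1 h))
      gcongr
  have := tendsto_intervalIntegral_fourier_id_mul hsi (by rw [hts]; exact hφ)
  rwa [hts] at this

/-- Subtracting `φ(0) e^{-πt²}` reduces to vanishing value at `0`; the Gaussian is its own Fourier
transform and has integral `1`. -/
theorem tendsto_intervalIntegral_fourier_at_zero {φ : ℝ → ℂ} (hφ : Integrable φ)
    (hd : DifferentiableAt ℝ φ 0) :
    Tendsto (fun N : ℝ => ∫ w in (-N)..N, 𝓕 φ w) atTop (𝓝 (φ 0)) := by
  set G : ℝ → ℂ := fun x => Complex.exp (-Real.pi * 1 * (x : ℂ) ^ 2) with hG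
  have hGi : Integrable G := by
    have := integrable_cexp_neg_mul_sq (b := (Real.pi : ℂ)) (by simpa using Real.pi_pos)
    simpa [hG] using this
  have hGF : 𝓕 G = G := by
    rw [hG, fourier_gaussian_pi (by simp)]
    simp
  have hG1 : ∫ x, G x = 1 := by
    have := integral_gaussian_complex (b := (Real.pi : ℂ)) (by simpa using Real.pi_pos)
    have hpi : (Real.pi : ℂ) ≠ 0 := by simp [Real.pi_ne_zero]
    simpa [hG, div_self hpi] using this
  have hGd : Differentiable ℝ G := by
    intro x
    have : DifferentiableAt ℝ (fun x : ℝ => (-Real.pi * 1 * (x : ℂ) ^ 2 : ℂ)) x := by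
      have := Complex.ofRealCLM.differentiableAt (x := x)
      exact (this.pow 2).const_mul _
    exact this.cexp
  set ψ : ℝ → ℂ := fun t => φ t - φ 0 * G t with hψ
  have hψi : Integrable ψ := hφ.sub (hGi.const_mul _)
  have h1 := tendsto_intervalIntegral_fourier_of_eq_zero hψi
    (hd.sub ((hGd 0).const_mul _)) (by simp [hψ, hG])
  have hF : ∀ w, 𝓕 φ w = 𝓕 ψ w + φ 0 * G w := by
    intro w
    rw [← congrFun hGF w]
    simp only [Real.fourier_real_eq_integral_exp_smul, smul_eq_mul, hψ]
    have hb : ∀ {k : ℝ → ℂ}, Integrable k → Integrable fun v : ℝ =>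
        Complex.exp (((-2 * Real.pi * v * w : ℝ) : ℂ) * Complex.I) * k v := fun hk => by
      refine Integrable.bdd_mul (c := 1) hk (by fun_prop) (ae_of_all _ fun v => ?_)
      rw [Complex.norm_exp_ofReal_mul_I]
    rw [← integral_const_mul, ← integral_add (hb hψi) ((hb hGi).const_mul _)]
    congr 1; ext v; ring
  have hc : Continuous (𝓕 ψ) :=
    VectorFourier.fourierIntegral_continuous Real.continuous_fourierChar
      (by exact continuous_inner) hψi
  have h2 : Tendsto (fun N : ℝ => ∫ w in (-N)..N, G w) atTop (𝓝 1) := by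
    rw [← hG1]
    exact intervalIntegral_tendsto_integral hGi tendsto_neg_atTop_atBot tendsto_id
  have h3 := h1.add (h2.const_mul (φ 0))
  simp only [zero_add, mul_one] at h3
  refine h3.congr fun N => ?_
  rw [← intervalIntegral.integral_const_mul, ← intervalIntegral.integral_add
    (hc.intervalIntegrable _ _) ((hGd.continuous.const_mul _).intervalIntegrable _ _)]
  simp_rw [hF]

/-- Pointwise Fourier inversion at a point of differentiability. -/
theorem tendsto_intervalIntegral_fourierIntegral {φ : ℝ → ℂ} (hφ : Integrable φ) {x : ℝ}
    (hd : DifferentiableAt ℝ φ x) :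
    Tendsto (fun N : ℝ => ∫ b in (-N)..N, ((2 * Real.pi : ℝ) : ℂ)⁻¹ *
        (Complex.exp (Complex.I * b * x) * ∫ t : ℝ, Complex.exp (-(Complex.I * b * t)) * φ t))
      atTop (𝓝 (φ x)) := by
  have hφ' : Integrable fun t => φ (t + x) := hφ.comp_add_right x
  have h := tendsto_intervalIntegral_fourier_at_zero hφ' (by
    have : DifferentiableAt ℝ φ (0 + x) := by simpa using hd
    exact differentiableAt_comp_add_const.2 this)
  simp only [zero_add] at h
  have h2pi : (0 : ℝ) < 2 * Real.pi := by positivity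
  -- The frequency is `b = 2πw`, so the cut-off `N` in `b` is `N / 2π` in `w`.
  refine (h.comp (tendsto_id.atTop_div_const h2pi)).congr fun N => ?_
  simp only [Function.comp, id]
  have key : ∀ b : ℝ, Complex.exp (Complex.I * b * x) * ∫ t : ℝ, Complex.exp (-(Complex.I * b * t)) * φ t
      = 𝓕 (fun t => φ (t + x)) (b / (2 * Real.pi)) := by
    intro b
    rw [Real.fourier_real_eq_integral_exp_smul, ← integral_const_mul,
      ← integral_add_right_eq_self (μ := volume) _ x]
    congr 1; ext t
    rw [← mul_assoc, ← Complex.exp_add, smul_eq_mul]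
    congr 2
    push_cast
    have hpi : (Real.pi : ℂ) ≠ 0 := by simp [Real.pi_ne_zero]
    field_simp
    ring
  simp_rw [key]
  rw [intervalIntegral.integral_const_mul,
    intervalIntegral.integral_comp_div (fun w => 𝓕 (fun t => φ (t + x)) w) h2pi.ne',
    ← Complex.ofReal_inv, Complex.real_smul, ← mul_assoc, ← Complex.ofReal_mul,
    inv_mul_cancel₀ h2pi.ne', neg_div]
  simp

end

/-! ### Inversion by the constant dual wavelet -/

theorem norm_rpow_mul_transformIntegrand {γ : ℝ} (f : ℝ → ℂ) (b : ℝ) {a t : ℝ} (ha : 0 < a)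
    (ht : 0 < t) :
    ‖((a ^ (γ - 1) : ℝ) : ℂ) * transformIntegrand γ f ((b : ℂ) - Complex.I * (a : ℂ)) t‖ =
      a ^ (γ - 1) * Real.exp (-(t * a)) * (t ^ γ * ‖f t‖) := by
  simp only [transformIntegrand, norm_mul, LaplaceClass.norm_exp_neg_I_mul, Complex.norm_real]
  rw [Real.norm_of_nonneg (Real.rpow_pos_of_pos ha _).le,
    Real.norm_of_nonneg (Real.rpow_pos_of_pos ht _).le]
  have : ((b : ℂ) - Complex.I * (a : ℂ)).im * t = -(t * a) := by simp [mul_comm]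
  rw [this]; ring

/-- Integrating the norm over `a` first gives `Γ(γ) t^{-γ}`, exactly cancelling the weight `t^γ`; so
integrability of `f` itself suffices, by Tonelli. -/
theorem integrable_rpow_mul_transformIntegrand {γ : ℝ} (hγ : 0 < γ) {f : ℝ → ℂ}
    (hf : IntegrableOn f (Ioi 0)) (b : ℝ) :
    Integrable (fun p : ℝ × ℝ => ((p.1 ^ (γ - 1) : ℝ) : ℂ) *
      transformIntegrand γ f ((b : ℂ) - Complex.I * (p.1 : ℂ)) p.2)
      ((volume.restrict (Ioi 0)).prod (volume.restrict (Ioi 0))) := by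
  have hm : AEStronglyMeasurable (fun p : ℝ × ℝ => ((p.1 ^ (γ - 1) : ℝ) : ℂ) *
      transformIntegrand γ f ((b : ℂ) - Complex.I * (p.1 : ℂ)) p.2)
      ((volume.restrict (Ioi 0)).prod (volume.restrict (Ioi 0))) := by
    simp only [transformIntegrand]
    refine AEStronglyMeasurable.mul ?_ (AEStronglyMeasurable.mul ?_ ?_)
    · exact (Complex.measurable_ofReal.comp
        (measurable_fst.pow_const (γ - 1))).aestronglyMeasurable
    · refine AEStronglyMeasurable.mul ?_ ?_
      · exact (by fun_prop : Continuous fun p : ℝ × ℝ =>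
          Complex.exp (-(Complex.I * ((b : ℂ) - Complex.I * (p.1 : ℂ)) * (p.2 : ℂ)))).aestronglyMeasurable
      · exact (Complex.measurable_ofReal.comp
          (measurable_snd.pow_const γ)).aestronglyMeasurable
    · exact hf.aestronglyMeasurable.comp_snd
  rw [integrable_prod_iff' hm]
  have hn : ∀ t ∈ Ioi (0 : ℝ), IntegrableOn
      (fun a : ℝ => a ^ (γ - 1) * Real.exp (-(t * a)) * (t ^ γ * ‖f t‖)) (Ioi 0) := fun t ht =>
    Integrable.mul_const (by
      have := integrableOn_rpow_mul_exp_neg_mul_rpow (s := γ - 1) (p := 1) (b := t)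
        (by linarith) one_pos ht
      simpa [IntegrableOn] using this) _
  constructor
  · refine (ae_restrict_iff' measurableSet_Ioi).2 ?_
    have hm2 := (ae_restrict_iff' measurableSet_Ioi).1 hm.prodMk_right
    filter_upwards [hm2] with t hmt ht
    refine Integrable.mono' (hn t ht) (hmt ht) ?_
    exact (ae_restrict_iff' measurableSet_Ioi).2 (ae_of_all _ fun a ha =>
      (norm_rpow_mul_transformIntegrand f b ha ht).le)
  · have hfn : IntegrableOn (fun t => Real.Gamma γ * ‖f t‖) (Ioi 0) := hf.norm.const_mul _
    refine hfn.congr_fun (fun t ht => ?_) measurableSet_Ioi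
    have ht : 0 < t := ht
    rw [setIntegral_congr_fun measurableSet_Ioi fun a ha =>
      norm_rpow_mul_transformIntegrand f b ha ht, integral_mul_const,
      Real.integral_rpow_mul_exp_neg_mul_Ioi hγ ht, one_div, Real.inv_rpow ht.le]
    have := (Real.rpow_pos_of_pos ht γ).ne'
    field_simp

/-- The transform is inverted by the constant dual wavelet. -/
theorem invertsTo_transform {γ : ℝ} (hγ : 0 < γ) {f : ℝ → ℂ} (hL : LaplaceClass γ f)
    (hf : IntegrableOn f (Ioi 0)) {q : ℝ} (hq : q ≠ 0)
    (hd : 0 < q → DifferentiableAt ℝ f q) :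
    InvertsTo γ (transform γ f) q (if 0 < q then f q else 0) := by
  have hrw : ∀ (b a : ℝ), 0 < a → inverseIntegrand γ (transform γ f) q b a =
      (((a ^ (γ - 1) : ℝ) : ℂ) * transform γ f ((b : ℂ) - Complex.I * (a : ℂ))) *
        (Complex.exp (Complex.I * b * q) * ((1 / (2 * Real.pi * Real.Gamma γ) : ℝ) : ℂ)) := by
    intro b a ha
    have h2 : a ^ (γ - 1 / 2) * a ^ (3 / 2 : ℝ) / a ^ 2 = a ^ (γ - 1) := by
      rw [← Real.rpow_add ha, ← Real.rpow_natCast, ← Real.rpow_sub ha]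
      congr 1; push_cast; ring
    rw [← h2]
    simp only [inverseIntegrand, dualWaveletAt, dualWavelet]
    push_cast
    ring
  -- The norm of the integrand does not depend on `b`, so `b = 0` supplies a majorant in `a` alone,
  -- integrable over each bounded strip `|b| ≤ N`.
  have hH := (integrable_rpow_mul_transformIntegrand hγ hf 0).norm.integral_prod_left
  have hHb : ∀ (b a : ℝ), 0 < a →
      ‖((a ^ (γ - 1) : ℝ) : ℂ) * transform γ f ((b : ℂ) - Complex.I * (a : ℂ))‖ ≤
      ∫ t in Ioi (0 : ℝ), ‖((a ^ (γ - 1) : ℝ) : ℂ) *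
        transformIntegrand γ f (((0 : ℝ) : ℂ) - Complex.I * (a : ℂ)) t‖ := by
    intro b a ha
    rw [transform, ← integral_const_mul]
    refine (norm_integral_le_integral_norm _).trans_eq ?_
    refine setIntegral_congr_fun measurableSet_Ioi fun t ht => ?_
    rw [norm_rpow_mul_transformIntegrand f b ha ht, norm_rpow_mul_transformIntegrand f 0 ha ht]
  constructor
  · intro N
    set c : ℝ := |1 / (2 * Real.pi * Real.Gamma γ)|
    have hI : IntegrableOn (fun p : ℝ × ℝ => c * ∫ t in Ioi (0 : ℝ), ‖((p.2 ^ (γ - 1) : ℝ) : ℂ) *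
        transformIntegrand γ f (((0 : ℝ) : ℂ) - Complex.I * (p.2 : ℂ)) t‖)
        (Icc (-N) N ×ˢ Ioi (0 : ℝ)) := by
      rw [IntegrableOn, Measure.volume_eq_prod, ← Measure.prod_restrict]
      exact (integrable_const (μ := volume.restrict (Icc (-N) N)) c).mul_prod hH
    have hms : MeasurableSet (Icc (-N) N ×ˢ Ioi (0 : ℝ)) := measurableSet_Icc.prod measurableSet_Ioi
    refine Integrable.mono' hI ?_ ?_
    · refine ContinuousOn.aestronglyMeasurable ?_ hms
      have : ContinuousOn (fun p : ℝ × ℝ =>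
          (((p.2 ^ (γ - 1) : ℝ) : ℂ) * transform γ f ((p.1 : ℂ) - Complex.I * (p.2 : ℂ))) *
          (Complex.exp (Complex.I * p.1 * q) * ((1 / (2 * Real.pi * Real.Gamma γ) : ℝ) : ℂ)))
          (Icc (-N) N ×ˢ Ioi (0 : ℝ)) := by
        refine ContinuousOn.mul (ContinuousOn.mul ?_ ?_) (by fun_prop)
        · refine Complex.continuous_ofReal.comp_continuousOn
            (continuousOn_snd.rpow_const fun p hp => Or.inl (ne_of_gt hp.2))
        · refine (analyticOnNhd_transform hL).continuousOn.comp (by fun_prop) fun p hp => ?_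
          have : 0 < p.2 := hp.2
          simpa [lowerHalfPlane] using this
      exact this.congr fun p hp => hrw p.1 p.2 hp.2
    · refine (ae_restrict_iff' hms).2 (ae_of_all _ fun p hp => ?_)
      rw [hrw p.1 p.2 hp.2, norm_mul, norm_mul (Complex.exp _), Complex.norm_real, mul_comm]
      have h1 : ‖Complex.exp (Complex.I * p.1 * q)‖ = 1 := by
        rw [Complex.norm_exp]; simp
      rw [h1, one_mul, Real.norm_eq_abs]
      exact mul_le_mul_of_nonneg_left (hHb _ _ hp.2) (abs_nonneg _)
  -- After the `a`-integration only Fourier inversion of `f` extended by zero is left. The extension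
  -- is differentiable at `q ≠ 0`: locally it is `0` or `f`.
  · set φ : ℝ → ℂ := (Ioi (0 : ℝ)).indicator f with hφ
    have hφi : Integrable φ := (integrable_indicator_iff measurableSet_Ioi).2 hf
    have hφq : φ q = if 0 < q then f q else 0 := by
      simp [hφ, indicator_apply]
    have hφd : DifferentiableAt ℝ φ q := by
      rcases lt_or_gt_of_ne hq with h | h
      · refine (differentiableAt_const (0 : ℂ)).congr_of_eventuallyEq ?_
        filter_upwards [Iio_mem_nhds h] with t ht
        exact indicator_of_notMem (notMem_Ioi.2 (le_of_lt ht)) _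
      · refine (hd h).congr_of_eventuallyEq ?_
        filter_upwards [Ioi_mem_nhds h] with t ht
        exact indicator_of_mem ht _
    rw [← hφq]
    refine (tendsto_intervalIntegral_fourierIntegral hφi hφd).congr fun N => ?_
    refine intervalIntegral.integral_congr fun b _ => ?_
    rw [setIntegral_congr_fun measurableSet_Ioi fun a ha => hrw b a ha, integral_mul_const]
    have hG : Real.Gamma γ ≠ 0 := (Real.Gamma_pos_of_pos hγ).ne'
    have key : ∫ a in Ioi (0 : ℝ), ((a ^ (γ - 1) : ℝ) : ℂ) *
        transform γ f ((b : ℂ) - Complex.I * (a : ℂ)) =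
        (Real.Gamma γ : ℂ) * ∫ t : ℝ, Complex.exp (-(Complex.I * b * t)) * φ t := by
      simp only [transform]
      simp_rw [← integral_const_mul]
      rw [integral_integral_swap (integrable_rpow_mul_transformIntegrand hγ hf b)]
      have : (fun t : ℝ => (Real.Gamma γ : ℂ) * (Complex.exp (-(Complex.I * b * t)) * φ t)) =
          (Ioi (0 : ℝ)).indicator fun t : ℝ =>
            (Real.Gamma γ : ℂ) * (Complex.exp (-(Complex.I * b * t)) * f t) := by
        ext t
        by_cases ht : t ∈ Ioi (0 : ℝ)
        · simp only [hφ, indicator_of_mem ht]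
        · simp only [hφ, indicator_of_notMem ht, mul_zero]
      rw [this, integral_indicator measurableSet_Ioi]
      refine setIntegral_congr_fun measurableSet_Ioi fun t ht => ?_
      have ht : 0 < t := ht
      have e : ∀ a : ℝ, ((a ^ (γ - 1) : ℝ) : ℂ) *
          transformIntegrand γ f ((b : ℂ) - Complex.I * (a : ℂ)) t =
          ((a ^ (γ - 1) * Real.exp (-(t * a)) : ℝ) : ℂ) *
            (((t ^ γ : ℝ) : ℂ) * (Complex.exp (-(Complex.I * b * t)) * f t)) := by
        intro a
        have : -(Complex.I * ((b : ℂ) - Complex.I * (a : ℂ)) * t) =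
            ((-(t * a) : ℝ) : ℂ) + -(Complex.I * b * t) := by
          push_cast
          linear_combination (a * t : ℂ) * Complex.I_sq
        rw [transformIntegrand, this, Complex.exp_add, ← Complex.ofReal_exp]
        push_cast
        ring
      simp_rw [e]
      rw [integral_mul_const, integral_complex_ofReal, Real.integral_rpow_mul_exp_neg_mul_Ioi hγ ht,
        one_div, Real.inv_rpow ht.le]
      have h3 : ((t ^ γ : ℝ) : ℂ) ≠ 0 := by exact_mod_cast (Real.rpow_pos_of_pos ht γ).ne'
      push_cast at h3 ⊢
      field_simp
    rw [key]
    have hG' : (Real.Gamma γ : ℂ) ≠ 0 := by exact_mod_cast hG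
    have hpi : (Real.pi : ℂ) ≠ 0 := by simp [Real.pi_ne_zero]
    push_cast
    field_simp

/-! ### The reduced system on `Re x > 1/2`: quantization and uniqueness -/

theorem isPreconnected_lowerHalfPlane : IsPreconnected lowerHalfPlane :=
  (convex_halfSpace_im_lt 0).isPreconnected

/-- The half-plane `Re x > 1/2`, on which `x = 1/2 + iz` varies for `Im z < 0`. -/
def rightHalfPlane : Set ℂ := {x : ℂ | 1 / 2 < x.re}

theorem isOpen_rightHalfPlane : IsOpen rightHalfPlane :=
  isOpen_lt continuous_const Complex.continuous_re

theorem isPreconnected_rightHalfPlane : IsPreconnected rightHalfPlane :=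
  (convex_halfSpace_re_gt (1 / 2)).isPreconnected

theorem one_mem_rightHalfPlane : (1 : ℂ) ∈ rightHalfPlane := by
  simp only [rightHalfPlane, mem_ofPred_eq, Complex.one_re]; norm_num

theorem re_pos_of_mem_rightHalfPlane {x : ℂ} (hx : x ∈ rightHalfPlane) : 0 < x.re :=
  lt_trans (by norm_num) hx

theorem ne_zero_of_mem_rightHalfPlane {x : ℂ} (hx : x ∈ rightHalfPlane) : x ≠ 0 := by
  rintro rfl
  have := re_pos_of_mem_rightHalfPlane hx
  simp at this

/-- Analytic solutions of the Euler equation `(x - 1) h' = ν h` are monomials. -/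
theorem euler_equation {U : Set ℂ} (hU : IsPreconnected U) (h1 : (1 : ℂ) ∈ U)
    {h : ℂ → ℂ} (hh : AnalyticOnNhd ℂ h U) {ν : ℂ} (he : ∀ x ∈ U, (x - 1) * deriv h x = ν * h x)
    (hUo : IsOpen U) :
    (∀ x ∈ U, h x = 0) ∨ ∃ n : ℕ, ν = n ∧ ∃ C : ℂ, C ≠ 0 ∧ ∀ x ∈ U, h x = C * (x - 1) ^ n := by
  by_cases hz : ∀ᶠ x in 𝓝 (1 : ℂ), h x = 0
  · exact Or.inl fun x hx => hh.eqOn_zero_of_preconnected_of_eventuallyEq_zero hU h1 hz hx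
  right
  -- Factor out the order of vanishing at the singular point: `h = (x-1)^n g` with `g(1) ≠ 0`. The
  -- equation becomes `(ν-n) g = (x-1) g'`; letting `x → 1` gives `ν = n`, and then `g' = 0`.
  obtain ⟨n, g, hg, hg1, hhg⟩ := (hh 1 h1).exists_eventuallyEq_pow_smul_nonzero_iff.2 hz
  have hgA := hg.eventually_analyticAt
  have key : ∀ᶠ x in 𝓝[≠] (1 : ℂ), (ν - n) * g x = (x - 1) * deriv g x := by
    have h2 : ∀ᶠ x in 𝓝 (1 : ℂ), x ≠ 1 → (ν - n) * g x = (x - 1) * deriv g x := by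
      filter_upwards [hhg.eventually_nhds, hgA, hUo.mem_nhds h1] with x hx hgx hxU hx1
      have hx1' : x - 1 ≠ 0 := sub_ne_zero.2 hx1
      have e1 : deriv h x = n * (x - 1) ^ (n - 1) * g x + (x - 1) ^ n * deriv g x := by
        rw [Filter.EventuallyEq.deriv_eq hx]
        simp only [smul_eq_mul]
        have := (((hasDerivAt_id x).sub_const 1).pow n).mul hgx.differentiableAt.hasDerivAt
        refine (this.congr_deriv ?_).deriv
        simp
      have e2 := he x hxU
      rw [e1, hx.self_of_nhds, smul_eq_mul] at e2
      -- For `n = 0` the exponent `n - 1` truncates to `0`, but the factor `n` removes the term.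
      have e3 : (x - 1) * (n * (x - 1) ^ (n - 1)) = n * (x - 1) ^ n := by
        rcases n with _ | n
        · simp
        · rw [Nat.add_sub_cancel, pow_succ]; ring
      refine mul_left_cancel₀ (pow_ne_zero n hx1') ?_
      linear_combination -e2 + g x * e3
    exact eventually_nhdsWithin_iff.2 h2
  have hν : ν = n := by
    have t1 : Tendsto (fun x => (ν - n) * g x) (𝓝[≠] (1 : ℂ)) (𝓝 ((ν - n) * g 1)) :=
      (continuousAt_const.mul hg.continuousAt).tendsto.mono_left nhdsWithin_le_nhds
    have t2 : Tendsto (fun x => (x - 1) * deriv g x) (𝓝[≠] (1 : ℂ)) (𝓝 ((1 - 1) * deriv g 1)) :=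
      ((by fun_prop : ContinuousAt (fun x : ℂ => x - 1) 1).mul
        hg.deriv.continuousAt).tendsto.mono_left nhdsWithin_le_nhds
    have := tendsto_nhds_unique (t1.congr' key) t2
    rw [sub_self, zero_mul] at this
    exact sub_eq_zero.1 ((mul_eq_zero.1 this).resolve_right hg1)
  refine ⟨n, hν, g 1, hg1, ?_⟩
  have hg0 : ∀ᶠ x in 𝓝 (1 : ℂ), deriv g x = 0 := by
    refine (hg.deriv.frequently_zero_iff_eventually_zero).1 (Eventually.frequently ?_)
    filter_upwards [key, self_mem_nhdsWithin] with x hx hx1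
    rw [hν, sub_self, zero_mul] at hx
    exact (mul_eq_zero.1 hx.symm).resolve_left (sub_ne_zero.2 hx1)
  obtain ⟨δ, hδ, hb⟩ := Metric.eventually_nhds_iff_ball.1 (hg0.and hgA)
  have hconst : ∀ᶠ x in 𝓝 (1 : ℂ), g x = g 1 := by
    filter_upwards [Metric.ball_mem_nhds _ hδ] with x hx
    exact Metric.isOpen_ball.is_const_of_deriv_eq_zero (convex_ball _ _).isPreconnected
      (fun y hy => (hb y hy).2.differentiableAt.differentiableWithinAt)
      (fun y hy => (hb y hy).1) hx (Metric.mem_ball_self hδ)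
  have hp : AnalyticOnNhd ℂ (fun x : ℂ => g 1 * (x - 1) ^ n) U := fun x _ => by fun_prop
  refine hh.eqOn_of_preconnected_of_eventuallyEq hp hU h1 ?_
  filter_upwards [hhg, hconst] with x hx hc
  rw [hx, hc, smul_eq_mul, mul_comm]

/-- The transformed equations in the variable `x = 1/2 + iz`, in diagonalizing combinations. -/
structure ReducedSolution (γ χ ν τ : ℝ) (p r : ℂ → ℂ) : Prop where
  analytic_p : AnalyticOnNhd ℂ p rightHalfPlane
  analytic_r : AnalyticOnNhd ℂ r rightHalfPlane
  eq_p : ∀ x ∈ rightHalfPlane, x * deriv p x = -(ν + 2 * γ) * p x - (τ - χ) * r x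
  eq_r : ∀ x ∈ rightHalfPlane, (x - 1) * deriv r x = ν * r x + (χ + τ) * p x
  lim_p : Tendsto (fun a : ℝ => p a) atTop (𝓝 0)
  lim_r : Tendsto (fun a : ℝ => r a) atTop (𝓝 0)

namespace ReducedSolution

variable {γ χ ν τ : ℝ} {p r p₀ r₀ : ℂ → ℂ}

theorem sub_const_mul (h : ReducedSolution γ χ ν τ p r) (h₀ : ReducedSolution γ χ ν τ p₀ r₀)
    (c : ℂ) : ReducedSolution γ χ ν τ (fun x => p x - c * p₀ x) (fun x => r x - c * r₀ x) where
  analytic_p := h.analytic_p.sub (analyticOnNhd_const.mul h₀.analytic_p)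
  analytic_r := h.analytic_r.sub (analyticOnNhd_const.mul h₀.analytic_r)
  eq_p x hx := by
    have d := (h.analytic_p x hx).differentiableAt.hasDerivAt.sub
      ((h₀.analytic_p x hx).differentiableAt.hasDerivAt.const_mul c)
    have d' : deriv (fun x => p x - c * p₀ x) x = deriv p x - c * deriv p₀ x := d.deriv
    rw [d']
    linear_combination h.eq_p x hx - c * h₀.eq_p x hx
  eq_r x hx := by
    have d := (h.analytic_r x hx).differentiableAt.hasDerivAt.sub
      ((h₀.analytic_r x hx).differentiableAt.hasDerivAt.const_mul c)
    have d' : deriv (fun x => r x - c * r₀ x) x = deriv r x - c * deriv r₀ x := d.deriv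
    rw [d']
    linear_combination h.eq_r x hx - c * h₀.eq_r x hx
  lim_p := by simpa using h.lim_p.sub (h₀.lim_p.const_mul c)
  lim_r := by simpa using h.lim_r.sub (h₀.lim_r.const_mul c)

/-- The integrating factor `x^{ν+2γ}` cancels the `p'` term obtained by differentiating `eq_p`; the
remaining `r'` is eliminated through `eq_r`, leaving an Euler equation at the interior point `x =
1`. -/
theorem deriv_alternative (h : ReducedSolution γ χ ν τ p r)
    (hτ : τ ^ 2 - χ ^ 2 = ν * (ν + 2 * γ)) :
    (∀ x ∈ rightHalfPlane, deriv p x = 0) ∨ ∃ n : ℕ, ν = n ∧ ∃ C : ℂ, C ≠ 0 ∧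
      ∀ x ∈ rightHalfPlane, x ^ ((ν + 2 * γ : ℝ) : ℂ) * (x * deriv p x) = C * (x - 1) ^ n := by
  set s : ℂ := ((ν + 2 * γ : ℝ) : ℂ) with hs
  have hslit : ∀ x ∈ rightHalfPlane, x ∈ Complex.slitPlane := fun x hx =>
    Or.inl (re_pos_of_mem_rightHalfPlane hx)
  have hpow : ∀ x ∈ rightHalfPlane, HasDerivAt (fun x : ℂ => x ^ s) (s * x ^ s / x) x := by
    intro x hx
    have hx0 := ne_zero_of_mem_rightHalfPlane hx
    refine ((hasDerivAt_id x).cpow_const (c := s) (hslit x hx)).congr_deriv ?_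
    simp only [id, mul_one]
    rw [Complex.cpow_sub _ _ hx0, Complex.cpow_one]; ring
  have hpowA : AnalyticOnNhd ℂ (fun x : ℂ => x ^ s) rightHalfPlane :=
    DifferentiableOn.analyticOnNhd (fun x hx => (hpow x hx).differentiableAt.differentiableWithinAt)
      isOpen_rightHalfPlane
  have hA : AnalyticOnNhd ℂ (fun x => x ^ s * (x * deriv p x)) rightHalfPlane :=
    hpowA.mul (analyticOnNhd_id.mul h.analytic_p.deriv)
  have hτ' : (τ : ℂ) ^ 2 - χ ^ 2 = ν * (ν + 2 * γ) := by exact_mod_cast hτ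
  have he : ∀ x ∈ rightHalfPlane, (x - 1) * deriv (fun x => x ^ s * (x * deriv p x)) x =
      (ν : ℂ) * (x ^ s * (x * deriv p x)) := by
    intro x hx
    have hx0 := ne_zero_of_mem_rightHalfPlane hx
    have dp := (h.analytic_p x hx).differentiableAt.hasDerivAt
    have dr := (h.analytic_r x hx).differentiableAt.hasDerivAt
    have dy : HasDerivAt (fun x => x * deriv p x)
        (-(ν + 2 * γ) * deriv p x - (τ - χ) * deriv r x) x := by
      refine ((dp.const_mul (-(ν + 2 * γ) : ℂ)).sub (dr.const_mul (τ - χ : ℂ))).congr_of_eventuallyEq ?_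
      filter_upwards [isOpen_rightHalfPlane.mem_nhds hx] with w hw
      exact h.eq_p w hw
    have dh := (hpow x hx).mul dy
    have dh' : deriv (fun x => x ^ s * (x * deriv p x)) x = _ := dh.deriv
    rw [dh']
    have e1 := h.eq_p x hx
    have e2 := h.eq_r x hx
    have hs' : s = ν + 2 * γ := by rw [hs]; push_cast; ring
    field_simp
    rw [hs']
    -- By `hτ`, the right side of `eq_r` times `τ - χ` is `ν((τ-χ) r + (ν+2γ) p)`, which `eq_p`
    -- identifies with `-ν x p'`.
    have key : (τ - χ) * ((x - 1) * deriv r x) = -(ν * (x * deriv p x)) := by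
      linear_combination (τ - χ : ℂ) * e2 + (ν : ℂ) * e1 + p x * hτ'
    linear_combination (-x ^ (ν + 2 * γ : ℂ)) * key
  rcases euler_equation isPreconnected_rightHalfPlane one_mem_rightHalfPlane hA he
    isOpen_rightHalfPlane with h0 | ⟨n, hn, C, hC, hh⟩
  · left
    intro x hx
    have hx0 := ne_zero_of_mem_rightHalfPlane hx
    have := h0 x hx
    simpa [hx0, Complex.cpow_eq_zero_iff] using this
  · exact Or.inr ⟨n, by exact_mod_cast hn, C, hC, hh⟩

/-- A constant `p` tending to `0` vanishes. Then `r` alone satisfies the Euler equation, so a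
nonzero `r` would be `C (x-1)^n`, which does not decay along the real axis. -/
theorem eq_zero_of_deriv_eq_zero (h : ReducedSolution γ χ ν τ p r)
    (h0 : ∀ x ∈ rightHalfPlane, deriv p x = 0) :
    ∀ x ∈ rightHalfPlane, p x = 0 ∧ r x = 0 := by
  have hreal : ∀ a : ℝ, 1 ≤ a → (a : ℂ) ∈ rightHalfPlane := fun a ha => by
    simp only [rightHalfPlane, mem_ofPred_eq, Complex.ofReal_re]; linarith
  have hp : ∀ x ∈ rightHalfPlane, p x = 0 := by
    intro x hx
    have hc : ∀ᶠ a : ℝ in atTop, p a = p x := by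
      filter_upwards [eventually_ge_atTop 1] with a ha
      exact isOpen_rightHalfPlane.is_const_of_deriv_eq_zero isPreconnected_rightHalfPlane
        (fun y hy => (h.analytic_p y hy).differentiableAt.differentiableWithinAt) h0
        (hreal a ha) hx
    exact tendsto_nhds_unique (tendsto_const_nhds.congr' (hc.mono fun _ h => h.symm)) h.lim_p
  have hr : ∀ x ∈ rightHalfPlane, r x = 0 := by
    rcases euler_equation isPreconnected_rightHalfPlane one_mem_rightHalfPlane h.analytic_r
      (ν := ν) (fun x hx => by rw [h.eq_r x hx, hp x hx, mul_zero, add_zero])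
      isOpen_rightHalfPlane with h1 | ⟨n, -, C, hC, hh⟩
    · exact h1
    · exfalso
      have hge : ∀ᶠ a : ℝ in atTop, ‖C‖ ≤ ‖r a‖ := by
        filter_upwards [eventually_ge_atTop 2] with a ha
        rw [hh a (hreal a (by linarith)), norm_mul, norm_pow]
        have : (1 : ℝ) ≤ ‖(a : ℂ) - 1‖ := by
          rw [← Complex.ofReal_one, ← Complex.ofReal_sub, Complex.norm_real, Real.norm_eq_abs]
          exact le_trans (by linarith) (le_abs_self _)
        exact le_mul_of_one_le_right (norm_nonneg _) (one_le_pow₀ this)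
      have := le_of_tendsto_of_tendsto tendsto_const_nhds h.lim_r.norm hge
      rw [norm_zero] at this
      exact hC (norm_le_zero_iff.1 this)
  exact fun x hx => ⟨hp x hx, hr x hx⟩

/-- A nonzero reduced solution has `ν ∈ ℕ`, and `ν = 0` is possible only for `χ < 0`. -/
theorem exists_nat_of_ne_zero (h : ReducedSolution γ χ ν τ p r) (hτ0 : 0 < τ)
    (hτ : τ ^ 2 - χ ^ 2 = ν * (ν + 2 * γ)) (hne : ∃ x ∈ rightHalfPlane, p x ≠ 0 ∨ r x ≠ 0) :
    ∃ n : ℕ, Admissible χ n ∧ ν = n ∧ ∃ C : ℂ, C ≠ 0 ∧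
      ∀ x ∈ rightHalfPlane, x ^ ((ν + 2 * γ : ℝ) : ℂ) * (x * deriv p x) = C * (x - 1) ^ n := by
  rcases h.deriv_alternative hτ with h0 | ⟨n, hn, C, hC, hh⟩
  · obtain ⟨x, hx, hx'⟩ := hne
    have := h.eq_zero_of_deriv_eq_zero h0 x hx
    simp [this.1, this.2] at hx'
  · refine ⟨n, fun hn0 => ?_, hn, C, hC, hh⟩
    subst hn0
    have hν : ν = 0 := by simpa using hn
    -- If `χ ≥ 0` then `τ > 0` and `τ² = χ²` give `τ = χ`. At `x = 1`, `eq_r` yields `2τ p(1) = 0`,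
    -- so `eq_p` yields `p'(1) = 0`, against the value `C ≠ 0` there.
    by_contra hχ
    have hτχ : τ = χ := by
      rw [hν] at hτ
      nlinarith [not_lt.1 hχ]
    have e1 := h.eq_p 1 one_mem_rightHalfPlane
    have e2 := h.eq_r 1 one_mem_rightHalfPlane
    have e3 := hh 1 one_mem_rightHalfPlane
    have hτc : (τ : ℂ) ≠ 0 := by exact_mod_cast hτ0.ne'
    have hp1 : p 1 = 0 := by
      rw [hν, ← hτχ] at e2
      have : (2 * τ : ℂ) * p 1 = 0 := by
        push_cast at e2
        linear_combination -e2
      simpa [hτc] using this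
    rw [hτχ, hp1] at e1
    rw [e1] at e3
    simp at e3
    exact hC e3.symm

/-- Reduced solutions are unique up to a constant. -/
theorem exists_eq_const_mul (h : ReducedSolution γ χ ν τ p r)
    (h₀ : ReducedSolution γ χ ν τ p₀ r₀) (hτ0 : 0 < τ)
    (hτ : τ ^ 2 - χ ^ 2 = ν * (ν + 2 * γ)) (hne : ∃ x ∈ rightHalfPlane, p x ≠ 0 ∨ r x ≠ 0)
    (hne₀ : ∃ x ∈ rightHalfPlane, p₀ x ≠ 0 ∨ r₀ x ≠ 0) :
    ∃ c : ℂ, ∀ x ∈ rightHalfPlane, p x = c * p₀ x ∧ r x = c * r₀ x := by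
  obtain ⟨n, -, hn, C, -, hh⟩ := h.exists_nat_of_ne_zero hτ0 hτ hne
  obtain ⟨n', -, hn', C₀, hC₀, hh₀⟩ := h₀.exists_nat_of_ne_zero hτ0 hτ hne₀
  have hnn : n' = n := by exact_mod_cast hn'.symm.trans hn
  subst hnn
  -- This constant matches the leading coefficients of the two Euler monomials, so the difference
  -- solution has `p' = 0` and vanishes.
  refine ⟨C / C₀, fun x hx => ?_⟩
  have hz := (h.sub_const_mul h₀ (C / C₀)).eq_zero_of_deriv_eq_zero (fun x hx => by
    have d := (h.analytic_p x hx).differentiableAt.hasDerivAt.sub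
      ((h₀.analytic_p x hx).differentiableAt.hasDerivAt.const_mul (C / C₀))
    have d' : deriv (fun x => p x - C / C₀ * p₀ x) x = deriv p x - C / C₀ * deriv p₀ x := d.deriv
    rw [d']
    have hx0 := ne_zero_of_mem_rightHalfPlane hx
    have hxs : x ^ ((ν + 2 * γ : ℝ) : ℂ) ≠ 0 := by simp [Complex.cpow_eq_zero_iff, hx0]
    refine mul_left_cancel₀ (mul_ne_zero hxs hx0) ?_
    have e1 := hh x hx
    have e2 := hh₀ x hx
    have e3 : C / C₀ * C₀ = C := div_mul_cancel₀ C hC₀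
    linear_combination e1 - C / C₀ * e2 - (x - 1) ^ n' * e3) x hx
  exact ⟨sub_eq_zero.1 hz.1, sub_eq_zero.1 hz.2⟩

end ReducedSolution

/-! ### Algebra of the parameters and the energy levels -/

/-- `√((m + ε) / (m - ε))`. -/
noncomputable def ratio (m ε : ℝ) : ℝ := √((m + ε) / (m - ε))

section parameters

variable {m lam χ ε : ℝ}

theorem gam_pos (hχ : lam ^ 2 < χ ^ 2) : 0 < gam lam χ := Real.sqrt_pos.2 (by linarith)

theorem gam_sq (hχ : lam ^ 2 < χ ^ 2) : gam lam χ ^ 2 = χ ^ 2 - lam ^ 2 :=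
  Real.sq_sqrt (by linarith)

theorem kap_pos (hε : |ε| < m) : 0 < kap m ε := by
  have := abs_lt.1 hε
  exact Real.sqrt_pos.2 (by nlinarith)

theorem kap_sq (hε : |ε| < m) : kap m ε ^ 2 = m ^ 2 - ε ^ 2 := by
  have := abs_lt.1 hε
  exact Real.sq_sqrt (by nlinarith)

theorem ratio_eq (hε : |ε| < m) : ratio m ε = (m + ε) / kap m ε := by
  have h := abs_lt.1 hε
  have h1 : 0 < m + ε := by linarith
  have h2 : 0 < m - ε := by linarith
  have hk := kap_pos hε
  rw [ratio, Real.sqrt_eq_iff_mul_self_eq (by positivity) (by positivity), div_mul_div_comm, ← sq,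
    ← sq, kap_sq hε]
  have : m ^ 2 - ε ^ 2 = (m + ε) * (m - ε) := by ring
  rw [this]
  field_simp

theorem ratio_pos (hε : |ε| < m) : 0 < ratio m ε := by
  rw [ratio_eq hε]
  have := abs_lt.1 hε
  exact div_pos (by linarith) (kap_pos hε)

theorem inv_ratio : √((m - ε) / (m + ε)) = (ratio m ε)⁻¹ := by
  rw [ratio, ← Real.sqrt_inv, inv_div]

theorem inv_ratio_eq (hε : |ε| < m) : (ratio m ε)⁻¹ = (m - ε) / kap m ε := by
  have h := abs_lt.1 hε
  have h1 : m + ε ≠ 0 := by linarith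
  have hk := (kap_pos hε).ne'
  rw [ratio_eq hε, inv_div, div_eq_div_iff h1 hk, ← sq, kap_sq hε]
  ring

/-- From `k = (m+ε)/κ` one gets `λk = τ + λε/κ`, and `λε/κ = η̃ + γ`; the inverse ratio has the
opposite sign of `ε`. These two relations bring `η̃` and `τ` into the reduced system. -/
theorem lam_mul_ratio (hε : |ε| < m) :
    lam * ratio m ε = etaTilde m lam χ ε + gam lam χ + lam * m / kap m ε := by
  rw [ratio_eq hε, etaTilde]; ring

theorem lam_mul_inv_ratio (hε : |ε| < m) :
    lam * (ratio m ε)⁻¹ = lam * m / kap m ε - (etaTilde m lam χ ε + gam lam χ) := by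
  rw [inv_ratio_eq hε, etaTilde]; ring

/-- Since `κ² = m² - ε²`, `τ² - (λε/κ)² = λ²`, while `χ² = γ² + λ²` and `λε/κ = η̃ + γ`. -/
theorem tau_sq (hχ : lam ^ 2 < χ ^ 2) (hε : |ε| < m) :
    (lam * m / kap m ε) ^ 2 - χ ^ 2 =
      etaTilde m lam χ ε * (etaTilde m lam χ ε + 2 * gam lam χ) := by
  have h1 := gam_sq hχ
  have hk := (kap_pos hε).ne'
  have h2 : (lam * m / kap m ε) ^ 2 - (lam * ε / kap m ε) ^ 2 = lam ^ 2 := by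
    rw [div_pow, div_pow, ← sub_div, div_eq_iff (pow_ne_zero 2 hk), kap_sq hε]; ring
  rw [etaTilde]
  linear_combination h2 + h1

theorem energy_pos (hm : 0 < m) (n : ℕ) : 0 < energy m lam χ n := by
  unfold energy; positivity

theorem energy_eq (n : ℕ) :
    energy m lam χ n = m / √(1 + lam ^ 2 / (gam lam χ + n) ^ 2) := by
  rw [energy, Real.rpow_neg (by positivity), ← Real.sqrt_eq_rpow, div_eq_mul_inv m]

theorem energy_sq (hχ : lam ^ 2 < χ ^ 2) (n : ℕ) :
    energy m lam χ n ^ 2 * ((gam lam χ + n) ^ 2 + lam ^ 2) = m ^ 2 * (gam lam χ + n) ^ 2 := by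
  have : 0 < gam lam χ + n := add_pos_of_pos_of_nonneg (gam_pos hχ) n.cast_nonneg
  rw [energy_eq, div_pow, Real.sq_sqrt (by positivity)]
  field_simp

theorem abs_energy_lt (hm : 0 < m) (hlam : 0 < lam) (hχ : lam ^ 2 < χ ^ 2) (n : ℕ) :
    |energy m lam χ n| < m := by
  have hp := energy_pos (lam := lam) (χ := χ) hm n
  have hg : 0 < gam lam χ + n := add_pos_of_pos_of_nonneg (gam_pos hχ) n.cast_nonneg
  rw [abs_of_pos hp, energy_eq, div_lt_iff₀ (by positivity)]
  have : 1 < √(1 + lam ^ 2 / (gam lam χ + n) ^ 2) := by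
    rw [Real.lt_sqrt (by norm_num)]
    have : 0 < lam ^ 2 / (gam lam χ + n) ^ 2 := by positivity
    linarith
  nlinarith

/-- The condition reads `λε = (γ+n)κ`. Its right side is positive, so `ε > 0` and squaring loses
nothing. -/
theorem etaTilde_eq_iff (hm : 0 < m) (hlam : 0 < lam) (hχ : lam ^ 2 < χ ^ 2) (hε : |ε| < m)
    (n : ℕ) : etaTilde m lam χ ε = n ↔ ε = energy m lam χ n := by
  have hp := energy_pos (lam := lam) (χ := χ) hm n
  have hg : 0 < gam lam χ + n := add_pos_of_pos_of_nonneg (gam_pos hχ) n.cast_nonneg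
  have hk := kap_pos hε
  have hs := energy_sq (m := m) hχ n
  have hks := kap_sq hε
  have e1 : etaTilde m lam χ ε = n ↔ lam * ε = (gam lam χ + n) * kap m ε := by
    rw [etaTilde, ← div_eq_iff hk.ne']
    constructor <;> intro h <;> linarith
  rw [e1]
  constructor
  · intro h
    have hε0 : 0 < ε := by
      have : 0 < lam * ε := by rw [h]; positivity
      exact (mul_pos_iff_of_pos_left hlam).1 this
    have h2 : (lam * ε) ^ 2 = ((gam lam χ + n) * kap m ε) ^ 2 := by rw [h]
    rw [mul_pow, mul_pow, hks] at h2
    have h3 : ε ^ 2 * ((gam lam χ + n) ^ 2 + lam ^ 2) =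
        energy m lam χ n ^ 2 * ((gam lam χ + n) ^ 2 + lam ^ 2) := by rw [hs]; linarith
    have h4 := mul_right_cancel₀ (by positivity : (gam lam χ + n) ^ 2 + lam ^ 2 ≠ 0) h3
    exact (sq_eq_sq₀ hε0.le hp.le).1 h4
  · intro h
    rw [← h] at hp hs
    refine (sq_eq_sq₀ (by positivity) (by positivity)).1 ?_
    rw [mul_pow, mul_pow, hks]
    linarith

end parameters

/-! ### From the transformed equations to the reduced system -/

section reduction

variable {m lam χ ε : ℝ} {F G : ℂ → ℂ}

theorem map_mem_lowerHalfPlane {x : ℂ} (hx : x ∈ rightHalfPlane) :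
    -Complex.I * (x - 1 / 2) ∈ lowerHalfPlane := by
  have : 1 / 2 < x.re := hx
  simp only [lowerHalfPlane, mem_ofPred_eq]
  simp
  norm_num at this
  linarith

theorem half_add_mem_rightHalfPlane {z : ℂ} (hz : z ∈ lowerHalfPlane) :
    1 / 2 + Complex.I * z ∈ rightHalfPlane := by
  have : z.im < 0 := hz
  simp only [rightHalfPlane, mem_ofPred_eq, Complex.add_re, Complex.mul_re, Complex.I_re,
    Complex.I_im]
  norm_num
  linarith

theorem neg_I_mul_half_add (z : ℂ) : -Complex.I * (1 / 2 + Complex.I * z - 1 / 2) = z := by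
  linear_combination -z * Complex.I_sq

/-- Adding `±k` times the second equation to the first collects the derivatives into `-(z ± i/2)(F'
± kG')`, and `z + i/2 = -i(x-1)`, `z - i/2 = -ix`. Thus `F - kG` is singular at `x = 0` and `F + kG`
at `x = 1`. -/
theorem IsAnalyticSolution.reduced (h : IsAnalyticSolution m lam χ ε F G) (hε : |ε| < m) :
    ReducedSolution (gam lam χ) χ (etaTilde m lam χ ε) (lam * m / kap m ε)
      (fun x => F (-Complex.I * (x - 1 / 2)) - ratio m ε * G (-Complex.I * (x - 1 / 2)))
      (fun x => F (-Complex.I * (x - 1 / 2)) + ratio m ε * G (-Complex.I * (x - 1 / 2))) := by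
  have hζ : ∀ x : ℂ, HasDerivAt (fun x : ℂ => -Complex.I * (x - 1 / 2)) (-Complex.I) x := fun x =>
    (((hasDerivAt_id x).sub_const (1 / 2)).const_mul (-Complex.I)).congr_deriv (by simp)
  have hζA : AnalyticOnNhd ℂ (fun x : ℂ => -Complex.I * (x - 1 / 2)) rightHalfPlane :=
    fun x _ => by fun_prop
  have hFA := h.analytic_F.comp hζA fun x hx => map_mem_lowerHalfPlane hx
  have hGA := h.analytic_G.comp hζA fun x hx => map_mem_lowerHalfPlane hx
  have hF : ∀ x ∈ rightHalfPlane, HasDerivAt (fun x => F (-Complex.I * (x - 1 / 2)))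
      (deriv F (-Complex.I * (x - 1 / 2)) * -Complex.I) x := fun x hx =>
    ((h.analytic_F _ (map_mem_lowerHalfPlane hx)).differentiableAt.hasDerivAt).comp x (hζ x)
  have hG : ∀ x ∈ rightHalfPlane, HasDerivAt (fun x => G (-Complex.I * (x - 1 / 2)))
      (deriv G (-Complex.I * (x - 1 / 2)) * -Complex.I) x := fun x hx =>
    ((h.analytic_G _ (map_mem_lowerHalfPlane hx)).differentiableAt.hasDerivAt).comp x (hζ x)
  have hk0 : (ratio m ε : ℂ) ≠ 0 := by exact_mod_cast (ratio_pos hε).ne'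
  have p1 : (lam : ℂ) * ratio m ε = etaTilde m lam χ ε + gam lam χ + (lam * m / kap m ε : ℝ) := by
    exact_mod_cast lam_mul_ratio (χ := χ) (lam := lam) hε
  have p2 : (lam : ℂ) * (ratio m ε : ℂ)⁻¹ = (lam * m / kap m ε : ℝ) - (etaTilde m lam χ ε + gam lam χ) := by
    exact_mod_cast lam_mul_inv_ratio (χ := χ) (lam := lam) hε
  have sys : ∀ x ∈ rightHalfPlane, _ := fun x hx => h.system _ (map_mem_lowerHalfPlane hx)
  simp only [inv_ratio, Complex.ofReal_sub, Complex.ofReal_neg, Complex.ofReal_inv] at sys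
  rw [← ratio] at sys
  have lim : Tendsto (fun a : ℝ => a - 1 / 2) atTop atTop := tendsto_atTop_add_const_right _ _ tendsto_id
  have limF : Tendsto (fun a : ℝ => F (-Complex.I * ((a : ℂ) - 1 / 2))) atTop (𝓝 0) :=
    (h.lim_F.comp lim).congr fun a => by
      simp only [Function.comp]; congr 1; push_cast; ring
  have limG : Tendsto (fun a : ℝ => G (-Complex.I * ((a : ℂ) - 1 / 2))) atTop (𝓝 0) :=
    (h.lim_G.comp lim).congr fun a => by
      simp only [Function.comp]; congr 1; push_cast; ring
  have kk : (ratio m ε : ℂ) * (ratio m ε : ℂ)⁻¹ = 1 := mul_inv_cancel₀ hk0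
  have hxz : ∀ x : ℂ, x = 1 / 2 + Complex.I * (-Complex.I * (x - 1 / 2)) := fun x => by
    linear_combination (x - 1 / 2) * Complex.I_sq
  refine ⟨hFA.sub (analyticOnNhd_const.mul hGA), hFA.add (analyticOnNhd_const.mul hGA), ?_, ?_,
    by simpa using limF.sub (limG.const_mul (ratio m ε : ℂ)),
    by simpa using limF.add (limG.const_mul (ratio m ε : ℂ))⟩
  · intro x hx
    have d := ((hF x hx).sub ((hG x hx).const_mul (ratio m ε : ℂ)))
    have d' : deriv (fun x => F (-Complex.I * (x - 1 / 2)) -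
      ratio m ε * G (-Complex.I * (x - 1 / 2))) x = _ := d.deriv
    rw [d']
    obtain ⟨e1, e2⟩ := sys x hx
    have hx' := hxz x
    set z := -Complex.I * (x - 1 / 2)
    linear_combination (-Complex.I * (deriv F z - ratio m ε * deriv G z)) * hx' -
      z * (deriv F z - ratio m ε * deriv G z) * Complex.I_sq - e1 + (ratio m ε : ℂ) * e2 +
      (Complex.I / 2 * deriv F z) * kk - F z * p1 + G z * lam * kk - G z * ratio m ε * p2
  · intro x hx
    have d := ((hF x hx).add ((hG x hx).const_mul (ratio m ε : ℂ)))
    have d' : deriv (fun x => F (-Complex.I * (x - 1 / 2)) +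
      ratio m ε * G (-Complex.I * (x - 1 / 2))) x = _ := d.deriv
    rw [d']
    obtain ⟨e1, e2⟩ := sys x hx
    have hx' := hxz x
    set z := -Complex.I * (x - 1 / 2)
    linear_combination (-Complex.I * (deriv F z + ratio m ε * deriv G z)) * hx' -
      z * (deriv F z + ratio m ε * deriv G z) * Complex.I_sq - e1 - (ratio m ε : ℂ) * e2 -
      (Complex.I / 2 * deriv F z) * kk + F z * p1 + G z * lam * kk - G z * ratio m ε * p2

theorem exists_mem_rightHalfPlane_ne_zero (hε : |ε| < m)
    (hne : ∃ z ∈ lowerHalfPlane, F z ≠ 0 ∨ G z ≠ 0) :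
    ∃ x ∈ rightHalfPlane,
      F (-Complex.I * (x - 1 / 2)) - ratio m ε * G (-Complex.I * (x - 1 / 2)) ≠ 0 ∨
      F (-Complex.I * (x - 1 / 2)) + ratio m ε * G (-Complex.I * (x - 1 / 2)) ≠ 0 := by
  obtain ⟨z, hz, h⟩ := hne
  refine ⟨1 / 2 + Complex.I * z, half_add_mem_rightHalfPlane hz, ?_⟩
  have hk0 : (ratio m ε : ℂ) ≠ 0 := by exact_mod_cast (ratio_pos hε).ne'
  rw [neg_I_mul_half_add]
  by_contra hcon
  push Not at hcon
  obtain ⟨h1, h2⟩ := hcon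
  have hF : F z = 0 := by linear_combination (h1 + h2) / 2
  have hG : (ratio m ε : ℂ) * G z = 0 := by linear_combination (h2 - h1) / 2
  exact h.elim (fun h => h hF) fun h => h ((mul_eq_zero.1 hG).resolve_left hk0)

theorem IsAnalyticSolution.exists_nat (h : IsAnalyticSolution m lam χ ε F G) (hm : 0 < m)
    (hlam : 0 < lam) (hχ : lam ^ 2 < χ ^ 2) (hε : |ε| < m)
    (hne : ∃ z ∈ lowerHalfPlane, F z ≠ 0 ∨ G z ≠ 0) :
    ∃ n : ℕ, Admissible χ n ∧ etaTilde m lam χ ε = n := by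
  obtain ⟨n, hn, hν, -⟩ := (h.reduced hε).exists_nat_of_ne_zero
    (div_pos (mul_pos hlam hm) (kap_pos hε)) (tau_sq hχ hε)
    (exists_mem_rightHalfPlane_ne_zero hε hne)
  exact ⟨n, hn, hν⟩

theorem IsAnalyticSolution.exists_eq_const_mul {F₀ G₀ : ℂ → ℂ}
    (h : IsAnalyticSolution m lam χ ε F G) (h₀ : IsAnalyticSolution m lam χ ε F₀ G₀) (hm : 0 < m)
    (hlam : 0 < lam) (hχ : lam ^ 2 < χ ^ 2) (hε : |ε| < m)
    (hne : ∃ z ∈ lowerHalfPlane, F z ≠ 0 ∨ G z ≠ 0)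
    (hne₀ : ∃ z ∈ lowerHalfPlane, F₀ z ≠ 0 ∨ G₀ z ≠ 0) :
    ∃ c : ℂ, ∀ z ∈ lowerHalfPlane, F z = c * F₀ z ∧ G z = c * G₀ z := by
  obtain ⟨c, hc⟩ := (h.reduced hε).exists_eq_const_mul (h₀.reduced hε)
    (div_pos (mul_pos hlam hm) (kap_pos hε)) (tau_sq hχ hε)
    (exists_mem_rightHalfPlane_ne_zero hε hne) (exists_mem_rightHalfPlane_ne_zero hε hne₀)
  have hk0 : (ratio m ε : ℂ) ≠ 0 := by exact_mod_cast (ratio_pos hε).ne'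
  refine ⟨c, fun z hz => ?_⟩
  have := hc _ (half_add_mem_rightHalfPlane hz)
  rw [neg_I_mul_half_add] at this
  obtain ⟨h1, h2⟩ := this
  constructor
  · linear_combination (h1 + h2) / 2
  · refine mul_left_cancel₀ hk0 ?_
    linear_combination (h2 - h1) / 2

end reduction

/-! ### The confluent hypergeometric series and its contiguous relations -/

section kummer

/-- The coefficients of the confluent hypergeometric series. -/
noncomputable def kummerCoeff (a b : ℂ) (k : ℕ) : ℂ :=
  (ascPochhammer ℂ k).eval a / ((ascPochhammer ℂ k).eval b * (k.factorial : ℂ))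

theorem kummerCoeff_zero (a b : ℂ) : kummerCoeff a b 0 = 1 := by simp [kummerCoeff]

variable {β : ℝ}

theorem norm_add_natCast_ge (hβ : 1 ≤ β) (k : ℕ) : (k : ℝ) + 1 ≤ ‖(β : ℂ) + k‖ := by
  rw [← Complex.ofReal_natCast, ← Complex.ofReal_add, Complex.norm_real, Real.norm_eq_abs]
  exact le_trans (by linarith) (le_abs_self _)

theorem add_natCast_ne_zero (hβ : 1 ≤ β) (k : ℕ) : (β : ℂ) + k ≠ 0 := by
  have h := norm_add_natCast_ge hβ k
  rw [← norm_pos_iff]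
  exact lt_of_lt_of_le (by positivity) h

theorem kummerCoeff_succ (a : ℂ) (b : ℂ) (k : ℕ) :
    kummerCoeff a b (k + 1) = kummerCoeff a b k * ((a + k) / ((b + k) * (k + 1))) := by
  simp only [kummerCoeff, ascPochhammer_succ_eval, Nat.factorial_succ]
  push_cast
  rw [div_mul_div_comm]
  congr 1; ring

/-- The ratio of successive coefficients is at most `(‖a‖+1)/(k+1)`, because `|β+k| ≥ k+1` when `β ≥
1`. The series is therefore dominated by an exponential series; later `β = 2γ+1`. -/
theorem norm_kummerCoeff_le (hβ : 1 ≤ β) (a : ℂ) (k : ℕ) :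
    ‖kummerCoeff a β k‖ ≤ (‖a‖ + 1) ^ k / k.factorial := by
  induction k with
  | zero => simp [kummerCoeff_zero]
  | succ k ih =>
    have h1 : ‖(a + k) / (((β : ℂ) + k) * (k + 1))‖ ≤ (‖a‖ + 1) / (k + 1) := by
      have hk : ‖((k : ℂ) + 1)‖ = k + 1 := by
        rw [← Nat.cast_add_one, Complex.norm_natCast]; push_cast; rfl
      rw [norm_div, norm_mul, hk, div_le_div_iff₀ (by
        have := norm_pos_iff.2 (add_natCast_ne_zero hβ k); positivity) (by positivity)]
      have h2 : ‖a + k‖ ≤ ‖a‖ + k := (norm_add_le _ _).trans_eq (by rw [Complex.norm_natCast])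
      have h3 := norm_add_natCast_ge hβ k
      have h4 : ‖a + k‖ ≤ (‖a‖ + 1) * ‖(β : ℂ) + k‖ := by
        have : (0 : ℝ) ≤ k := k.cast_nonneg
        nlinarith [norm_nonneg a]
      have : (0 : ℝ) ≤ k + 1 := by positivity
      nlinarith
    rw [kummerCoeff_succ, norm_mul, Nat.factorial_succ]
    calc _ ≤ (‖a‖ + 1) ^ k / k.factorial * ((‖a‖ + 1) / (k + 1)) := by gcongr
      _ = _ := by
        push_cast
        rw [div_mul_div_comm, pow_succ]
        congr 1; ring

theorem summable_kummer (hβ : 1 ≤ β) (a x : ℂ) : Summable fun k => kummerCoeff a β k * x ^ k := by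
  refine Summable.of_norm_bounded (Real.summable_pow_div_factorial ((‖a‖ + 1) * ‖x‖)) fun k => ?_
  rw [norm_mul, norm_pow, mul_pow, mul_div_right_comm]
  gcongr
  exact norm_kummerCoeff_le hβ a k

/-- The factor `k` produced by differentiation is absorbed by `k ≤ 2^k`. -/
theorem natCast_mul_pow_div_factorial_le {A : ℝ} (hA : 0 ≤ A) (k : ℕ) :
    (k : ℝ) * (A ^ k / k.factorial) ≤ (2 * A) ^ k / k.factorial := by
  rw [mul_pow, mul_div_assoc]
  gcongr
  exact_mod_cast Nat.lt_two_pow_self.le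

theorem summable_natCast_mul_kummer (hβ : 1 ≤ β) (a x : ℂ) :
    Summable fun k : ℕ => (k : ℂ) * (kummerCoeff a β k * x ^ k) := by
  refine Summable.of_norm_bounded
    (Real.summable_pow_div_factorial (2 * ((‖a‖ + 1) * ‖x‖))) fun k => ?_
  refine le_trans ?_ (natCast_mul_pow_div_factorial_le (by positivity) k)
  rw [norm_mul, Complex.norm_natCast, norm_mul, norm_pow, mul_pow, mul_div_right_comm]
  gcongr
  exact norm_kummerCoeff_le hβ a k

/-- The derivative of `₁F₁`. -/
theorem hasDerivAt_oneFOne (hβ : 1 ≤ β) (a x : ℂ) :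
    HasDerivAt (oneFOne a β) (∑' k : ℕ, kummerCoeff a β k * (k * x ^ (k - 1))) x := by
  set S := ‖x‖ + 1 with hS
  have hS1 : 1 ≤ S := by simp [hS]
  have hx : x ∈ Metric.ball (0 : ℂ) S := by simp [hS]
  refine hasDerivAt_tsum_of_isPreconnected (t := Metric.ball 0 S) (y₀ := 0)
    (g := fun k y => kummerCoeff a β k * y ^ k)
    (g' := fun k y => kummerCoeff a β k * (k * y ^ (k - 1)))
    (Real.summable_pow_div_factorial (2 * ((‖a‖ + 1) * S))) Metric.isOpen_ball
    (convex_ball _ _).isPreconnected (fun k y _ => (hasDerivAt_pow k y).const_mul _) ?_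
    (Metric.mem_ball_self (by linarith)) (summable_kummer hβ a 0) hx
  intro k y hy
  refine le_trans ?_ (natCast_mul_pow_div_factorial_le (by positivity) k)
  have hy' : ‖y‖ ≤ S := (mem_ball_zero_iff.1 hy).le
  rw [norm_mul, norm_mul, Complex.norm_natCast, norm_pow]
  have h1 : ‖y‖ ^ (k - 1) ≤ S ^ k :=
    (pow_le_pow_left₀ (norm_nonneg _) hy' _).trans (pow_le_pow_right₀ hS1 (Nat.sub_le k 1))
  calc _ ≤ (‖a‖ + 1) ^ k / k.factorial * (k * S ^ k) := by
        gcongr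
        exact norm_kummerCoeff_le hβ a k
    _ = _ := by rw [mul_pow]; ring

theorem oneFOne_eq_tsum (a b x : ℂ) : oneFOne a b x = ∑' k, kummerCoeff a b k * x ^ k := rfl

theorem mul_deriv_oneFOne (hβ : 1 ≤ β) (a x : ℂ) :
    x * deriv (oneFOne a β) x = ∑' k : ℕ, (k : ℂ) * (kummerCoeff a β k * x ^ k) := by
  rw [(hasDerivAt_oneFOne hβ a x).deriv, ← tsum_mul_left]
  congr 1; ext k
  rcases k with _ | k
  · simp
  · rw [Nat.add_sub_cancel, pow_succ]; ring

/-- Both sides are `(a)_{k+1}`, with its first or its last factor split off. -/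
theorem mul_ascPochhammer_eval_add_one (a : ℂ) (k : ℕ) :
    a * (ascPochhammer ℂ k).eval (a + 1) = (ascPochhammer ℂ k).eval a * (a + k) := by
  rw [← ascPochhammer_succ_eval, ascPochhammer_succ_left]
  simp

theorem mul_kummerCoeff_add_one (a b : ℂ) (k : ℕ) :
    a * kummerCoeff (a + 1) b k = kummerCoeff a b k * (a + k) := by
  simp only [kummerCoeff]
  rw [← mul_div_assoc, mul_ascPochhammer_eval_add_one, mul_div_right_comm]

/-- Contiguous relation raising the first parameter. -/
theorem mul_deriv_oneFOne_raise (hβ : 1 ≤ β) (a x : ℂ) :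
    x * deriv (oneFOne a β) x = a * (oneFOne (a + 1) β x - oneFOne a β x) := by
  rw [mul_deriv_oneFOne hβ, oneFOne_eq_tsum, oneFOne_eq_tsum,
    ← (summable_kummer hβ _ x).tsum_sub (summable_kummer hβ _ x), ← tsum_mul_left]
  congr 1; ext k
  linear_combination -x ^ k * mul_kummerCoeff_add_one a β k

/-- The lowering relation at the power `x^{k+1}`. All its coefficients are rational multiples of the
one for `a + 1` at index `k`, so only an identity of rational functions is left. -/
theorem kummerCoeff_lower (hβ : 1 ≤ β) (a x : ℂ) (k : ℕ) :
    ((k + 1 : ℕ) : ℂ) * (kummerCoeff (a + 1) β (k + 1) * x ^ (k + 1)) =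
      (β - (a + 1)) * (kummerCoeff a β (k + 1) * x ^ (k + 1)) +
        (((a + 1) - β) * (kummerCoeff (a + 1) β (k + 1) * x ^ (k + 1)) +
        x * (kummerCoeff (a + 1) β k * x ^ k)) := by
  have hl : kummerCoeff a β (k + 1) =
      kummerCoeff (a + 1) β k * (a / ((β + k) * (k + 1))) := by
    rw [kummerCoeff_succ, ← mul_div_assoc, ← mul_kummerCoeff_add_one]; ring
  have hd : ((β : ℂ) + k) * (k + 1) * (((β : ℂ) + k) * (k + 1))⁻¹ = 1 :=
    mul_inv_cancel₀ (mul_ne_zero (add_natCast_ne_zero hβ k) (Nat.cast_add_one_ne_zero k))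
  rw [hl, kummerCoeff_succ, pow_succ, div_eq_mul_inv, div_eq_mul_inv]
  push_cast
  linear_combination (kummerCoeff (a + 1) β k * x ^ k * x) * hd

/-- Contiguous relation lowering the first parameter. -/
theorem mul_deriv_oneFOne_lower (hβ : 1 ≤ β) (a x : ℂ) :
    x * deriv (oneFOne (a + 1) β) x =
      (β - (a + 1)) * oneFOne a β x + ((a + 1) - β + x) * oneFOne (a + 1) β x := by
  have h0 := summable_kummer hβ a x
  have h1 := summable_kummer hβ (a + 1) x
  have A := (summable_natCast_mul_kummer hβ (a + 1) x).tsum_eq_zero_add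
  have B := h0.tsum_eq_zero_add
  have C := h1.tsum_eq_zero_add
  have t1 := (summable_nat_add_iff 1).2 h0
  have t2 := (summable_nat_add_iff 1).2 h1
  have D := ((tsum_congr (kummerCoeff_lower hβ a x)).trans ((t1.mul_left _).tsum_add
    ((t2.mul_left _).add (h1.mul_left _))))
  rw [(t2.mul_left _).tsum_add (h1.mul_left _), tsum_mul_left, tsum_mul_left, tsum_mul_left] at D
  rw [← mul_deriv_oneFOne hβ] at A
  rw [← oneFOne_eq_tsum, kummerCoeff_zero] at B C
  rw [← oneFOne_eq_tsum] at D
  rw [A, D, Nat.cast_zero, zero_mul]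
  -- The constant terms `β - (a+1)` and `(a+1) - β` cancel, which allows both sums to restart at `k
  -- = 0`.
  linear_combination (β - (a + 1)) * (-B) + ((a + 1) - β) * (-C)

theorem oneFOne_zero (a b : ℂ) : oneFOne a b 0 = 1 := by
  rw [oneFOne_eq_tsum, tsum_eq_single 0 (fun k hk => by simp [hk])]
  simp [kummerCoeff_zero]

theorem continuous_oneFOne (hβ : 1 ≤ β) (a : ℂ) : Continuous (oneFOne a β) :=
  continuous_iff_continuousAt.2 fun x => (hasDerivAt_oneFOne hβ a x).continuousAt

theorem ascPochhammer_eval_neg_natCast_eq_zero {n k : ℕ} (h : n < k) :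
    (ascPochhammer ℂ k).eval (-(n : ℂ)) = 0 := by
  induction k with
  | zero => omega
  | succ k ih =>
    rw [ascPochhammer_succ_eval]
    rcases Nat.lt_succ_iff_lt_or_eq.1 h with h | rfl
    · rw [ih h, zero_mul]
    · simp

theorem oneFOne_neg_natCast (n : ℕ) (b x : ℂ) :
    oneFOne (-(n : ℂ)) b x =
      ∑ k ∈ Finset.range (n + 1), kummerCoeff (-(n : ℂ)) b k * x ^ k := by
  rw [oneFOne_eq_tsum]
  refine tsum_eq_sum fun k hk => ?_
  rw [Finset.mem_range, not_lt] at hk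
  simp [kummerCoeff, ascPochhammer_eval_neg_natCast_eq_zero (show n < k by omega)]

end kummer

/-! ### The solution regular at the origin, at an arbitrary energy -/

/-- The radial Dirac equations in the variable `q`, with `k = √((m + ε)/(m - ε))`. -/
def QDirac (lam χ k : ℝ) (f g : ℝ → ℂ) : Prop :=
  ∀ q : ℝ, 0 < q →
    HasDerivAt f (-(((1 + χ) / q : ℝ) : ℂ) * f q + ((k / 2 + lam / q : ℝ) : ℂ) * g q) q ∧
    HasDerivAt g (-(((1 - χ) / q : ℝ) : ℂ) * g q + ((k⁻¹ / 2 - lam / q : ℝ) : ℂ) * f q) q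

section solution

/-- Upper component of the solution of the radial equations that is regular at the origin. -/
noncomputable def regularF (γ χ lam k ν : ℝ) (q : ℝ) : ℂ :=
  ((-γ + χ - lam * k : ℝ) : ℂ) * kummerFactor γ (-(ν : ℂ)) q
    + ((-γ + χ + lam * k : ℝ) : ℂ) * kummerFactor γ (-(ν : ℂ) + 1) q

/-- Lower component of the solution of the radial equations that is regular at the origin. -/
noncomputable def regularG (γ χ lam k ν : ℝ) (q : ℝ) : ℂ :=
  ((k⁻¹ : ℝ) : ℂ) *
    (-(((-γ + χ - lam * k : ℝ) : ℂ) * kummerFactor γ (-(ν : ℂ)) q)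
      + ((-γ + χ + lam * k : ℝ) : ℂ) * kummerFactor γ (-(ν : ℂ) + 1) q)

theorem hasDerivAt_kummerFactor {γ : ℝ} (hγ : 0 < γ) (a : ℂ) {q : ℝ} (hq : 0 < q) :
    HasDerivAt (kummerFactor γ a)
      (((γ - 1) / q - 1 / 2) * kummerFactor γ a q +
        ((1 / Real.Gamma (2 * γ) * q ^ (γ - 1) * Real.exp (-(q / 2)) : ℝ) : ℂ) *
          deriv (oneFOne a (2 * (γ : ℂ) + 1)) q) q := by
  have hb : (2 * (γ : ℂ) + 1) = ((2 * γ + 1 : ℝ) : ℂ) := by push_cast; ring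
  have h1 : HasDerivAt (fun q : ℝ => 1 / Real.Gamma (2 * γ) * q ^ (γ - 1) * Real.exp (-(q / 2)))
      (1 / Real.Gamma (2 * γ) * q ^ (γ - 1) * Real.exp (-(q / 2)) * ((γ - 1) / q - 1 / 2)) q := by
    have e1 := (Real.hasDerivAt_rpow_const (x := q) (p := γ - 1) (Or.inl hq.ne')).const_mul
      (1 / Real.Gamma (2 * γ))
    have e2 := ((hasDerivAt_id q).div_const 2).neg.exp
    refine (e1.mul e2).congr_deriv ?_
    rw [Real.rpow_sub_one hq.ne' (γ - 1)]
    simp only [id, Pi.neg_apply]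
    ring
  have h2 : HasDerivAt (fun q : ℝ => oneFOne a (2 * (γ : ℂ) + 1) q)
      (deriv (oneFOne a (2 * (γ : ℂ) + 1)) q) q := by
    rw [hb]
    have := (hasDerivAt_oneFOne (β := 2 * γ + 1) (by linarith) a (q : ℂ))
    exact this.differentiableAt.hasDerivAt.comp_ofReal
  refine (h1.ofReal_comp.mul h2).congr_deriv ?_
  simp only [kummerFactor]
  push_cast
  ring

/-- The Kummer functions with parameters `-ν` and `-ν+1` are exchanged by the raising and lowering
relations, so their span over functions of `q` is closed under differentiation. The system becomes
an algebraic identity in the two functions, true by `hγχ` and `hν`. Here `ν` need not be an integer.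
-/
theorem qDirac_regular {γ χ lam k ν : ℝ} (hγ : 0 < γ) (hk : k ≠ 0) (hγχ : γ ^ 2 = χ ^ 2 - lam ^ 2)
    (hν : lam * k - lam * k⁻¹ = 2 * (ν + γ)) :
    QDirac lam χ k (regularF γ χ lam k ν) (regularG γ χ lam k ν) := by
  intro q hq
  have hqc : (q : ℂ) ≠ 0 := by exact_mod_cast hq.ne'
  have hkc : (k : ℂ) ≠ 0 := by exact_mod_cast hk
  have hb : (2 * (γ : ℂ) + 1) = ((2 * γ + 1 : ℝ) : ℂ) := by push_cast; ring
  have d0 := hasDerivAt_kummerFactor hγ (-(ν : ℂ)) hq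
  have d1 := hasDerivAt_kummerFactor hγ (-(ν : ℂ) + 1) hq
  have k0 := mul_deriv_oneFOne_raise (β := 2 * γ + 1) (by linarith) (-(ν : ℂ)) q
  have k1 := mul_deriv_oneFOne_lower (β := 2 * γ + 1) (by linarith) (-(ν : ℂ)) q
  rw [← hb] at k0 k1
  set ρ : ℂ := ((1 / Real.Gamma (2 * γ) * q ^ (γ - 1) * Real.exp (-(q / 2)) : ℝ) : ℂ) with hρ
  have K0 : kummerFactor γ (-(ν : ℂ)) q = ρ * oneFOne (-(ν : ℂ)) (2 * γ + 1) q := rfl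
  have K1 : kummerFactor γ (-(ν : ℂ) + 1) q = ρ * oneFOne (-(ν : ℂ) + 1) (2 * γ + 1) q := rfl
  have r1 : (γ : ℂ) ^ 2 = χ ^ 2 - lam ^ 2 := by exact_mod_cast hγχ
  have r2 : (lam : ℂ) * k - lam * (k : ℂ)⁻¹ = 2 * (ν + γ) := by exact_mod_cast hν
  have qw : (q : ℂ) * (q : ℂ)⁻¹ = 1 := mul_inv_cancel₀ hqc
  have kk : (k : ℂ) * (k : ℂ)⁻¹ = 1 := mul_inv_cancel₀ hkc
  set w : ℂ := (q : ℂ)⁻¹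
  set J : ℂ := (k : ℂ)⁻¹
  have D0 : ρ * deriv (oneFOne (-(ν : ℂ)) (2 * γ + 1)) q =
      -ν * (kummerFactor γ (-(ν : ℂ) + 1) q - kummerFactor γ (-(ν : ℂ)) q) * w := by
    rw [K0, K1]
    linear_combination ρ * w * k0 - ρ * deriv (oneFOne (-(ν : ℂ)) (2 * γ + 1)) q * qw
  have D1 : ρ * deriv (oneFOne (-(ν : ℂ) + 1) (2 * γ + 1)) q =
      ((2 * γ + ν) * kummerFactor γ (-(ν : ℂ)) q +
        (-ν - 2 * γ + q) * kummerFactor γ (-(ν : ℂ) + 1) q) * w := by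
    rw [K0, K1]
    linear_combination ρ * w * k1 - ρ * deriv (oneFOne (-(ν : ℂ) + 1) (2 * γ + 1)) q * qw
  rw [D0] at d0
  rw [D1] at d1
  constructor
  · refine ((d0.const_mul _).add (d1.const_mul _)).congr_deriv ?_
    simp only [regularF, regularG]
    push_cast
    simp only [div_eq_mul_inv]
    set u := kummerFactor γ (-(ν : ℂ)) q
    set v := kummerFactor γ (-(ν : ℂ) + 1) q
    linear_combination w * (u * (-(χ - γ) * r2 - r1 - lam ^ 2 * kk) +
      v * ((χ - γ) * r2 - r1 - lam ^ 2 * kk)) -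
      1 / 2 * (-(-γ + χ - lam * k) * u + (-γ + χ + lam * k) * v) * kk +
      (-γ + χ + lam * k) * v * qw
  · refine (((d0.const_mul _).neg.add (d1.const_mul _)).const_mul _).congr_deriv ?_
    simp only [regularF, regularG]
    push_cast
    simp only [div_eq_mul_inv]
    set u := kummerFactor γ (-(ν : ℂ)) q
    set v := kummerFactor γ (-(ν : ℂ) + 1) q
    linear_combination J * w * (u * (-lam * k * r2 - r1 - lam ^ 2 * kk) +
      v * (lam * k * r2 + r1 + lam ^ 2 * kk)) + J * (-γ + χ + lam * k) * v * qw -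
      lam * w * ((-γ + χ - lam * k) * u + (-γ + χ + lam * k) * v) * kk

end solution

/-! ### Bound states are regular at the origin and lie in the domain of the transform -/

theorem isBigO_kummerFactor {γ : ℝ} (hγ : 0 < γ) (a : ℂ) :
    kummerFactor γ a =O[𝓝[>] 0] fun q : ℝ => q ^ (γ - 1) := by
  have hb : (2 * (γ : ℂ) + 1) = ((2 * γ + 1 : ℝ) : ℂ) := by push_cast; ring
  have hc : Continuous fun q : ℝ => ((1 / Real.Gamma (2 * γ) * Real.exp (-(q / 2)) : ℝ) : ℂ) *
      oneFOne a (2 * (γ : ℂ) + 1) q := by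
    have := (continuous_oneFOne (β := 2 * γ + 1) (by linarith) a).comp Complex.continuous_ofReal
    rw [hb]
    exact (by fun_prop : Continuous fun q : ℝ =>
      ((1 / Real.Gamma (2 * γ) * Real.exp (-(q / 2)) : ℝ) : ℂ)).mul this
  have h1 := ((hc.tendsto 0).mono_left (nhdsWithin_le_nhds (s := Ioi 0))).isBigO_one ℝ
  have h2 : (fun q : ℝ => ((q ^ (γ - 1) : ℝ) : ℂ)) =O[𝓝[>] 0] fun q : ℝ => q ^ (γ - 1) :=
    IsBigO.of_norm_left (by simpa using (isBigO_refl _ _).norm_left)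
  refine ((h2.mul h1).congr_left fun q => ?_).congr_right fun q => by simp
  simp only [kummerFactor]; push_cast; ring

/-- Near the origin the regular solution is bounded by `q^{γ-1}`, and its upper component does not
vanish. -/
theorem regular_near_zero {γ χ lam k ν : ℝ} (hγ : 0 < γ) (hγχ : γ ≠ χ) :
    (regularF γ χ lam k ν =O[𝓝[>] 0] fun q : ℝ => q ^ (γ - 1)) ∧
    (regularG γ χ lam k ν =O[𝓝[>] 0] fun q : ℝ => q ^ (γ - 1)) ∧
    ∀ᶠ q in 𝓝[>] (0 : ℝ), regularF γ χ lam k ν q ≠ 0 := by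
  have h0 := isBigO_kummerFactor hγ (-(ν : ℂ))
  have h1 := isBigO_kummerFactor hγ (-(ν : ℂ) + 1)
  refine ⟨(h0.const_mul_left _).add (h1.const_mul_left _),
    ((h0.const_mul_left _).neg_left.add (h1.const_mul_left _)).const_mul_left _, ?_⟩
  have hb : (2 * (γ : ℂ) + 1) = ((2 * γ + 1 : ℝ) : ℂ) := by push_cast; ring
  have hc : Continuous fun q : ℝ =>
      ((-γ + χ - lam * k : ℝ) : ℂ) * oneFOne (-(ν : ℂ)) (2 * (γ : ℂ) + 1) q +
      ((-γ + χ + lam * k : ℝ) : ℂ) * oneFOne (-(ν : ℂ) + 1) (2 * (γ : ℂ) + 1) q := by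
    have c0 := (continuous_oneFOne (β := 2 * γ + 1) (by linarith) (-(ν : ℂ))).comp
      Complex.continuous_ofReal
    have c1 := (continuous_oneFOne (β := 2 * γ + 1) (by linarith) (-(ν : ℂ) + 1)).comp
      Complex.continuous_ofReal
    rw [hb]
    exact (continuous_const.mul c0).add (continuous_const.mul c1)
  -- Both series equal `1` at the origin, so the `λk` terms cancel and `2(χ-γ)` remains.
  have hne : (fun q : ℝ =>
      ((-γ + χ - lam * k : ℝ) : ℂ) * oneFOne (-(ν : ℂ)) (2 * (γ : ℂ) + 1) q +
      ((-γ + χ + lam * k : ℝ) : ℂ) * oneFOne (-(ν : ℂ) + 1) (2 * (γ : ℂ) + 1) q) 0 ≠ 0 := by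
    simp only [Complex.ofReal_zero, oneFOne_zero, mul_one]
    rw [← Complex.ofReal_add]
    norm_cast
    intro h
    exact hγχ (by linarith)
  filter_upwards [nhdsWithin_le_nhds (hc.continuousAt.eventually_ne hne), self_mem_nhdsWithin]
    with q hq hq0
  have hq0 : 0 < q := hq0
  have hG : 0 < Real.Gamma (2 * γ) := Real.Gamma_pos_of_pos (by linarith)
  have hρ : ((1 / Real.Gamma (2 * γ) * q ^ (γ - 1) * Real.exp (-(q / 2)) : ℝ) : ℂ) ≠ 0 := by
    have : 0 < 1 / Real.Gamma (2 * γ) * q ^ (γ - 1) * Real.exp (-(q / 2)) := by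
      have := Real.rpow_pos_of_pos hq0 (γ - 1)
      positivity
    exact_mod_cast this.ne'
  have := mul_ne_zero hρ hq
  intro h
  refine this ?_
  rw [← h]
  simp only [regularF, kummerFactor]; ring

/-- Bound states in the variable `q`. -/
structure QBound (γ lam χ k : ℝ) (f g : ℝ → ℂ) : Prop where
  dirac : QDirac lam χ k f g
  sq_f : IntegrableOn (fun q : ℝ => q ^ 2 * ‖f q‖ ^ 2) (Ioi 0)
  sq_g : IntegrableOn (fun q : ℝ => q ^ 2 * ‖g q‖ ^ 2) (Ioi 0)
  zero : γ < 1 / 2 → ∃ d : ℝ, 0 < d ∧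
    IntegrableOn (fun q : ℝ => q ^ γ * ‖f q‖) (Ioc 0 d) ∧
    IntegrableOn (fun q : ℝ => q ^ γ * ‖g q‖) (Ioc 0 d)

section wronskian

variable {lam χ k : ℝ} {f g f₁ g₁ : ℝ → ℂ}

theorem QDirac.continuousOn_f (h : QDirac lam χ k f g) : ContinuousOn f (Ioi 0) := fun q hq =>
  (h q hq).1.continuousAt.continuousWithinAt

theorem QDirac.continuousOn_g (h : QDirac lam χ k f g) : ContinuousOn g (Ioi 0) := fun q hq =>
  (h q hq).2.continuousAt.continuousWithinAt

/-- The Wronskian of two solutions is constant. -/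
theorem QDirac.exists_wronskian (h : QDirac lam χ k f g) (h₁ : QDirac lam χ k f₁ g₁) :
    ∃ W : ℂ, ∀ q : ℝ, 0 < q → (q : ℂ) ^ 2 * (f₁ q * g q - f q * g₁ q) = W := by
  -- The factor `q²` compensates the trace `-2/q` of the system.
  have hd : ∀ q ∈ Ioi (0 : ℝ), HasDerivAt
      (fun q : ℝ => (q : ℂ) ^ 2 * (f₁ q * g q - f q * g₁ q)) 0 q := by
    intro q hq
    have hq : 0 < q := hq
    have hqc : (q : ℂ) ≠ 0 := by exact_mod_cast hq.ne'
    have e1 : HasDerivAt (fun q : ℝ => (q : ℂ) ^ 2) (2 * q) q := by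
      simpa using (hasDerivAt_pow 2 (q : ℂ)).comp_ofReal
    have e2 := ((h₁ q hq).1.mul (h q hq).2).sub ((h q hq).1.mul (h₁ q hq).2)
    refine (e1.mul e2).congr_deriv ?_
    simp only [Pi.sub_apply, Pi.mul_apply]
    push_cast
    field_simp
    ring
  refine ⟨((1 : ℝ) : ℂ) ^ 2 * (f₁ 1 * g 1 - f 1 * g₁ 1), fun q hq => ?_⟩
  exact isOpen_Ioi.is_const_of_deriv_eq_zero isPreconnected_Ioi
    (fun x hx => (hd x hx).differentiableAt.differentiableWithinAt)
    (fun x hx => (hd x hx).deriv) hq (mem_Ioi.2 one_pos)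

/-- The derivative of `f / f₁` is `k/2 + λ/q` times the Wronskian numerator over `f₁²`, hence zero
wherever `f₁ ≠ 0`. -/
theorem QDirac.eventually_eq_const_mul (h : QDirac lam χ k f g) (h₁ : QDirac lam χ k f₁ g₁)
    (hW : ∀ q : ℝ, 0 < q → f₁ q * g q = f q * g₁ q)
    (hne : ∀ᶠ q in 𝓝[>] (0 : ℝ), f₁ q ≠ 0) :
    ∃ c : ℂ, ∀ᶠ q in 𝓝[>] (0 : ℝ), f q = c * f₁ q ∧ g q = c * g₁ q := by
  obtain ⟨δ, hδ, hne⟩ := mem_nhdsGT_iff_exists_Ioo_subset.1 hne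
  have hδ : 0 < δ := hδ
  have hd : ∀ q ∈ Ioo 0 δ, HasDerivAt (fun q => f q / f₁ q) 0 q := by
    intro q hq
    refine ((h q hq.1).1.div (h₁ q hq.1).1 (hne hq)).congr_deriv ?_
    rw [div_eq_zero_iff]
    left
    linear_combination (((k / 2 + lam / q : ℝ) : ℂ)) * hW q hq.1
  refine ⟨f (δ / 2) / f₁ (δ / 2), ?_⟩
  filter_upwards [Ioo_mem_nhdsGT hδ] with q hq
  have hc : f q / f₁ q = f (δ / 2) / f₁ (δ / 2) :=
    isOpen_Ioo.is_const_of_deriv_eq_zero isPreconnected_Ioo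
      (fun x hx => (hd x hx).differentiableAt.differentiableWithinAt)
      (fun x hx => (hd x hx).deriv) hq ⟨by linarith, by linarith⟩
  have hq1 : f₁ q ≠ 0 := hne hq
  have e1 : f q = f q / f₁ q * f₁ q := (div_mul_cancel₀ _ hq1).symm
  rw [← hc]
  refine ⟨e1, mul_left_cancel₀ hq1 ?_⟩
  rw [hW q hq.1]
  nth_rewrite 1 [e1]
  ring

end wronskian

section bound

variable {γ lam χ k ν : ℝ} {f g : ℝ → ℂ}

theorem not_integrableOn_const_mul_rpow {c s d : ℝ} (hc : c ≠ 0) (hs : s ≤ -1) (hd : 0 < d) :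
    ¬ IntegrableOn (fun q : ℝ => c * q ^ s) (Ioo 0 d) := by
  intro h
  have h2 : IntegrableOn (fun q : ℝ => q ^ s) (Ioo 0 d) := by
    refine (Integrable.const_mul h c⁻¹).congr (ae_of_all _ fun q => ?_)
    simp only
    rw [inv_mul_cancel_left₀ hc]
  have := (intervalIntegral.integrableOn_Ioo_rpow_iff hd).1 h2
  linarith

/-- Compare with the regular solution. If the Wronskian vanishes, the two are proportional near the
origin. If it is `W ≠ 0`, the bound `O(q^{γ-1})` on the regular solution forces `‖f‖ + ‖g‖ ≥ c
q^{-γ-1}`, which is too singular. -/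
theorem QBound.isBigO (h : QBound γ lam χ k f g) (hγ : 0 < γ) (hlam : lam ≠ 0) (hk : k ≠ 0)
    (hγχ : γ ^ 2 = χ ^ 2 - lam ^ 2) (hν : lam * k - lam * k⁻¹ = 2 * (ν + γ)) :
    (f =O[𝓝[>] 0] fun q : ℝ => q ^ (γ - 1)) ∧ (g =O[𝓝[>] 0] fun q : ℝ => q ^ (γ - 1)) := by
  have hreg := qDirac_regular hγ hk hγχ hν
  have hne : γ ≠ χ := by
    rintro rfl
    exact hlam (by nlinarith)
  obtain ⟨hF, hG, hF0⟩ := regular_near_zero (lam := lam) (k := k) (ν := ν) hγ hne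
  obtain ⟨W, hW⟩ := h.dirac.exists_wronskian hreg
  by_cases hW0 : W = 0
  · obtain ⟨c, hc⟩ := h.dirac.eventually_eq_const_mul hreg (fun q hq => by
      have hq2 : (q : ℂ) ^ 2 ≠ 0 := by
        have : (q : ℂ) ≠ 0 := by exact_mod_cast hq.ne'
        exact pow_ne_zero 2 this
      have := hW q hq
      rw [hW0] at this
      exact sub_eq_zero.1 ((mul_eq_zero.1 this).resolve_left hq2)) hF0
    exact ⟨(hF.const_mul_left c).congr' (hc.mono fun q hq => hq.1.symm) EventuallyEq.rfl,
      (hG.const_mul_left c).congr' (hc.mono fun q hq => hq.2.symm) EventuallyEq.rfl⟩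
  exfalso
  obtain ⟨C, hC, hFC⟩ := hF.exists_pos
  obtain ⟨D, hD, hGD⟩ := hG.exists_pos
  obtain ⟨δ, hδ, hb⟩ := mem_nhdsGT_iff_exists_Ioo_subset.1 (hFC.bound.and hGD.bound)
  have hδ : 0 < δ := hδ
  have hWn : 0 < ‖W‖ := norm_pos_iff.2 hW0
  set c := ‖W‖ / (C + D) with hc
  have hc0 : 0 < c := by positivity
  have key : ∀ q ∈ Ioo 0 δ, c * q ^ (-γ - 1) ≤ ‖f q‖ + ‖g q‖ := by
    intro q hq
    have hq0 : 0 < q := hq.1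
    obtain ⟨b1, b2⟩ := hb hq
    have hp := Real.rpow_pos_of_pos hq0 (γ - 1)
    rw [Real.norm_of_nonneg hp.le] at b1 b2
    have h1 : ‖W‖ ≤ q ^ 2 * ((C + D) * q ^ (γ - 1) * (‖f q‖ + ‖g q‖)) := by
      rw [← hW q hq0, norm_mul, norm_pow, Complex.norm_real, Real.norm_of_nonneg hq0.le]
      gcongr
      refine (norm_sub_le _ _).trans ?_
      rw [norm_mul, norm_mul]
      have m1 := mul_le_mul_of_nonneg_right b1 (norm_nonneg (g q))
      have m2 := mul_le_mul_of_nonneg_right b2 (norm_nonneg (f q))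
      have m3 : 0 ≤ C * q ^ (γ - 1) * ‖f q‖ := by positivity
      have m4 : 0 ≤ D * q ^ (γ - 1) * ‖g q‖ := by positivity
      nlinarith
    have h2 : q ^ 2 * q ^ (γ - 1) * q ^ (-γ - 1) = 1 := by
      rw [← Real.rpow_natCast, ← Real.rpow_add hq0, ← Real.rpow_add hq0]
      have : ((2 : ℕ) : ℝ) + (γ - 1) + (-γ - 1) = 0 := by push_cast; ring
      rw [this, Real.rpow_zero]
    have hp2 := Real.rpow_pos_of_pos hq0 (-γ - 1)
    rw [hc, div_mul_eq_mul_div, div_le_iff₀ (by positivity)]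
    calc ‖W‖ * q ^ (-γ - 1)
        ≤ q ^ 2 * ((C + D) * q ^ (γ - 1) * (‖f q‖ + ‖g q‖)) * q ^ (-γ - 1) := by gcongr
      _ = (q ^ 2 * q ^ (γ - 1) * q ^ (-γ - 1)) * ((‖f q‖ + ‖g q‖) * (C + D)) := by ring
      _ = _ := by rw [h2, one_mul]
  have hmeas : ∀ (c s d : ℝ), AEStronglyMeasurable (fun q : ℝ => c * q ^ s)
      (volume.restrict (Ioo 0 d)) := fun c s d =>
    (measurable_const.mul (measurable_id.pow_const s)).aestronglyMeasurable
  -- For `γ < 1/2` the weight `q^γ` turns the lower bound into `q^{-1}`; otherwise squaring with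
  -- weight `q²` gives `q^{-2γ}`, where `-2γ ≤ -1`. Neither is integrable at `0`.
  by_cases hg : γ < 1 / 2
  · obtain ⟨d, hd, i1, i2⟩ := h.zero hg
    have hm : 0 < min d δ := lt_min hd hδ
    refine not_integrableOn_const_mul_rpow (d := min d δ) hc0.ne' le_rfl hm ?_
    have hi := (i1.add i2).mono_set (fun q hq => ⟨hq.1, (hq.2.trans_le (min_le_left d δ)).le⟩ :
      Ioo 0 (min d δ) ⊆ Ioc 0 d)
    refine Integrable.mono' hi (hmeas _ _ _)
      ((ae_restrict_iff' measurableSet_Ioo).2 (ae_of_all _ fun q hq => ?_))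
    have hq0 : 0 < q := hq.1
    have hk := key q ⟨hq.1, hq.2.trans_le (min_le_right _ _)⟩
    have hp := Real.rpow_pos_of_pos hq0 (-1)
    rw [Real.norm_of_nonneg (by positivity)]
    have e : q ^ (-1 : ℝ) = q ^ γ * q ^ (-γ - 1) := by
      rw [← Real.rpow_add hq0]; congr 1; ring
    have hp2 := Real.rpow_pos_of_pos hq0 γ
    simp only [Pi.add_apply]
    rw [e]
    nlinarith [mul_le_mul_of_nonneg_left hk hp2.le]
  · refine not_integrableOn_const_mul_rpow (s := -2 * γ) (d := δ)
      (by positivity : c ^ 2 ≠ 0) (by linarith) hδ ?_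
    have hi := (h.sq_f.add h.sq_g).mono_set (fun q hq => hq.1 : Ioo 0 δ ⊆ Ioi 0)
    refine Integrable.mono' (hi.const_mul 2) (hmeas _ _ _)
      ((ae_restrict_iff' measurableSet_Ioo).2 (ae_of_all _ fun q hq => ?_))
    have hq0 : 0 < q := hq.1
    have hk := key q hq
    have hp := Real.rpow_pos_of_pos hq0 (-2 * γ)
    have hp2 := Real.rpow_pos_of_pos hq0 (-γ - 1)
    rw [Real.norm_of_nonneg (by positivity)]
    have e : q ^ (-2 * γ) = q ^ 2 * (q ^ (-γ - 1)) ^ 2 := by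
      rw [← Real.rpow_natCast, ← Real.rpow_natCast, ← Real.rpow_mul hq0.le, ← Real.rpow_add hq0]
      congr 1; push_cast; ring
    simp only [Pi.add_apply]
    rw [e]
    have h3 : (c * q ^ (-γ - 1)) ^ 2 ≤ (‖f q‖ + ‖g q‖) ^ 2 :=
      pow_le_pow_left₀ (by positivity) hk 2
    have h4 : (‖f q‖ + ‖g q‖) ^ 2 ≤ 2 * (‖f q‖ ^ 2 + ‖g q‖ ^ 2) := by
      nlinarith [sq_nonneg (‖f q‖ - ‖g q‖)]
    have h5 := mul_le_mul_of_nonneg_left (h3.trans h4) (sq_nonneg q)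
    nlinarith

/-- Near the origin `q^γ f = O(q^{2γ-1})`, integrable since `γ > 0`. Away from it only `q f ∈ L²` is
known, and the exponential supplies the other square-integrable factor. -/
theorem laplaceClass_of_isBigO (hγ : 0 < γ) (hc : ContinuousOn f (Ioi 0))
    (hO : f =O[𝓝[>] 0] fun q : ℝ => q ^ (γ - 1))
    (hsq : IntegrableOn (fun q : ℝ => q ^ 2 * ‖f q‖ ^ 2) (Ioi 0)) : LaplaceClass γ f := by
  intro a ha
  obtain ⟨C, hC, hb⟩ := hO.exists_pos
  obtain ⟨δ, hδ, hb⟩ := mem_nhdsGT_iff_exists_Ioo_subset.1 hb.bound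
  have hδ : 0 < δ := hδ
  have hcont : ContinuousOn (fun q : ℝ => ((Real.exp (-(a * q)) : ℝ) : ℂ) *
      (((q ^ γ : ℝ) : ℂ) * f q)) (Ioi 0) := by
    refine ContinuousOn.mul (by fun_prop) (ContinuousOn.mul ?_ hc)
    exact Complex.continuous_ofReal.comp_continuousOn
      (continuousOn_id.rpow_const fun x hx => Or.inl (ne_of_gt hx))
  have hnorm : ∀ q : ℝ, 0 < q → ‖((Real.exp (-(a * q)) : ℝ) : ℂ) * (((q ^ γ : ℝ) : ℂ) * f q)‖ =
      Real.exp (-(a * q)) * (q ^ γ * ‖f q‖) := fun q hq => by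
    rw [norm_mul, norm_mul, Complex.norm_real, Complex.norm_real,
      Real.norm_of_nonneg (Real.exp_pos _).le, Real.norm_of_nonneg (Real.rpow_pos_of_pos hq γ).le]
  have hun : Ioi (0 : ℝ) = Ioo 0 δ ∪ Ici δ := (Ioo_union_Ici_eq_Ioi hδ).symm
  rw [hun]
  refine IntegrableOn.union ?_ ?_
  · have hi : IntegrableOn (fun q : ℝ => C * q ^ (2 * γ - 1)) (Ioo 0 δ) :=
      ((intervalIntegral.integrableOn_Ioo_rpow_iff hδ).2 (by linarith)).const_mul C
    refine Integrable.mono' hi ((hcont.mono fun q hq => hq.1).aestronglyMeasurable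
      measurableSet_Ioo) ((ae_restrict_iff' measurableSet_Ioo).2 (ae_of_all _ fun q hq => ?_))
    have hq0 : 0 < q := hq.1
    have hbq : ‖f q‖ ≤ C * ‖q ^ (γ - 1)‖ := hb hq
    rw [Real.norm_of_nonneg (Real.rpow_pos_of_pos hq0 (γ - 1)).le] at hbq
    rw [hnorm q hq0]
    have e : q ^ (2 * γ - 1) = q ^ γ * q ^ (γ - 1) := by
      rw [← Real.rpow_add hq0]; congr 1; ring
    have h1 : Real.exp (-(a * q)) ≤ 1 := Real.exp_le_one_iff.2 (by nlinarith)
    have hp := Real.rpow_pos_of_pos hq0 γ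
    calc _ ≤ 1 * (q ^ γ * (C * q ^ (γ - 1))) := by gcongr
      _ = _ := by rw [e]; ring
  · have hsub : Ici δ ⊆ Ioi (0 : ℝ) := fun q hq => lt_of_lt_of_le hδ hq
    have h1 : IntegrableOn (fun q : ℝ => δ⁻¹ ^ 2 * (q ^ (2 * γ) * Real.exp (-(2 * a) * q))) (Ioi 0) := by
      have := integrableOn_rpow_mul_exp_neg_mul_rpow (s := 2 * γ) (p := 1) (b := 2 * a)
        (by linarith) one_pos (by linarith)
      simp only [Real.rpow_one] at this
      exact Integrable.const_mul this _
    have hi := (h1.add hsq).mono_set hsub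
    refine Integrable.mono' hi ((hcont.mono hsub).aestronglyMeasurable
      measurableSet_Ici) ((ae_restrict_iff' measurableSet_Ici).2 (ae_of_all _ fun q hq => ?_))
    have hq0 : 0 < q := hsub hq
    rw [hnorm q hq0]
    simp only [Pi.add_apply]
    have e1 : q ^ (2 * γ) = (q ^ γ) ^ 2 := by
      rw [← Real.rpow_natCast, ← Real.rpow_mul hq0.le]; congr 1; push_cast; ring
    have e2 : Real.exp (-(2 * a) * q) = Real.exp (-(a * q)) ^ 2 := by
      rw [← Real.exp_nat_mul]; congr 1; push_cast; ring
    rw [e1, e2]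
    have hp := Real.rpow_pos_of_pos hq0 γ
    have he := Real.exp_pos (-(a * q))
    -- On `q ≥ δ` this inserts the missing factor `q`; then `uv ≤ u² + v²` separates the exponential
    -- from `q f`.
    have h2 : 1 ≤ δ⁻¹ * q := by
      rw [← div_eq_inv_mul, le_div_iff₀ hδ, one_mul]; exact hq
    have h3 : Real.exp (-(a * q)) * (q ^ γ * ‖f q‖) ≤
        (δ⁻¹ * (q ^ γ * Real.exp (-(a * q)))) * (q * ‖f q‖) := by
      have : 0 ≤ Real.exp (-(a * q)) * (q ^ γ * ‖f q‖) := by positivity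
      nlinarith
    nlinarith [sq_nonneg ((δ⁻¹ * (q ^ γ * Real.exp (-(a * q)))) - (q * ‖f q‖)),
      sq_nonneg ((δ⁻¹ * (q ^ γ * Real.exp (-(a * q)))) + (q * ‖f q‖))]

end bound

/-! ### Change of variable between `r` and `q` -/

section scaling

variable {m lam χ ε : ℝ} {f g F G : ℝ → ℂ}

theorem inQ_inR (hε : |ε| < m) (f : ℝ → ℂ) : inQ m ε (inR m ε f) = f := by
  ext q
  have := (kap_pos hε).ne'
  simp only [inQ, inR]
  congr 1; field_simp

theorem inR_inQ (hε : |ε| < m) (f : ℝ → ℂ) : inR m ε (inQ m ε f) = f := by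
  ext q
  have := (kap_pos hε).ne'
  simp only [inQ, inR]
  congr 1; field_simp

theorem RadialDirac.qDirac (h : RadialDirac m lam χ ε f g) (hε : |ε| < m) :
    QDirac lam χ (ratio m ε) (inQ m ε f) (inQ m ε g) := by
  intro q hq
  have hκ := kap_pos hε
  have hr : 0 < q / (2 * kap m ε) := by positivity
  obtain ⟨d1, d2, e1, e2⟩ := h _ hr
  have hs : HasDerivAt (fun q : ℝ => q / (2 * kap m ε)) (1 / (2 * kap m ε)) q :=
    (hasDerivAt_id q).div_const _
  have s1 := d1.hasDerivAt.scomp q hs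
  have s2 := d2.hasDerivAt.scomp q hs
  have hqc : (q : ℂ) ≠ 0 := by exact_mod_cast hq.ne'
  have hκc : (kap m ε : ℂ) ≠ 0 := by exact_mod_cast hκ.ne'
  have e1' := eq_sub_of_add_eq (sub_eq_zero.1 e1)
  have e2' := eq_neg_of_add_eq_zero_left e2
  rw [inv_ratio_eq hε, ratio_eq hε]
  constructor
  · refine s1.congr_deriv ?_
    rw [e1']
    simp only [inQ, Complex.real_smul]
    push_cast
    field_simp
    ring
  · refine s2.congr_deriv ?_
    rw [eq_sub_of_add_eq e2']
    simp only [inQ, Complex.real_smul]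
    push_cast
    field_simp
    ring

theorem QDirac.radialDirac (h : QDirac lam χ (ratio m ε) F G) (hε : |ε| < m) :
    RadialDirac m lam χ ε (inR m ε F) (inR m ε G) := by
  intro r hr
  have hκ := kap_pos hε
  have hq : 0 < 2 * kap m ε * r := by positivity
  obtain ⟨d1, d2⟩ := h _ hq
  have hs : HasDerivAt (fun r : ℝ => 2 * kap m ε * r) (2 * kap m ε) r := by
    simpa using (hasDerivAt_id r).const_mul (2 * kap m ε)
  have s1 : HasDerivAt (inR m ε F) _ r := d1.scomp r hs
  have s2 : HasDerivAt (inR m ε G) _ r := d2.scomp r hs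
  have hrc : (r : ℂ) ≠ 0 := by exact_mod_cast hr.ne'
  have hκc : (kap m ε : ℂ) ≠ 0 := by exact_mod_cast hκ.ne'
  refine ⟨s1.differentiableAt, s2.differentiableAt, ?_, ?_⟩
  · rw [s1.deriv, ratio_eq hε]
    simp only [inR, Complex.real_smul]
    push_cast
    field_simp
    ring
  · rw [s2.deriv, inv_ratio_eq hε]
    simp only [inR, Complex.real_smul]
    push_cast
    field_simp
    ring

theorem integrableOn_sq_inQ (hε : |ε| < m)
    (h : MemLp (fun r : ℝ => (r : ℂ) * f r) 2 (volume.restrict (Ioi 0))) :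
    IntegrableOn (fun q : ℝ => q ^ 2 * ‖inQ m ε f q‖ ^ 2) (Ioi 0) := by
  have hκ := kap_pos hε
  have h1 := (memLp_two_iff_integrable_sq_norm h.1).1 h
  have hc : 0 < (2 * kap m ε)⁻¹ := by positivity
  have h2 := (integrableOn_Ioi_comp_mul_left_iff (fun r : ℝ => ‖(r : ℂ) * f r‖ ^ 2) 0 hc).2
    (by rw [mul_zero]; exact h1)
  refine (Integrable.const_mul h2 ((2 * kap m ε) ^ 2)).congr (ae_of_all _ fun q => ?_)
  simp only [inQ, norm_mul, Complex.norm_real, mul_pow, Real.norm_eq_abs, sq_abs]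
  rw [show (2 * kap m ε)⁻¹ * q = q / (2 * kap m ε) by ring]
  field_simp

theorem memLp_inR (hε : |ε| < m) (hF : ContinuousOn F (Ioi 0))
    (h : IntegrableOn (fun q : ℝ => q ^ 2 * ‖F q‖ ^ 2) (Ioi 0)) :
    MemLp (fun r : ℝ => (r : ℂ) * inR m ε F r) 2 (volume.restrict (Ioi 0)) := by
  have hκ := kap_pos hε
  have hc : 0 < 2 * kap m ε := by positivity
  have hcont : ContinuousOn (fun r : ℝ => (r : ℂ) * inR m ε F r) (Ioi 0) := by
    refine ContinuousOn.mul (by fun_prop) ?_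
    exact hF.comp (by fun_prop) fun r hr => mul_pos hc hr
  rw [memLp_two_iff_integrable_sq_norm (hcont.aestronglyMeasurable measurableSet_Ioi)]
  have h2 := (integrableOn_Ioi_comp_mul_left_iff _ 0 hc).2 (by rw [mul_zero]; exact h)
  refine (Integrable.const_mul h2 ((2 * kap m ε)⁻¹ ^ 2)).congr (ae_of_all _ fun q => ?_)
  simp only [inR, norm_mul, Complex.norm_real, mul_pow, Real.norm_eq_abs, sq_abs]
  field_simp

/-- Scaling carries `(0,1]` to `(0,2κ]`; only the germ at `0` matters, which is why `QBound` asks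
for some `d` only. -/
theorem integrableOn_rpow_inQ {γ : ℝ} (hε : |ε| < m) (h : LocIntegrableAtZero γ f) :
    IntegrableOn (fun q : ℝ => q ^ γ * ‖inQ m ε f q‖) (Ioc 0 (2 * kap m ε)) := by
  have hκ := kap_pos hε
  have hc : 0 < (2 * kap m ε)⁻¹ := by positivity
  have h1 : IntervalIntegrable (fun r : ℝ => ‖((r ^ γ : ℝ) : ℂ) * f r‖) volume 0 1 :=
    ((intervalIntegrable_iff_integrableOn_Ioc_of_le zero_le_one).2 h).norm
  have h2 := h1.comp_mul_left (c := (2 * kap m ε)⁻¹)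
  rw [zero_div, one_div, inv_inv, intervalIntegrable_iff_integrableOn_Ioc_of_le (by positivity)] at h2
  have h3 : IntegrableOn (fun q : ℝ => (2 * kap m ε) ^ γ *
      ‖((((2 * kap m ε)⁻¹ * q) ^ γ : ℝ) : ℂ) * f ((2 * kap m ε)⁻¹ * q)‖) (Ioc 0 (2 * kap m ε)) :=
    Integrable.const_mul h2 _
  refine h3.congr_fun (fun q hq => ?_) measurableSet_Ioc
  have hq0 : 0 < q := hq.1
  have hp := Real.rpow_pos_of_pos (mul_pos hc hq0) γ
  simp only [inQ]
  rw [norm_mul, Complex.norm_real, Real.norm_of_nonneg hp.le, ← mul_assoc,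
    ← Real.mul_rpow (by positivity) (by positivity), mul_inv_cancel_left₀ (by positivity),
    show (2 * kap m ε)⁻¹ * q = q / (2 * kap m ε) by ring]

theorem IsBoundState.qBound (h : IsBoundState m lam χ ε f g) (hε : |ε| < m) :
    QBound (gam lam χ) lam χ (ratio m ε) (inQ m ε f) (inQ m ε g) where
  dirac := h.dirac.qDirac hε
  sq_f := integrableOn_sq_inQ hε h.sq_f
  sq_g := integrableOn_sq_inQ hε h.sq_g
  zero hγ := ⟨2 * kap m ε, by have := kap_pos hε; positivity,
    integrableOn_rpow_inQ hε (h.zero_f hγ), integrableOn_rpow_inQ hε (h.zero_g hγ)⟩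

theorem isBigO_of_inQ {s : ℝ} (hε : |ε| < m)
    (h : inQ m ε f =O[𝓝[>] 0] fun q : ℝ => q ^ s) : f =O[𝓝[>] 0] fun r : ℝ => r ^ s := by
  have hκ := kap_pos hε
  have hc : 0 < 2 * kap m ε := by positivity
  have ht : Tendsto (fun r : ℝ => 2 * kap m ε * r) (𝓝[>] 0) (𝓝[>] 0) := by
    refine tendsto_nhdsWithin_iff.2 ⟨?_, ?_⟩
    · have : Tendsto (fun r : ℝ => 2 * kap m ε * r) (𝓝 0) (𝓝 (2 * kap m ε * 0)) :=
        (continuous_const.mul continuous_id).tendsto 0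
      rw [mul_zero] at this
      exact this.mono_left nhdsWithin_le_nhds
    · filter_upwards [self_mem_nhdsWithin] with r hr
      exact mul_pos hc hr
  have h1 := h.comp_tendsto ht
  have h2 : inQ m ε f ∘ (fun r : ℝ => 2 * kap m ε * r) = f := inR_inQ hε f
  rw [h2] at h1
  refine h1.trans ?_
  have h3 : (fun r : ℝ => (2 * kap m ε) ^ s * r ^ s) =O[𝓝[>] 0] fun r : ℝ => r ^ s :=
    (isBigO_refl _ _).const_mul_left _
  refine h3.congr' ?_ EventuallyEq.rfl
  filter_upwards [self_mem_nhdsWithin] with r hr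
  have hr : 0 < r := hr
  simp only [Function.comp]
  rw [Real.mul_rpow hc.le hr.le]

end scaling

/-! ### Bound states transform to analytic solutions -/

section transformed

variable {m lam χ ε : ℝ} {f g : ℝ → ℂ}

theorem tendsto_rpow_mul_of_isBigO {γ : ℝ} (hγ : 0 < γ)
    (hO : f =O[𝓝[>] 0] fun q : ℝ => q ^ (γ - 1)) :
    Tendsto (fun q : ℝ => ((q ^ (γ + 1) : ℝ) : ℂ) * f q) (𝓝[>] 0) (𝓝 0) := by
  have h1 : (fun q : ℝ => ((q ^ (γ + 1) : ℝ) : ℂ)) =O[𝓝[>] 0] fun q : ℝ => q ^ (γ + 1) :=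
    IsBigO.of_norm_left (by simpa using (isBigO_refl _ _).norm_left)
  refine (h1.mul hO).trans_tendsto ?_
  have h2 : Tendsto (fun q : ℝ => q ^ (2 * γ)) (𝓝[>] 0) (𝓝 0) := by
    have := (Real.continuousAt_rpow_const 0 (2 * γ) (Or.inr (by linarith))).tendsto
    rw [Real.zero_rpow (by linarith)] at this
    exact this.mono_left nhdsWithin_le_nhds
  refine h2.congr' ?_
  filter_upwards [self_mem_nhdsWithin] with q hq
  have hq : 0 < q := hq
  rw [← Real.rpow_add hq]; congr 1; ring

/-- Multiply the radial equations by `q` and transform: `q f'` is handled by parts, and `q f`, `q g`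
are derivatives of the transforms. No separate hypothesis on `f'` is needed, since the equations
express `q f'` and `q g'` through functions already in the class. -/
theorem isAnalyticSolution_transform (hχ : lam ^ 2 < χ ^ 2)
    (h : QDirac lam χ (ratio m ε) f g)
    (hf : LaplaceClass (gam lam χ) f) (hg : LaplaceClass (gam lam χ) g)
    (hf0 : f =O[𝓝[>] 0] fun q : ℝ => q ^ (gam lam χ - 1))
    (hg0 : g =O[𝓝[>] 0] fun q : ℝ => q ^ (gam lam χ - 1)) :
    IsAnalyticSolution m lam χ ε (transform (gam lam χ) f) (transform (gam lam χ) g) where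
  analytic_F := analyticOnNhd_transform hf
  analytic_G := analyticOnNhd_transform hg
  lim_F := tendsto_transform_zero hf
  lim_G := tendsto_transform_zero hg
  system := by
    intro z hz
    have hγ := gam_pos hχ
    rw [inv_ratio, ← ratio]
    set k := ratio m ε
    have c1 := (hf.const_mul (-(1 + χ))).add
      ((hg.id_mul.const_mul (k / 2)).add (hg.const_mul lam))
    have c2 := (hg.const_mul (-(1 - χ))).add
      ((hf.id_mul.const_mul ((k : ℂ)⁻¹ / 2)).add (hf.const_mul (-lam)))
    have v1 : ∀ q : ℝ, 0 < q → (-(1 + χ) : ℂ) * f q + (k / 2 * (q * g q) + lam * g q) =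
        q * (-(((1 + χ) / q : ℝ) : ℂ) * f q + ((k / 2 + lam / q : ℝ) : ℂ) * g q) := by
      intro q hq
      have hqc : (q : ℂ) ≠ 0 := by exact_mod_cast hq.ne'
      push_cast; field_simp
    have v2 : ∀ q : ℝ, 0 < q → (-(1 - χ) : ℂ) * g q + ((k : ℂ)⁻¹ / 2 * (q * f q) + -lam * f q) =
        q * (-(((1 - χ) / q : ℝ) : ℂ) * g q + ((k⁻¹ / 2 - lam / q : ℝ) : ℂ) * f q) := by
      intro q hq
      have hqc : (q : ℂ) ≠ 0 := by exact_mod_cast hq.ne'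
      have qq : (q : ℂ) * (q : ℂ)⁻¹ = 1 := mul_inv_cancel₀ hqc
      push_cast
      simp only [div_eq_mul_inv]
      linear_combination ((1 - χ) * g q + lam * f q) * qq
    have p1 := transform_id_mul_deriv hf hγ (c1.congr v1) (fun q hq => (h q hq).1)
      (tendsto_rpow_mul_of_isBigO hγ hf0) hz
    have p2 := transform_id_mul_deriv hg hγ (c2.congr v2) (fun q hq => (h q hq).2)
      (tendsto_rpow_mul_of_isBigO hγ hg0) hz
    rw [← transform_congr v1, transform_add (hf.const_mul _)
      ((hg.id_mul.const_mul _).add (hg.const_mul _)) hz, transform_add (hg.id_mul.const_mul _)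
      (hg.const_mul _) hz, transform_const_mul, transform_const_mul, transform_const_mul] at p1
    rw [← transform_congr v2, transform_add (hg.const_mul _)
      ((hf.id_mul.const_mul _).add (hf.const_mul _)) hz, transform_add (hf.id_mul.const_mul _)
      (hf.const_mul _) hz, transform_const_mul, transform_const_mul, transform_const_mul] at p2
    have d1 := (hasDerivAt_transform hf hz).deriv
    have d2 := (hasDerivAt_transform hg hz).deriv
    push_cast
    constructor
    · linear_combination -p1 - Complex.I * k / 2 * d2 +
        k / 2 * transform (gam lam χ) (fun q => (q : ℂ) * g q) z * Complex.I_sq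
    · linear_combination -p2 - Complex.I * (k : ℂ)⁻¹ / 2 * d1 +
        (k : ℂ)⁻¹ / 2 * transform (gam lam χ) (fun q => (q : ℂ) * f q) z * Complex.I_sq

theorem IsBoundState.transform_properties (h : IsBoundState m lam χ ε f g) (hlam : 0 < lam)
    (hχ : lam ^ 2 < χ ^ 2) (hε : |ε| < m) :
    (f =O[𝓝[>] 0] fun r : ℝ => r ^ (-1 + gam lam χ)) ∧
    (g =O[𝓝[>] 0] fun r : ℝ => r ^ (-1 + gam lam χ)) ∧
    LaplaceClass (gam lam χ) (inQ m ε f) ∧ LaplaceClass (gam lam χ) (inQ m ε g) ∧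
    IsAnalyticSolution m lam χ ε (transform (gam lam χ) (inQ m ε f))
      (transform (gam lam χ) (inQ m ε g)) := by
  have hb := h.qBound hε
  have hγ := gam_pos hχ
  obtain ⟨of, og⟩ := hb.isBigO (ν := etaTilde m lam χ ε) hγ hlam.ne' (ratio_pos hε).ne'
    (gam_sq hχ) (by
      have h1 := lam_mul_ratio (χ := χ) (lam := lam) hε
      have h2 := lam_mul_inv_ratio (χ := χ) (lam := lam) hε
      linarith)
  have lf := laplaceClass_of_isBigO hγ hb.dirac.continuousOn_f of hb.sq_f
  have lg := laplaceClass_of_isBigO hγ hb.dirac.continuousOn_g og hb.sq_g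
  refine ⟨?_, ?_, lf, lg, isAnalyticSolution_transform hχ hb.dirac lf lg of og⟩
  · rw [add_comm, ← sub_eq_add_neg]; exact isBigO_of_inQ hε of
  · rw [add_comm, ← sub_eq_add_neg]; exact isBigO_of_inQ hε og

end transformed

/-! ### Decay and transforms of the polynomial Kummer factors -/

section polynomial

/-- The bound `O(q^{γ-1} e^{-q/4})`, satisfied by the radial eigenfunctions. -/
def ExpDecay (γ : ℝ) (f : ℝ → ℂ) : Prop :=
  ∃ C : ℝ, ∀ q : ℝ, 0 < q → ‖f q‖ ≤ C * (q ^ (γ - 1) * Real.exp (-(q / 4)))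

variable {γ : ℝ} {f g : ℝ → ℂ}

theorem ExpDecay.add (hf : ExpDecay γ f) (hg : ExpDecay γ g) :
    ExpDecay γ (fun q => f q + g q) := by
  obtain ⟨C, hC⟩ := hf
  obtain ⟨D, hD⟩ := hg
  refine ⟨C + D, fun q hq => (norm_add_le _ _).trans ?_⟩
  rw [add_mul]
  exact add_le_add (hC q hq) (hD q hq)

theorem ExpDecay.const_mul (c : ℂ) (hf : ExpDecay γ f) : ExpDecay γ (fun q => c * f q) := by
  obtain ⟨C, hC⟩ := hf
  refine ⟨‖c‖ * C, fun q hq => ?_⟩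
  rw [norm_mul, mul_assoc]
  exact mul_le_mul_of_nonneg_left (hC q hq) (norm_nonneg _)

theorem integrableOn_rpow_mul_exp {s a : ℝ} (hs : -1 < s) (ha : 0 < a) :
    IntegrableOn (fun q : ℝ => q ^ s * Real.exp (-(a * q))) (Ioi 0) := by
  have := integrableOn_rpow_mul_exp_neg_mul_rpow (s := s) (p := 1) (b := a) hs one_pos ha
  simpa using this

theorem ExpDecay.integrableOn (hf : ExpDecay γ f) (hγ : 0 < γ) (hc : ContinuousOn f (Ioi 0)) :
    IntegrableOn f (Ioi 0) := by
  obtain ⟨C, hC⟩ := hf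
  refine Integrable.mono' ((integrableOn_rpow_mul_exp (s := γ - 1) (a := 1 / 4) (by linarith)
    (by norm_num)).const_mul C) (hc.aestronglyMeasurable measurableSet_Ioi)
    ((ae_restrict_iff' measurableSet_Ioi).2 (ae_of_all _ fun q hq => ?_))
  refine (hC q hq).trans_eq ?_
  rw [show q / 4 = 1 / 4 * q by ring]

theorem ExpDecay.isBigO (hf : ExpDecay γ f) : f =O[𝓝[>] 0] fun q : ℝ => q ^ (γ - 1) := by
  obtain ⟨C, hC⟩ := hf
  refine IsBigO.of_bound |C| ?_
  filter_upwards [self_mem_nhdsWithin] with q hq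
  have hq : 0 < q := hq
  have hp := Real.rpow_pos_of_pos hq (γ - 1)
  rw [Real.norm_of_nonneg hp.le]
  refine (hC q hq).trans ?_
  have h1 : Real.exp (-(q / 4)) ≤ 1 := Real.exp_le_one_iff.2 (by linarith)
  have h2 := le_abs_self C
  have : q ^ (γ - 1) * Real.exp (-(q / 4)) ≤ q ^ (γ - 1) := by nlinarith
  have h3 : 0 ≤ q ^ (γ - 1) * Real.exp (-(q / 4)) := by positivity
  calc _ ≤ |C| * (q ^ (γ - 1) * Real.exp (-(q / 4))) := by gcongr
    _ ≤ _ := by gcongr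

theorem ExpDecay.integrableOn_sq (hf : ExpDecay γ f) (hγ : 0 < γ) (hc : ContinuousOn f (Ioi 0)) :
    IntegrableOn (fun q : ℝ => q ^ 2 * ‖f q‖ ^ 2) (Ioi 0) := by
  obtain ⟨C, hC⟩ := hf
  have hcont : ContinuousOn (fun q : ℝ => q ^ 2 * ‖f q‖ ^ 2) (Ioi 0) :=
    ContinuousOn.mul (by fun_prop) (hc.norm.pow 2)
  refine Integrable.mono' ((integrableOn_rpow_mul_exp (s := 2 * γ) (a := 1 / 2) (by linarith)
    (by norm_num)).const_mul (C ^ 2)) (hcont.aestronglyMeasurable measurableSet_Ioi)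
    ((ae_restrict_iff' measurableSet_Ioi).2 (ae_of_all _ fun q hq => ?_))
  have hq : 0 < q := hq
  rw [Real.norm_of_nonneg (by positivity)]
  have h1 := pow_le_pow_left₀ (norm_nonneg _) (hC q hq) 2
  refine (mul_le_mul_of_nonneg_left h1 (sq_nonneg q)).trans_eq ?_
  have e1 : q ^ (2 * γ) = q ^ 2 * (q ^ (γ - 1)) ^ 2 := by
    rw [← Real.rpow_natCast, ← Real.rpow_natCast, ← Real.rpow_mul hq.le, ← Real.rpow_add hq]
    congr 1; push_cast; ring
  have e2 : Real.exp (-(1 / 2 * q)) = Real.exp (-(q / 4)) ^ 2 := by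
    rw [← Real.exp_nat_mul]; congr 1; push_cast; ring
  rw [e1, e2]; ring

theorem ExpDecay.locIntegrableAtZero_inR {m ε : ℝ} (hf : ExpDecay γ f) (hγ : 0 < γ) (hε : |ε| < m)
    (hc : ContinuousOn f (Ioi 0)) : LocIntegrableAtZero γ (inR m ε f) := by
  obtain ⟨C, hC⟩ := hf
  have hκ : 0 < 2 * kap m ε := by have := kap_pos hε; positivity
  have hcont : ContinuousOn (fun r : ℝ => ((r ^ γ : ℝ) : ℂ) * inR m ε f r) (Ioc 0 1) := by
    refine ContinuousOn.mul ?_ ?_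
    · exact Complex.continuous_ofReal.comp_continuousOn
        (continuousOn_id.rpow_const fun x hx => Or.inl (ne_of_gt hx.1))
    · exact hc.comp (by fun_prop) fun r hr => mul_pos hκ hr.1
  have hi : IntegrableOn (fun r : ℝ => |C| * (2 * kap m ε) ^ (γ - 1) * r ^ (2 * γ - 1)) (Ioc 0 1) :=
    Integrable.const_mul (((intervalIntegrable_iff_integrableOn_Ioc_of_le zero_le_one).1
      (intervalIntegral.intervalIntegrable_rpow' (by linarith)))) _
  refine Integrable.mono' hi (hcont.aestronglyMeasurable measurableSet_Ioc)
    ((ae_restrict_iff' measurableSet_Ioc).2 (ae_of_all _ fun r hr => ?_))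
  have hr0 : 0 < r := hr.1
  have h1 := hC _ (mul_pos hκ hr0)
  have hp := Real.rpow_pos_of_pos hr0 γ
  have hp2 := Real.rpow_pos_of_pos (mul_pos hκ hr0) (γ - 1)
  have h2 : Real.exp (-(2 * kap m ε * r / 4)) ≤ 1 :=
    Real.exp_le_one_iff.2 (by have := mul_pos hκ hr0; linarith)
  rw [norm_mul, Complex.norm_real, Real.norm_of_nonneg hp.le]
  have e : r ^ (2 * γ - 1) = r ^ γ * r ^ (γ - 1) := by
    rw [← Real.rpow_add hr0]; congr 1; ring
  calc r ^ γ * ‖inR m ε f r‖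
      ≤ r ^ γ * (C * ((2 * kap m ε * r) ^ (γ - 1) * Real.exp (-(2 * kap m ε * r / 4)))) := by
        gcongr; exact h1
    _ ≤ r ^ γ * (|C| * ((2 * kap m ε * r) ^ (γ - 1) * 1)) := by
        gcongr
        exact le_abs_self C
    _ = _ := by rw [Real.mul_rpow hκ.le hr0.le, e]; ring

/-- The series terminates, and `q^k ≤ 4^k k! e^{q/4}` lets half of the decay of `e^{-q/2}` absorb
the polynomial. -/
theorem expDecay_kummerFactor (hγ : 0 < γ) (n : ℕ) : ExpDecay γ (kummerFactor γ (-(n : ℂ))) := by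
  set b : ℂ := 2 * (γ : ℂ) + 1
  refine ⟨1 / Real.Gamma (2 * γ) * ∑ k ∈ Finset.range (n + 1),
    ‖kummerCoeff (-(n : ℂ)) b k‖ * (4 ^ k * k.factorial), fun q hq => ?_⟩
  have hG : 0 < Real.Gamma (2 * γ) := Real.Gamma_pos_of_pos (by linarith)
  have hp := Real.rpow_pos_of_pos hq (γ - 1)
  have h1 : ‖oneFOne (-(n : ℂ)) b q‖ ≤ (∑ k ∈ Finset.range (n + 1),
      ‖kummerCoeff (-(n : ℂ)) b k‖ * (4 ^ k * k.factorial)) * Real.exp (q / 4) := by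
    rw [oneFOne_neg_natCast, Finset.sum_mul]
    refine (norm_sum_le _ _).trans (Finset.sum_le_sum fun k _ => ?_)
    rw [norm_mul, norm_pow, Complex.norm_real, Real.norm_of_nonneg hq.le, mul_assoc]
    gcongr
    have h2 := Real.pow_div_factorial_le_exp (q / 4) (by positivity) k
    rw [div_le_iff₀ (by positivity), div_pow, div_le_iff₀ (by positivity)] at h2
    linarith
  have e : Real.exp (-(q / 4)) = Real.exp (-(q / 2)) * Real.exp (q / 4) := by
    rw [← Real.exp_add]; congr 1; ring
  rw [kummerFactor, norm_mul, Complex.norm_real, Real.norm_of_nonneg (by positivity), e]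
  calc _ ≤ 1 / Real.Gamma (2 * γ) * q ^ (γ - 1) * Real.exp (-(q / 2)) * ((∑ k ∈ Finset.range (n + 1),
      ‖kummerCoeff (-(n : ℂ)) b k‖ * (4 ^ k * k.factorial)) * Real.exp (q / 4)) := by gcongr
    _ = _ := by ring

/-- `q^{s-1-γ} e^{-q/2}` as a complex function. -/
noncomputable def powerExp (γ s : ℝ) (q : ℝ) : ℂ :=
  ((q ^ (s - 1 - γ) * Real.exp (-(q / 2)) : ℝ) : ℂ)

theorem rpow_mul_powerExp {s : ℝ} {a q : ℝ} (hq : 0 < q) :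
    ((Real.exp (-(a * q)) : ℝ) : ℂ) * (((q ^ γ : ℝ) : ℂ) * powerExp γ s q) =
      ((q ^ (s - 1) * Real.exp (-((1 / 2 + a) * q)) : ℝ) : ℂ) := by
  have e1 : q ^ (s - 1) = q ^ γ * q ^ (s - 1 - γ) := by
    rw [← Real.rpow_add hq]; congr 1; ring
  have e2 : Real.exp (-((1 / 2 + a) * q)) = Real.exp (-(a * q)) * Real.exp (-(q / 2)) := by
    rw [← Real.exp_add]; congr 1; ring
  rw [powerExp, e1, e2]
  push_cast; ring

theorem laplaceClass_powerExp {s : ℝ} (hs : 0 < s) : LaplaceClass γ (powerExp γ s) := by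
  intro a ha
  have h := (integrableOn_rpow_mul_exp (s := s - 1) (a := 1 / 2 + a) (by linarith)
    (by linarith)).ofReal (𝕜 := ℂ)
  exact IntegrableOn.congr_fun h (fun q hq => (rpow_mul_powerExp hq).symm) measurableSet_Ioi

theorem differentiableOn_half_add_cpow (s : ℂ) :
    DifferentiableOn ℂ (fun z : ℂ => (1 / 2 + Complex.I * z) ^ s) lowerHalfPlane := by
  intro z hz
  have h1 : DifferentiableAt ℂ (fun z : ℂ => 1 / 2 + Complex.I * z) z := by fun_prop
  exact (h1.cpow_const (Or.inl (re_pos_of_mem_rightHalfPlane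
    (half_add_mem_rightHalfPlane hz)))).differentiableWithinAt

/-- On the negative imaginary axis this is the real Gamma integral. Both sides are analytic in the
half-plane, so agreement near `z = -i` on that axis propagates by the identity theorem. -/
theorem transform_powerExp {s : ℝ} (hs : 0 < s) {z : ℂ} (hz : z ∈ lowerHalfPlane) :
    transform γ (powerExp γ s) z = Real.Gamma s * (1 / 2 + Complex.I * z) ^ (-(s : ℂ)) := by
  have hA := analyticOnNhd_transform (laplaceClass_powerExp (γ := γ) hs)
  have hB : AnalyticOnNhd ℂ (fun z : ℂ => (Real.Gamma s : ℂ) *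
      (1 / 2 + Complex.I * z) ^ (-(s : ℂ))) lowerHalfPlane :=
    ((differentiableOn_half_add_cpow _).const_mul _).analyticOnNhd isOpen_lowerHalfPlane
  have hreal : ∀ a : ℝ, 0 < a → transform γ (powerExp γ s) (-Complex.I * a) =
      Real.Gamma s * (1 / 2 + Complex.I * (-Complex.I * a)) ^ (-(s : ℂ)) := by
    intro a ha
    have e1 : (1 / 2 + Complex.I * (-Complex.I * a)) = ((1 / 2 + a : ℝ) : ℂ) := by
      push_cast; linear_combination (-a : ℂ) * Complex.I_sq
    have hpos : 0 < 1 / 2 + a := by linarith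
    rw [e1, ← Complex.ofReal_neg, ← Complex.ofReal_cpow hpos.le, transform,
      setIntegral_congr_fun (g := fun q : ℝ =>
        ((q ^ (s - 1) * Real.exp (-((1 / 2 + a) * q)) : ℝ) : ℂ)) measurableSet_Ioi]
    · rw [integral_complex_ofReal, Real.integral_rpow_mul_exp_neg_mul_Ioi hs hpos, one_div (1 / 2 + a),
        Real.inv_rpow hpos.le, ← Real.rpow_neg hpos.le]
      push_cast; ring
    · intro q hq
      simp only
      rw [← rpow_mul_powerExp (γ := γ) hq, transformIntegrand]
      have e2 : -(Complex.I * (-Complex.I * a) * q) = ((-(a * q) : ℝ) : ℂ) := by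
        push_cast; linear_combination (a * q : ℂ) * Complex.I_sq
      rw [e2, ← Complex.ofReal_exp]; ring
  refine hA.eqOn_of_preconnected_of_frequently_eq hB isPreconnected_lowerHalfPlane
    (z₀ := -Complex.I) (by simp [lowerHalfPlane]) ?_ hz
  have ht : Tendsto (fun a : ℝ => -Complex.I * (a : ℂ)) (𝓝[≠] 1) (𝓝[≠] (-Complex.I)) := by
    refine tendsto_nhdsWithin_iff.2 ⟨?_, ?_⟩
    · have : Tendsto (fun a : ℝ => -Complex.I * (a : ℂ)) (𝓝 1) (𝓝 (-Complex.I * ((1 : ℝ) : ℂ))) :=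
        (by fun_prop : Continuous fun a : ℝ => -Complex.I * (a : ℂ)).tendsto 1
      rw [Complex.ofReal_one, mul_one] at this
      exact this.mono_left nhdsWithin_le_nhds
    · filter_upwards [self_mem_nhdsWithin] with a ha h
      refine ha ?_
      have h2 : -Complex.I * (a : ℂ) = -Complex.I := h
      have h3 : (a : ℂ) = 1 := by
        refine mul_left_cancel₀ (neg_ne_zero.2 Complex.I_ne_zero) (h2.trans (mul_one _).symm)
      exact_mod_cast h3
  refine ht.frequently (Eventually.frequently ?_)
  filter_upwards [nhdsWithin_le_nhds (Ioi_mem_nhds (zero_lt_one (α := ℝ)))] with a ha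
  exact hreal a ha

theorem transform_sum {ι : Type*} (S : Finset ι) (c : ι → ℂ) {h : ι → ℝ → ℂ}
    (hh : ∀ i, LaplaceClass γ (h i)) {z : ℂ} (hz : z.im < 0) :
    LaplaceClass γ (fun q => ∑ i ∈ S, c i * h i q) ∧
    transform γ (fun q => ∑ i ∈ S, c i * h i q) z = ∑ i ∈ S, c i * transform γ (h i) z := by
  classical
  induction S using Finset.induction_on with
  | empty =>
    simp only [Finset.sum_empty]
    refine ⟨fun a _ => by simp, by simp [transform, transformIntegrand]⟩
  | insert i S hi ih =>
    simp only [Finset.sum_insert hi]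
    refine ⟨((hh i).const_mul _).add ih.1, ?_⟩
    rw [transform_add ((hh i).const_mul _) ih.1 hz, transform_const_mul, ih.2]

theorem Gamma_add_natCast {s : ℝ} (hs : 0 < s) (k : ℕ) :
    (Real.Gamma (s + k) : ℂ) = (ascPochhammer ℂ k).eval (s : ℂ) * Real.Gamma s := by
  induction k with
  | zero => simp
  | succ k ih =>
    have h0 : s + k ≠ 0 := by positivity
    rw [ascPochhammer_succ_eval, Nat.cast_succ, ← add_assoc, Real.Gamma_add_one h0,
      Complex.ofReal_mul, ih]
    push_cast; ring

theorem kummerFactor_neg_natCast (n : ℕ) {q : ℝ} (hq : 0 < q) :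
    kummerFactor γ (-(n : ℂ)) q = ∑ k ∈ Finset.range (n + 1),
      ((Real.Gamma (2 * γ) : ℂ)⁻¹ * kummerCoeff (-(n : ℂ)) (2 * (γ : ℂ) + 1) k) *
        powerExp γ (2 * γ + k) q := by
  rw [kummerFactor, oneFOne_neg_natCast, Finset.mul_sum]
  refine Finset.sum_congr rfl fun k _ => ?_
  have e : q ^ (2 * γ + k - 1 - γ) = q ^ (γ - 1) * q ^ k := by
    rw [← Real.rpow_natCast, ← Real.rpow_add hq]; congr 1; ring
  rw [powerExp, e]
  push_cast; ring

theorem gaussFactor_neg_natCast (n : ℕ) (z : ℂ) :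
    gaussFactor γ (-(n : ℂ)) z = (1 / 2 + Complex.I * z) ^ (-(2 * (γ : ℂ))) *
      ∑ k ∈ Finset.range (n + 1), kummerCoeff (-(n : ℂ)) (2 * (γ : ℂ) + 1) k *
        (ascPochhammer ℂ k).eval (2 * (γ : ℂ)) * (1 / (1 / 2 + Complex.I * z)) ^ k := by
  rw [gaussFactor, ordinaryHypergeometric_eq_tsum]
  congr 1
  simp only
  rw [tsum_eq_sum (s := Finset.range (n + 1))]
  · refine Finset.sum_congr rfl fun k _ => ?_
    rw [smul_eq_mul, kummerCoeff]
    ring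
  · intro k hk
    rw [Finset.mem_range, not_lt] at hk
    simp [ascPochhammer_eval_neg_natCast_eq_zero (show n < k by omega)]

theorem laplaceClass_kummerFactor (hγ : 0 < γ) (n : ℕ) :
    LaplaceClass γ (kummerFactor γ (-(n : ℂ))) :=
  (transform_sum (z := -Complex.I) (Finset.range (n + 1)) _
    (fun k => laplaceClass_powerExp (γ := γ) (s := 2 * γ + k) (by positivity)) (by simp)).1.congr
    fun _ hq => (kummerFactor_neg_natCast n hq).symm

/-- Transforming term by term multiplies the `k`-th coefficient by `Γ(2γ+k)/Γ(2γ) = (2γ)_k`, the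
additional Pochhammer symbol that distinguishes `₂F₁` from `₁F₁`. -/
theorem transform_kummerFactor (hγ : 0 < γ) (n : ℕ) {z : ℂ} (hz : z ∈ lowerHalfPlane) :
    transform γ (kummerFactor γ (-(n : ℂ))) z = gaussFactor γ (-(n : ℂ)) z := by
  rw [transform_congr (fun q hq => kummerFactor_neg_natCast n hq),
    (transform_sum (Finset.range (n + 1)) _
      (fun k => laplaceClass_powerExp (γ := γ) (s := 2 * γ + k) (by positivity)) hz).2,
    gaussFactor_neg_natCast, Finset.mul_sum]
  refine Finset.sum_congr rfl fun k _ => ?_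
  have hx := ne_zero_of_mem_rightHalfPlane (half_add_mem_rightHalfPlane hz)
  have hG : (Real.Gamma (2 * γ) : ℂ) ≠ 0 := by
    exact_mod_cast (Real.Gamma_pos_of_pos (by linarith : 0 < 2 * γ)).ne'
  rw [transform_powerExp (by positivity) hz, Gamma_add_natCast (by linarith)]
  have e : (1 / 2 + Complex.I * z) ^ (-((2 * γ + k : ℝ) : ℂ)) =
      (1 / 2 + Complex.I * z) ^ (-(2 * (γ : ℂ))) * (1 / (1 / 2 + Complex.I * z)) ^ k := by
    rw [one_div (1 / 2 + Complex.I * z), inv_pow, ← Complex.cpow_natCast, ← Complex.cpow_neg,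
      ← Complex.cpow_add _ _ hx]
    congr 1; push_cast; ring
  rw [e]
  push_cast at hG ⊢
  field_simp

end polynomial

/-! ### Eigenfunctions: existence, nonvanishing, uniqueness -/

section eigenfunctions

variable {m lam χ : ℝ} {n : ℕ}

theorem eigenF_eq_regularF : eigenF m lam χ n =
    regularF (gam lam χ) χ lam (ratio m (energy m lam χ n)) n := by
  ext q
  simp only [eigenF, regularF, cMinus, cPlus, ratio, Complex.ofReal_natCast]

theorem eigenG_eq_regularG : eigenG m lam χ n =
    regularG (gam lam χ) χ lam (ratio m (energy m lam χ n)) n := by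
  ext q
  simp only [eigenG, regularG, cMinus, cPlus, lowerRatio, inv_ratio, Complex.ofReal_natCast]
  rfl

/-- At `η̃ = 0` one has `τ² = χ²`, so `τ = -χ` for `χ < 0`; then `λk = γ + τ = γ - χ`. -/
theorem cPlus_zero (hm : 0 < m) (hlam : 0 < lam) (hχ : lam ^ 2 < χ ^ 2) (hχ0 : χ < 0) :
    cPlus m lam χ 0 = 0 := by
  have hε := abs_energy_lt hm hlam hχ 0
  have hν : etaTilde m lam χ (energy m lam χ 0) = (0 : ℕ) :=
    (etaTilde_eq_iff hm hlam hχ hε 0).2 rfl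
  have h1 := lam_mul_ratio (χ := χ) (lam := lam) hε
  have h2 := tau_sq hχ hε
  have h3 : 0 < lam * m / kap m (energy m lam χ 0) := div_pos (mul_pos hlam hm) (kap_pos hε)
  rw [hν] at h1 h2
  push_cast at h1 h2
  have h4 : lam * m / kap m (energy m lam χ 0) = -χ := by nlinarith
  rw [cPlus, ← ratio]
  linarith

/-- For `n ≥ 1` the parameter `-n+1` is `-(n-1)`. For `n = 0` it equals `1`, where the series does
not terminate, but its coefficient vanishes and any `j` serves. Thus the polynomial results apply to
both terms. -/
theorem exists_cPlus_mul_eq (hm : 0 < m) (hlam : 0 < lam) (hχ : lam ^ 2 < χ ^ 2)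
    (hn : Admissible χ n) : ∃ j : ℕ, ∀ u : ℂ → ℂ,
      (cPlus m lam χ n : ℂ) * u (-(n : ℂ) + 1) = (cPlus m lam χ n : ℂ) * u (-(j : ℂ)) := by
  rcases n with _ | n
  · refine ⟨0, fun u => ?_⟩
    rw [cPlus_zero hm hlam hχ (hn rfl)]
    simp
  · refine ⟨n, fun u => ?_⟩
    congr 2
    push_cast; ring

theorem qDirac_eigen (hm : 0 < m) (hlam : 0 < lam) (hχ : lam ^ 2 < χ ^ 2) :
    QDirac lam χ (ratio m (energy m lam χ n)) (eigenF m lam χ n) (eigenG m lam χ n) := by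
  have hε := abs_energy_lt hm hlam hχ n
  have hν := (etaTilde_eq_iff hm hlam hχ hε n).2 rfl
  have h1 := lam_mul_ratio (χ := χ) (lam := lam) hε
  have h2 := lam_mul_inv_ratio (χ := χ) (lam := lam) hε
  rw [eigenF_eq_regularF, eigenG_eq_regularG]
  exact qDirac_regular (gam_pos hχ) (ratio_pos hε).ne' (gam_sq hχ) (by rw [hν] at h1 h2; linarith)

theorem expDecay_eigen (hm : 0 < m) (hlam : 0 < lam) (hχ : lam ^ 2 < χ ^ 2)
    (hn : Admissible χ n) :
    ExpDecay (gam lam χ) (eigenF m lam χ n) ∧ ExpDecay (gam lam χ) (eigenG m lam χ n) := by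
  obtain ⟨j, hj⟩ := exists_cPlus_mul_eq hm hlam hχ hn
  have h0 := expDecay_kummerFactor (gam_pos hχ) n
  have h1 := expDecay_kummerFactor (gam_pos hχ) j
  have e : ∀ q, (cPlus m lam χ n : ℂ) * kummerFactor (gam lam χ) (-(n : ℂ) + 1) q =
      (cPlus m lam χ n : ℂ) * kummerFactor (gam lam χ) (-(j : ℂ)) q := fun q =>
    hj fun a => kummerFactor (gam lam χ) a q
  constructor
  · have := (h0.const_mul (cMinus m lam χ n)).add (h1.const_mul (cPlus m lam χ n))
    simp only [← e] at this
    exact this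
  · have := (((h0.const_mul (cMinus m lam χ n)).const_mul (-1)).add
      (h1.const_mul (cPlus m lam χ n))).const_mul (lowerRatio m lam χ n)
    simp only [← e, neg_one_mul] at this
    exact this

theorem transform_eigen (hm : 0 < m) (hlam : 0 < lam) (hχ : lam ^ 2 < χ ^ 2)
    (hn : Admissible χ n) :
    LaplaceClass (gam lam χ) (eigenF m lam χ n) ∧ LaplaceClass (gam lam χ) (eigenG m lam χ n) ∧
    ∀ z ∈ lowerHalfPlane,
      transform (gam lam χ) (eigenF m lam χ n) z = PhiF m lam χ n z ∧
      transform (gam lam χ) (eigenG m lam χ n) z = PhiG m lam χ n z := by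
  have hγ := gam_pos hχ
  obtain ⟨j, hj⟩ := exists_cPlus_mul_eq hm hlam hχ hn
  have h0 := laplaceClass_kummerFactor hγ n
  have h1 := laplaceClass_kummerFactor hγ j
  have e : ∀ q, (cPlus m lam χ n : ℂ) * kummerFactor (gam lam χ) (-(n : ℂ) + 1) q =
      (cPlus m lam χ n : ℂ) * kummerFactor (gam lam χ) (-(j : ℂ)) q := fun q =>
    hj fun a => kummerFactor (gam lam χ) a q
  have eF : ∀ q, 0 < q → (cMinus m lam χ n : ℂ) * kummerFactor (gam lam χ) (-(n : ℂ)) q +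
      (cPlus m lam χ n : ℂ) * kummerFactor (gam lam χ) (-(j : ℂ)) q = eigenF m lam χ n q :=
    fun q _ => by rw [eigenF, e]
  have eG : ∀ q, 0 < q → (lowerRatio m lam χ n : ℂ) *
      (-1 * ((cMinus m lam χ n : ℂ) * kummerFactor (gam lam χ) (-(n : ℂ)) q) +
      (cPlus m lam χ n : ℂ) * kummerFactor (gam lam χ) (-(j : ℂ)) q) = eigenG m lam χ n q :=
    fun q _ => by rw [eigenG, e, neg_one_mul]
  have c0 := h0.const_mul (cMinus m lam χ n)
  have c1 := h1.const_mul (cPlus m lam χ n)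
  refine ⟨(c0.add c1).congr eF, (((c0.const_mul (-1)).add c1).const_mul _).congr eG,
    fun z hz => ⟨?_, ?_⟩⟩
  · rw [← transform_congr eF, transform_add c0 c1 hz, transform_const_mul, transform_const_mul,
      transform_kummerFactor hγ n hz, transform_kummerFactor hγ j hz, PhiF]
    rw [hj fun a => gaussFactor (gam lam χ) a z]
  · rw [← transform_congr eG, transform_const_mul, transform_add (c0.const_mul (-1)) c1 hz,
      transform_const_mul, transform_const_mul, transform_const_mul,
      transform_kummerFactor hγ n hz, transform_kummerFactor hγ j hz, PhiG, neg_one_mul]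
    rw [hj fun a => gaussFactor (gam lam χ) a z]

theorem IsAnalyticSolution.congr {ε : ℝ} {F G F₀ G₀ : ℂ → ℂ} (h : IsAnalyticSolution m lam χ ε F G)
    (hFG : ∀ z ∈ lowerHalfPlane, F z = F₀ z ∧ G z = G₀ z) :
    IsAnalyticSolution m lam χ ε F₀ G₀ := by
  have hF : EqOn F F₀ lowerHalfPlane := fun z hz => (hFG z hz).1
  have hG : EqOn G G₀ lowerHalfPlane := fun z hz => (hFG z hz).2
  have hI : ∀ᶠ a : ℝ in atTop, -(Complex.I * (a : ℂ)) ∈ lowerHalfPlane := by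
    filter_upwards [eventually_gt_atTop 0] with a ha
    simpa [lowerHalfPlane] using ha
  refine ⟨h.analytic_F.congr isOpen_lowerHalfPlane hF, h.analytic_G.congr isOpen_lowerHalfPlane hG,
    fun z hz => ?_, h.lim_F.congr' (hI.mono fun a ha => hF ha),
    h.lim_G.congr' (hI.mono fun a ha => hG ha)⟩
  rw [← hF hz, ← hG hz,
    ← (hF.eventuallyEq_of_mem (isOpen_lowerHalfPlane.mem_nhds hz)).deriv_eq,
    ← (hG.eventuallyEq_of_mem (isOpen_lowerHalfPlane.mem_nhds hz)).deriv_eq]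
  exact h.system z hz

theorem InvertsTo.congr {γ : ℝ} {F F₀ : ℂ → ℂ} {q : ℝ} {v : ℂ} (h : InvertsTo γ F q v)
    (hF : ∀ z ∈ lowerHalfPlane, F z = F₀ z) : InvertsTo γ F₀ q v := by
  have e : ∀ (b a : ℝ), 0 < a → inverseIntegrand γ F q b a = inverseIntegrand γ F₀ q b a := by
    intro b a ha
    rw [inverseIntegrand, hF _ (by simpa [lowerHalfPlane] using ha), ← inverseIntegrand]
  refine ⟨fun N => (h.1 N).congr_fun (fun p hp => e p.1 p.2 hp.2)
    (measurableSet_Icc.prod measurableSet_Ioi), h.2.congr fun N => ?_⟩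
  refine intervalIntegral.integral_congr fun b _ => ?_
  exact setIntegral_congr_fun measurableSet_Ioi fun a ha => e b a ha

theorem isBoundState_eigen (hm : 0 < m) (hlam : 0 < lam) (hχ : lam ^ 2 < χ ^ 2)
    (hn : Admissible χ n) :
    IsBoundState m lam χ (energy m lam χ n)
      (inR m (energy m lam χ n) (eigenF m lam χ n))
      (inR m (energy m lam χ n) (eigenG m lam χ n)) := by
  have hε := abs_energy_lt hm hlam hχ n
  have hγ := gam_pos hχ
  have hq := qDirac_eigen (n := n) hm hlam hχ
  obtain ⟨dF, dG⟩ := expDecay_eigen hm hlam hχ hn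
  exact ⟨hq.radialDirac hε,
    memLp_inR hε hq.continuousOn_f (dF.integrableOn_sq hγ hq.continuousOn_f),
    memLp_inR hε hq.continuousOn_g (dG.integrableOn_sq hγ hq.continuousOn_g),
    fun _ => dF.locIntegrableAtZero_inR hγ hε hq.continuousOn_f,
    fun _ => dG.locIntegrableAtZero_inR hγ hε hq.continuousOn_g⟩

theorem exists_eigenF_ne_zero (hlam : 0 < lam) (hχ : lam ^ 2 < χ ^ 2) :
    ∃ q : ℝ, 0 < q ∧ eigenF m lam χ n q ≠ 0 := by
  have hγχ : gam lam χ ≠ χ := by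
    intro h
    have := gam_sq hχ
    rw [h] at this
    nlinarith
  have h := (regular_near_zero (lam := lam) (k := ratio m (energy m lam χ n)) (ν := n)
    (gam_pos hχ) hγχ).2.2
  rw [← eigenF_eq_regularF] at h
  obtain ⟨q, h1, h2⟩ := (h.and self_mem_nhdsWithin).exists
  exact ⟨q, h2, h1⟩

theorem isAnalyticSolution_Phi (hm : 0 < m) (hlam : 0 < lam) (hχ : lam ^ 2 < χ ^ 2)
    (hn : Admissible χ n) :
    IsAnalyticSolution m lam χ (energy m lam χ n) (PhiF m lam χ n) (PhiG m lam χ n) := by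
  obtain ⟨dF, dG⟩ := expDecay_eigen hm hlam hχ hn
  obtain ⟨lF, lG, ht⟩ := transform_eigen hm hlam hχ hn
  exact (isAnalyticSolution_transform hχ (qDirac_eigen hm hlam hχ) lF lG dF.isBigO dG.isBigO).congr ht

/-- By injectivity of the transform, `Φ_n = 0` would make the radial eigenfunction vanish, although
its upper component is nonzero near the origin. -/
theorem exists_Phi_ne_zero (hm : 0 < m) (hlam : 0 < lam) (hχ : lam ^ 2 < χ ^ 2)
    (hn : Admissible χ n) :
    ∃ z ∈ lowerHalfPlane, PhiF m lam χ n z ≠ 0 ∨ PhiG m lam χ n z ≠ 0 := by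
  by_contra hcon
  push Not at hcon
  obtain ⟨lF, -, ht⟩ := transform_eigen hm hlam hχ hn
  obtain ⟨q, hq, hne⟩ := exists_eigenF_ne_zero (m := m) (n := n) hlam hχ
  exact hne (eq_zero_of_transform_eq_zero lF (qDirac_eigen hm hlam hχ).continuousOn_f
    (fun z hz => by rw [(ht z hz).1, (hcon z hz).1]) hq)

theorem exists_transform_ne_zero {ε : ℝ} {f g : ℝ → ℂ} (h : IsBoundState m lam χ ε f g)
    (hlam : 0 < lam) (hχ : lam ^ 2 < χ ^ 2) (hε : |ε| < m)
    (hne : ∃ r : ℝ, 0 < r ∧ (f r ≠ 0 ∨ g r ≠ 0)) :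
    ∃ z ∈ lowerHalfPlane, transform (gam lam χ) (inQ m ε f) z ≠ 0 ∨
      transform (gam lam χ) (inQ m ε g) z ≠ 0 := by
  by_contra hcon
  push Not at hcon
  obtain ⟨-, -, lf, lg, -⟩ := h.transform_properties hlam hχ hε
  have hq := (h.qBound hε).dirac
  obtain ⟨r, hr, hr'⟩ := hne
  have hκ := kap_pos hε
  have hpos : 0 < 2 * kap m ε * r := by positivity
  rw [← inR_inQ hε f, ← inR_inQ hε g] at hr'
  rcases hr' with hr' | hr'
  · exact hr' (eq_zero_of_transform_eq_zero lf hq.continuousOn_f (fun z hz => (hcon z hz).1) hpos)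
  · exact hr' (eq_zero_of_transform_eq_zero lg hq.continuousOn_g (fun z hz => (hcon z hz).2) hpos)

theorem eq_const_mul_of_transform {γ : ℝ} {f f₀ : ℝ → ℂ} {c : ℂ} (hf : LaplaceClass γ f)
    (hf₀ : LaplaceClass γ f₀) (hc : ContinuousOn f (Ioi 0)) (hc₀ : ContinuousOn f₀ (Ioi 0))
    (h : ∀ z ∈ lowerHalfPlane, transform γ f z = c * transform γ f₀ z) {q : ℝ} (hq : 0 < q) :
    f q = c * f₀ q := by
  have h0 := eq_zero_of_transform_eq_zero (hf.add (hf₀.const_mul (-c)))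
    (hc.add (continuousOn_const.mul hc₀)) (fun z hz => by
      rw [transform_add hf (hf₀.const_mul _) hz, transform_const_mul, h z hz]; ring) hq
  linear_combination h0

theorem boundState_unique (hm : 0 < m) (hlam : 0 < lam) (hχ : lam ^ 2 < χ ^ 2)
    (hn : Admissible χ n) {f g : ℝ → ℂ} (h : IsBoundState m lam χ (energy m lam χ n) f g) :
    ∃ c : ℂ, ∀ r : ℝ, 0 < r →
      f r = c * inR m (energy m lam χ n) (eigenF m lam χ n) r ∧
      g r = c * inR m (energy m lam χ n) (eigenG m lam χ n) r := by
  have hε := abs_energy_lt hm hlam hχ n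
  -- Uniqueness of analytic solutions compares nonzero solutions; the zero state is the multiple by
  -- `c = 0`.
  by_cases hne : ∃ r : ℝ, 0 < r ∧ (f r ≠ 0 ∨ g r ≠ 0)
  · obtain ⟨-, -, lf, lg, hs⟩ := h.transform_properties hlam hχ hε
    obtain ⟨lF, lG, ht⟩ := transform_eigen hm hlam hχ hn
    obtain ⟨c, hc⟩ := hs.exists_eq_const_mul (isAnalyticSolution_Phi hm hlam hχ hn) hm hlam hχ hε
      (exists_transform_ne_zero h hlam hχ hε hne) (exists_Phi_ne_zero hm hlam hχ hn)
    have hq := (h.qBound hε).dirac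
    have hq₀ := qDirac_eigen (n := n) hm hlam hχ
    have hκ := kap_pos hε
    refine ⟨c, fun r hr => ?_⟩
    have hpos : 0 < 2 * kap m (energy m lam χ n) * r := by positivity
    rw [← inR_inQ hε f, ← inR_inQ hε g]
    exact ⟨eq_const_mul_of_transform lf lF hq.continuousOn_f hq₀.continuousOn_f
        (fun z hz => by rw [(ht z hz).1, (hc z hz).1]) hpos,
      eq_const_mul_of_transform lg lG hq.continuousOn_g hq₀.continuousOn_g
        (fun z hz => by rw [(ht z hz).2, (hc z hz).2]) hpos⟩
  · push Not at hne
    exact ⟨0, fun r hr => by simp [(hne r hr).1, (hne r hr).2]⟩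

end eigenfunctions

end DiracCoulomb

/-! ### Assembly of the theorem -/

theorem mainTheorem4 (m lam χ : ℝ) (hm : 0 < m) (hlam : 0 < lam) (hχ : lam ^ 2 < χ ^ 2) :
    -- the transform of a bound state exists, is analytic, vanishes at `-i∞` and solves the
    -- transformed equations
    (∀ ε : ℝ, |ε| < m → ∀ f g : ℝ → ℂ, DiracCoulomb.IsBoundState m lam χ ε f g →
      (f =O[nhdsWithin 0 (Set.Ioi 0)] fun r : ℝ => r ^ (-1 + DiracCoulomb.gam lam χ)) ∧
      (g =O[nhdsWithin 0 (Set.Ioi 0)] fun r : ℝ => r ^ (-1 + DiracCoulomb.gam lam χ)) ∧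
      (∀ z ∈ DiracCoulomb.lowerHalfPlane,
        MeasureTheory.IntegrableOn (DiracCoulomb.transformIntegrand (DiracCoulomb.gam lam χ)
          (DiracCoulomb.inQ m ε f) z) (Set.Ioi 0) ∧
        MeasureTheory.IntegrableOn (DiracCoulomb.transformIntegrand (DiracCoulomb.gam lam χ)
          (DiracCoulomb.inQ m ε g) z) (Set.Ioi 0)) ∧
      DiracCoulomb.IsAnalyticSolution m lam χ ε
        (DiracCoulomb.transform (DiracCoulomb.gam lam χ) (DiracCoulomb.inQ m ε f))
        (DiracCoulomb.transform (DiracCoulomb.gam lam χ) (DiracCoulomb.inQ m ε g))) ∧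
    -- analyticity in the lower half-plane forces `η̃ = n` and determines the solution
    (∀ ε : ℝ, |ε| < m → ∀ F G : ℂ → ℂ, DiracCoulomb.IsAnalyticSolution m lam χ ε F G →
      (∃ z ∈ DiracCoulomb.lowerHalfPlane, F z ≠ 0 ∨ G z ≠ 0) →
      ∃ n : ℕ, DiracCoulomb.Admissible χ n ∧
        DiracCoulomb.etaTilde m lam χ ε = n ∧
        DiracCoulomb.eta m lam χ ε = -(n : ℝ) - 2 * DiracCoulomb.gam lam χ ∧
        ∃ c : ℂ, ∀ z ∈ DiracCoulomb.lowerHalfPlane,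
          F z = c * DiracCoulomb.PhiF m lam χ n z ∧ G z = c * DiracCoulomb.PhiG m lam χ n z) ∧
    -- `η̃ = n` is the same as `ε = ε_n`
    (∀ ε : ℝ, |ε| < m → ∀ n : ℕ,
      (DiracCoulomb.etaTilde m lam χ ε = n ↔ ε = DiracCoulomb.energy m lam χ n)) ∧
    -- the bound-state spectrum
    (∀ ε : ℝ, |ε| < m →
      ((∃ f g : ℝ → ℂ, DiracCoulomb.IsBoundState m lam χ ε f g ∧
          ∃ r : ℝ, 0 < r ∧ (f r ≠ 0 ∨ g r ≠ 0)) ↔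
        ∃ n : ℕ, DiracCoulomb.Admissible χ n ∧ ε = DiracCoulomb.energy m lam χ n)) ∧
    -- the transformed eigenfunctions, the radial eigenfunctions, and the inversion
    (∀ n : ℕ, DiracCoulomb.Admissible χ n →
      |DiracCoulomb.energy m lam χ n| < m ∧
      DiracCoulomb.IsAnalyticSolution m lam χ (DiracCoulomb.energy m lam χ n)
        (DiracCoulomb.PhiF m lam χ n) (DiracCoulomb.PhiG m lam χ n) ∧
      (∃ z ∈ DiracCoulomb.lowerHalfPlane,
        DiracCoulomb.PhiF m lam χ n z ≠ 0 ∨ DiracCoulomb.PhiG m lam χ n z ≠ 0) ∧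
      DiracCoulomb.IsBoundState m lam χ (DiracCoulomb.energy m lam χ n)
        (DiracCoulomb.inR m (DiracCoulomb.energy m lam χ n) (DiracCoulomb.eigenF m lam χ n))
        (DiracCoulomb.inR m (DiracCoulomb.energy m lam χ n) (DiracCoulomb.eigenG m lam χ n)) ∧
      (∃ q : ℝ, 0 < q ∧
        (DiracCoulomb.eigenF m lam χ n q ≠ 0 ∨ DiracCoulomb.eigenG m lam χ n q ≠ 0)) ∧
      (∀ f g : ℝ → ℂ, DiracCoulomb.IsBoundState m lam χ (DiracCoulomb.energy m lam χ n) f g →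
        ∃ c : ℂ, ∀ r : ℝ, 0 < r →
          f r = c * DiracCoulomb.inR m (DiracCoulomb.energy m lam χ n)
            (DiracCoulomb.eigenF m lam χ n) r ∧
          g r = c * DiracCoulomb.inR m (DiracCoulomb.energy m lam χ n)
            (DiracCoulomb.eigenG m lam χ n) r) ∧
      (∀ z ∈ DiracCoulomb.lowerHalfPlane,
        DiracCoulomb.transform (DiracCoulomb.gam lam χ) (DiracCoulomb.eigenF m lam χ n) z
          = DiracCoulomb.PhiF m lam χ n z ∧
        DiracCoulomb.transform (DiracCoulomb.gam lam χ) (DiracCoulomb.eigenG m lam χ n) z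
          = DiracCoulomb.PhiG m lam χ n z) ∧
      (∀ q : ℝ, q ≠ 0 →
        DiracCoulomb.InvertsTo (DiracCoulomb.gam lam χ) (DiracCoulomb.PhiF m lam χ n) q
          (if 0 < q then DiracCoulomb.eigenF m lam χ n q else 0) ∧
        DiracCoulomb.InvertsTo (DiracCoulomb.gam lam χ) (DiracCoulomb.PhiG m lam χ n) q
          (if 0 < q then DiracCoulomb.eigenG m lam χ n q else 0))) := by 
  open DiracCoulomb in
  refine ⟨fun ε hε f g h => ?_, fun ε hε F G h hne => ?_,
    fun ε hε n => etaTilde_eq_iff hm hlam hχ hε n, fun ε hε => ⟨?_, ?_⟩, fun n hn => ?_⟩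
  · obtain ⟨of, og, lf, lg, hs⟩ := h.transform_properties hlam hχ hε
    exact ⟨of, og, fun z hz => ⟨lf.integrableOn_transformIntegrand hz,
      lg.integrableOn_transformIntegrand hz⟩, hs⟩
  · obtain ⟨n, hn, hν⟩ := h.exists_nat hm hlam hχ hε hne
    refine ⟨n, hn, hν, ?_, ?_⟩
    -- By definition `η + η̃ = -2γ`.
    · rw [← hν]
      simp only [eta, etaTilde]
      ring
    · obtain rfl := (etaTilde_eq_iff hm hlam hχ hε n).1 hν
      exact h.exists_eq_const_mul (isAnalyticSolution_Phi hm hlam hχ hn) hm hlam hχ hε hne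
        (exists_Phi_ne_zero hm hlam hχ hn)
  · rintro ⟨f, g, h, hne⟩
    obtain ⟨-, -, -, -, hs⟩ := h.transform_properties hlam hχ hε
    obtain ⟨n, hn, hν⟩ := hs.exists_nat hm hlam hχ hε (exists_transform_ne_zero h hlam hχ hε hne)
    exact ⟨n, hn, (etaTilde_eq_iff hm hlam hχ hε n).1 hν⟩
  · rintro ⟨n, hn, rfl⟩
    obtain ⟨q, hq, hne⟩ := exists_eigenF_ne_zero (m := m) (n := n) hlam hχ
    have hκ := kap_pos hε
    refine ⟨_, _, isBoundState_eigen hm hlam hχ hn, q / (2 * kap m (energy m lam χ n)),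
      by positivity, Or.inl ?_⟩
    -- The witness is the radius corresponding to a `q` at which the eigenfunction does not vanish.
    change inQ m _ (inR m _ _) q ≠ 0
    rwa [inQ_inR hε]
  · have hε := abs_energy_lt hm hlam hχ n
    have hγ := gam_pos hχ
    have hd := qDirac_eigen (n := n) hm hlam hχ
    obtain ⟨dF, dG⟩ := expDecay_eigen hm hlam hχ hn
    obtain ⟨lF, lG, ht⟩ := transform_eigen hm hlam hχ hn
    obtain ⟨q, hq, hne⟩ := exists_eigenF_ne_zero (m := m) (n := n) hlam hχ
    exact ⟨hε, isAnalyticSolution_Phi hm hlam hχ hn, exists_Phi_ne_zero hm hlam hχ hn,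
      isBoundState_eigen hm hlam hχ hn, ⟨q, hq, Or.inl hne⟩,
      fun f g h => boundState_unique hm hlam hχ hn h, ht, fun q hq =>
      ⟨(invertsTo_transform hγ lF (dF.integrableOn hγ hd.continuousOn_f) hq
          fun h => (hd q h).1.differentiableAt).congr fun z hz => (ht z hz).1,
        (invertsTo_transform hγ lG (dG.integrableOn hγ hd.continuousOn_g) hq
          fun h => (hd q h).2.differentiableAt).congr fun z hz => (ht z hz).2⟩⟩
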